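/- **Theorem 1.** *Setting.* Let $f(w)=\mathbb E_{\xi\sim\mathcal D}[f(w;\xi)]$, $w\in\mathbb R^d$, have an $L$-Lipschitz gradient and a $\rho$-Lipschitz Hessian, with noise bounded by $\|\nabla f(w)-\nabla f(w;\xi)\|^2\le\sigma^2$, and let $\Delta$ be an upper bound of $f(w_0)-\inf f$. With i.i.d. samples $\xi_t\sim\mathcal D$, run, from $w_0\in\mathbb R^d$ and $m_{-1}=0$, $$g_t=\nabla f(w_t;\xi_t),\qquad m_t=\beta m_{t-1}+g_t,\qquad w_{t+1}=w_t-\hat\eta_t m_t ,$$ where $\hat\eta_t=r$ if $t\equiv 0 \pmod{\mathcal T_{thred}}$ and $\hat\eta_t=\eta$ otherwise, and suppose that $\|m_t\|\le c_m$ almost surely for all $t$. Write $\mathbb E_t[\cdot]=\mathbb E[\cdot\mid w_1,\dots,w_t]$ and $H_t=\nabla^2 f(w_t)$. Assume the following for all $t$. - *CNC:* whenever $\|\nabla f(w_t)\|\le\epsilon$ and $H_t$ has an eigenvalue smaller than $-\epsilon$, $\mathbb E_t[\langle m_t,v_t\rangle^2]\ge\gamma$, where $v_t$ is a unit eigenvector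 for the smallest eigenvalue of $H_t$, determined by $w_1,\dots,w_t$. - *APAG:* whenever $\|\nabla f(w_t)\|\ge\epsilon$, $\mathbb E_t[\langle\nabla f(w_t),m_t-g_t\rangle]\ge-\frac12\|\nabla f(w_t)\|^2$. - *APCG:* whenever $\|\nabla f(w_t)\|\le\epsilon$ and $\lambda_{\min}(H_t)\le-\epsilon$, for every integer $1\le k\le\mathcal T_{thred}-1$, $\mathbb E_t[\langle\nabla f(w_t),M_{t,k}m_t\rangle]\ge-c'\eta\|M_{t,k}\|_2\|\nabla f(w_t)\|^2$, where $M_{t,k}=\big(\prod_{s=1}^{\mathcal T_{thred}-1}G_{s,t}\big)\big(\prod_{s=k}^{\mathcal T_{thred}-1}G_{s,t}\big)$ and $G_{s,t}=I-\eta\sum_{j=1}^s\beta^{s-j}H_t$. - *GrACE:* $\mathbb E_t\big[\hat\eta_t\langle\nabla f(w_t),g_t-m_t\rangle+\frac{\hat\eta_t^2}{2}m_t^\top H_t m_t\big]\le\hat\eta_t^2c_h$. Without loss of generality $L,\rho,\sigma^2,c_m,c',c_h\ge1$ and $\gamma\le 1$; let $\gamma>0$, $0<\epsilon\le1$, $0<\delta<1$,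 $0\le\beta<1$. Put $A=\frac{Lc_m\sigma^2\rho c'c_h}{(1-\beta)\delta\gamma\epsilon}$ and assume $A\ge2$ (which holds for instance if $\delta\le\frac12$ or $\epsilon\le\frac12$). *Claim.* There are absolute constants $c_0,c_1,c_2,c_3,C>0$ such that the following holds in this setting. Set $$r=\frac{c_0\,\delta\gamma\epsilon^2}{c_m^3\rho L\sigma^2c_h},\qquad \eta=\delta^2\gamma^2\epsilon^5c_\eta\ \text{ with }\ 0<c_\eta\le\frac{c_1}{c_m^5\rho L^2\sigma^2c'c_h},\qquad \mathcal T_{thred}\ge\frac{c_3(1-\beta)}{\eta\epsilon}\log A,$$ $$\mathcal F_{thred}=\frac{c_2\,\delta\gamma^2\epsilon^4}{c_m^4\rho^2L\sigma^4c_h},\qquad T=\frac{2\,\mathcal T_{thred}\,\Delta}{\delta\,\mathcal F_{thred}},$$ where $\mathcal T_{thred}$ is an integer, $\eta\le r/\sqrt{\mathcal T_{thred}}$, and $\beta$ is not too close to $1$: $$L(1-\beta)^3>1,\quad \sigma^2(1-\beta)^3>1,\quad c'(1-\beta)^2>1,\quad \eta\le\tfrac{1-\beta}{L},\quad \eta\le\tfrac{1-\beta}{\epsilon},\quad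 \mathcal T_{thred}\ge1+\tfrac{2\beta}{1-\beta}.$$ Then a point drawn uniformly (and independently of the run) from $w_0,w_{\mathcal T_{thred}},w_{2\mathcal T_{thred}},\dots,w_{K\mathcal T_{thred}}$, $K=\lfloor T/\mathcal T_{thred}\rfloor$, is with probability at least $1-\delta$ an $(\epsilon,\epsilon)$-second-order stationary point of $f$, that is, a point $w$ with $\|\nabla f(w)\|\le\epsilon$ and $\nabla^2f(w)\succeq-\epsilon I$. If moreover $\mathcal T_{thred}$ is the least integer with $\mathcal T_{thred}\ge\frac{c_3(1-\beta)}{\eta\epsilon}\log A$, then $$\mathcal T_{thred}\le \frac{C}{\delta^2\gamma^2c_\eta}\,(1-\beta)\log(A)\,\epsilon^{-6},\qquad T\le C\,\frac{\Delta\,c_m^4\rho^2L\sigma^4c_h}{\delta^4\gamma^4c_\eta}\,(1-\beta)\log(A)\,\epsilon^{-10}.$$ -/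

import Mathlib

open MeasureTheory ProbabilityTheory

noncomputable section

/-- The parameter space `ℝ^d` with its Euclidean norm. -/
abbrev Vec (d : ℕ) := EuclideanSpace ℝ (Fin d)

/-- The Hessian of `f` at `w`, as a continuous linear operator. -/
def hess {d : ℕ} (f : Vec d → ℝ) (w : Vec d) : Vec d →L[ℝ] Vec d :=
  fderiv ℝ (gradient f) w

/-- The objective `f(w) = 𝔼_{ξ ∼ D} [f(w; ξ)]`. -/
def objective {d : ℕ} {Ξ : Type*} [MeasurableSpace Ξ] (D : Measure Ξ)
    (F : Vec d → Ξ → ℝ) : Vec d → ℝ :=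
  fun w => ∫ x, F w x ∂D

/-- The stochastic gradient `∇ f(w; ξ)` (gradient in `w`). -/
def stochGrad {d : ℕ} {Ξ : Type*} (F : Vec d → Ξ → ℝ) (w : Vec d) (x : Ξ) : Vec d :=
  gradient (fun u => F u x) w

/-- `w` is an `(ε, ε)`-second-order stationary point: `‖∇f(w)‖ ≤ ε` and `∇²f(w) ⪰ -ε I`. -/
def IsSOSP {d : ℕ} (f : Vec d → ℝ) (ε : ℝ) (w : Vec d) : Prop :=
  ‖gradient f w‖ ≤ ε ∧ ∀ x : Vec d, -ε * ‖x‖ ^ 2 ≤ inner ℝ x (hess f w x)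

/-- The stochastic objective: `f(w) = 𝔼[f(w; ξ)]` has an `L`-Lipschitz gradient and a
`ρ`-Lipschitz Hessian, and the noise of the stochastic gradient is bounded,
`‖∇f(w) - ∇f(w; ξ)‖² ≤ σ²`. -/
structure SmoothStochastic {d : ℕ} {Ξ : Type*} [MeasurableSpace Ξ] (D : Measure Ξ)
    (F : Vec d → Ξ → ℝ) (L ρ σ : ℝ) : Prop where
  integrable : ∀ w, Integrable (F w) D
  differentiable : ∀ᵐ x ∂D, Differentiable ℝ (fun w => F w x)
  measurable_grad : Measurable (fun p : Vec d × Ξ => stochGrad F p.1 p.2)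
  contDiff : ContDiff ℝ 2 (objective D F)
  lipschitz_grad : ∀ w w' : Vec d,
    ‖gradient (objective D F) w - gradient (objective D F) w'‖ ≤ L * ‖w - w'‖
  lipschitz_hess : ∀ w w' : Vec d,
    ‖hess (objective D F) w - hess (objective D F) w'‖ ≤ ρ * ‖w - w'‖
  noise : ∀ᵐ x ∂D, ∀ w : Vec d,
    ‖gradient (objective D F) w - stochGrad F w x‖ ^ 2 ≤ σ ^ 2

/-- The samples `ξ_0, ξ_1, …` are independent with common law `D`. -/
structure IIDSamples {Ξ Ω : Type*} [MeasurableSpace Ξ] [MeasurableSpace Ω]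
    (P : Measure Ω) (D : Measure Ξ) (ξ : ℕ → Ω → Ξ) : Prop where
  measurable : ∀ t, Measurable (ξ t)
  indep : iIndepFun ξ P
  law : ∀ t, P.map (ξ t) = D

/-- The learning rate at time `t`: the large step `r` if `t mod τ = 0`, and `η` otherwise. -/
def stepSize (r η : ℝ) (τ t : ℕ) : ℝ := if t % τ = 0 then r else η

/-- `w`, `g`, `m` are the iterates, the stochastic gradients and the momenta of SGD with
heavy-ball momentum `β`, with a step of size `r` every `τ` iterations and `η` otherwise
(with the convention `m_{-1} = 0`). -/
structure HeavyBall {d : ℕ} {Ξ Ω : Type*} (F : Vec d → Ξ → ℝ) (ξ : ℕ → Ω → Ξ)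
    (w₀ : Vec d) (β r η : ℝ) (τ : ℕ) (w g m : ℕ → Ω → Vec d) : Prop where
  init : ∀ ω, w 0 ω = w₀
  grad : ∀ t ω, g t ω = stochGrad F (w t ω) (ξ t ω)
  momentum_zero : ∀ ω, m 0 ω = g 0 ω
  momentum_succ : ∀ t ω, m (t + 1) ω = β • m t ω + g (t + 1) ω
  update : ∀ t ω, w (t + 1) ω = w t ω - stepSize r η τ t • m t ω

/-- The σ-algebra generated by `w_1, …, w_t`; `𝔼_t` is the conditional expectation
given it. -/
abbrev past {d : ℕ} {Ω : Type*} (w : ℕ → Ω → Vec d) (t : ℕ) : MeasurableSpace Ω :=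
  ⨆ i ∈ Finset.Icc 1 t, MeasurableSpace.comap (w i) inferInstance

/-- The conditional expectation `𝔼_t[X] = 𝔼[X | w_1, …, w_t]`. -/
def condE {d : ℕ} {Ω : Type*} [MeasurableSpace Ω] (P : Measure Ω) (w : ℕ → Ω → Vec d)
    (t : ℕ) (X : Ω → ℝ) : Ω → ℝ :=
  P[X | past w t]

/-- The set of eigenvalues of an operator. -/
def eigenvalues {d : ℕ} (H : Vec d →L[ℝ] Vec d) : Set ℝ :=
  {μ | Module.End.HasEigenvalue (H : Vec d →ₗ[ℝ] Vec d) μ}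

/-- `v` is a unit eigenvector of `H` for the smallest eigenvalue of `H`. -/
def IsMinEigenvector {d : ℕ} (H : Vec d →L[ℝ] Vec d) (v : Vec d) : Prop :=
  ‖v‖ = 1 ∧ ∃ μ, IsLeast (eigenvalues H) μ ∧ H v = μ • v

/-- Correlated Negative Curvature with parameter `γ`: whenever `‖∇f(w_t)‖ ≤ ε` and `∇²f(w_t)`
has an eigenvalue smaller than `-ε`, one has `𝔼_t[⟨m_t, v_t⟩²] ≥ γ`, where `v_t` (a function of
the past) is a unit eigenvector for the smallest eigenvalue of `∇²f(w_t)`. -/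
def CNC {d : ℕ} {Ω : Type*} [MeasurableSpace Ω] (P : Measure Ω) (f : Vec d → ℝ) (ε γ : ℝ)
    (w m : ℕ → Ω → Vec d) : Prop :=
  ∃ v : ℕ → Ω → Vec d, (∀ t, StronglyMeasurable[past w t] (v t)) ∧
    ∀ t, ∀ᵐ ω ∂P, ‖gradient f (w t ω)‖ ≤ ε →
      (∃ μ ∈ eigenvalues (hess f (w t ω)), μ < -ε) →
      IsMinEigenvector (hess f (w t ω)) (v t ω) ∧
        γ ≤ condE P w t (fun ω' => (inner ℝ (m t ω') (v t ω')) ^ 2) ω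

/-- Almost Positively Aligned with Gradient, at the times when `‖∇f(w_t)‖ ≥ ε`. -/
def APAG {d : ℕ} {Ω : Type*} [MeasurableSpace Ω] (P : Measure Ω) (f : Vec d → ℝ) (ε : ℝ)
    (w g m : ℕ → Ω → Vec d) : Prop :=
  ∀ t, ∀ᵐ ω ∂P, ε ≤ ‖gradient f (w t ω)‖ →
    -(1 / 2) * ‖gradient f (w t ω)‖ ^ 2 ≤
      condE P w t (fun ω' => inner ℝ (gradient f (w t ω')) (m t ω' - g t ω')) ω

/-- `G_s = I - η (∑_{j=1}^s β^{s-j}) H`. -/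
def gOp {d : ℕ} (η β : ℝ) (H : Vec d →L[ℝ] Vec d) (s : ℕ) : Vec d →L[ℝ] Vec d :=
  1 - (η * ∑ j ∈ Finset.Icc 1 s, β ^ (s - j)) • H

/-- The product `G_a G_{a+1} ⋯ G_{b-1}`. -/
def gProd {d : ℕ} (η β : ℝ) (H : Vec d →L[ℝ] Vec d) (a b : ℕ) : Vec d →L[ℝ] Vec d :=
  ((List.Ico a b).map (gOp η β H)).prod

/-- `M = (∏_{s=1}^{τ-1} G_s) (∏_{s=k}^{τ-1} G_s)`. -/
def mOp {d : ℕ} (η β : ℝ) (τ k : ℕ) (H : Vec d →L[ℝ] Vec d) : Vec d →L[ℝ] Vec d :=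
  gProd η β H 1 τ * gProd η β H k τ

/-- Almost Positively Correlated with Gradient, with parameter `τ` and constant `c'`, at the times
when `‖∇f(w_t)‖ ≤ ε` and `λ_min(∇²f(w_t)) ≤ -ε`. -/
def APCG {d : ℕ} {Ω : Type*} [MeasurableSpace Ω] (P : Measure Ω) (f : Vec d → ℝ)
    (ε η β : ℝ) (τ : ℕ) (c' : ℝ) (w m : ℕ → Ω → Vec d) : Prop :=
  ∀ k, 1 ≤ k → k + 1 ≤ τ → ∀ t, ∀ᵐ ω ∂P, ‖gradient f (w t ω)‖ ≤ ε →
    (∃ μ ∈ eigenvalues (hess f (w t ω)), μ ≤ -ε) →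
    -(c' * η * ‖mOp η β τ k (hess f (w t ω))‖ * ‖gradient f (w t ω)‖ ^ 2) ≤
      condE P w t (fun ω' => inner ℝ (gradient f (w t ω'))
        (mOp η β τ k (hess f (w t ω')) (m t ω'))) ω

/-- Gradient Alignment or Curvature Exploitation with constant `c_h`, where `h t` is the step
size of the update at time `t`. -/
def GrACE {d : ℕ} {Ω : Type*} [MeasurableSpace Ω] (P : Measure Ω) (f : Vec d → ℝ)
    (h : ℕ → ℝ) (c_h : ℝ) (w g m : ℕ → Ω → Vec d) : Prop :=
  ∀ t, ∀ᵐ ω ∂P,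
    condE P w t (fun ω' => h t * inner ℝ (gradient f (w t ω')) (g t ω' - m t ω')
      + h t ^ 2 / 2 * inner ℝ (m t ω') (hess f (w t ω') (m t ω'))) ω ≤ h t ^ 2 * c_h

/-- The law of the returned point: `w_{kτ}` for an index `k` that is uniform on `{0, …, K}` and
independent of the run. -/
def returnLaw {d : ℕ} {Ω : Type*} [MeasurableSpace Ω] (P : Measure Ω) (w : ℕ → Ω → Vec d)
    (τ K : ℕ) : Measure (Vec d) :=
  (P.prod (PMF.uniformOfFintype (Fin (K + 1))).toMeasure).map
    (fun p : Ω × Fin (K + 1) => w ((p.2 : ℕ) * τ) p.1)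

/-- The quantity `L c_m σ² ρ c' c_h / ((1-β) δ γ ε)` inside the logarithm. -/
def logArg (L ρ σ c_m c' c_h γ δ β ε : ℝ) : ℝ :=
  L * c_m * σ ^ 2 * ρ * c' * c_h / ((1 - β) * δ * γ * ε)

end

noncomputable section

set_option linter.unusedSectionVars false

/-! ### Taylor estimates under Lipschitz gradient and Hessian -/

section Calculus

variable {d : ℕ} {f : Vec d → ℝ} {L ρ : ℝ}

/-! The proof is an amortized descent argument over periods of `τ` steps, each starting with the
large step `r`. Write `K` for the threshold decrease. A period started at a point that is not
second-order stationary lowers the expected objective by at least `K`, and one started at a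
stationary point raises it by at most `δK/2` (`integral_period_le`, integrated over events of the
past). Telescoping against the total budget `Δ` over `n ≥ 2Δ/(δK)` periods forces the stationary
fraction to be at least `1 - δ` (`sum_prob_isSOSP_ge`).

If the gradient is large, the decrease comes from the large step through APAG, while GrACE limits
the increase over the remaining small steps (`setIntegral_period_le_of_large_gradient`).

If the gradient is small but the Hessian `H` has an eigenvalue below `-ε`, suppose the decrease is
less than `K`. Then GrACE bounds the integrated squared gradients along the period, so the
mean-square displacement grows at most linearly in time (`setIntegral_normSq_displacement_le`). On
the other hand the displacement obeys a perturbed linear recursion with operators `G_s = I - ηθ_s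
H`, where `θ_s` is the geometric weight. CNC puts mass on the lowest eigenvector, where `Q = G_1 ⋯
G_{τ-1}` attains its norm, so the unperturbed part has mean square at least `r²γ‖Q‖²`. The cross
terms are controlled by APCG, by mean-zero noise, by the sign of the inherited momentum, and by
Taylor bounds (`normSq_displacement_ge`). Dividing by `‖Q‖²`, a random but past-measurable quantity,
gives `saddle_growth`. Since `1/‖Q‖²` is exponentially small in `ηετ/(1-β)`, linear growth
contradicts this lower bound once `τ` exceeds a multiple of `(1-β) log A / (ηε)`
(`AdmissibleParameters.escape`). -/

theorem contDiff_gradient (hf : ContDiff ℝ 2 f) : ContDiff ℝ 1 (gradient f) := by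
  have h : ContDiff ℝ 1 (fderiv ℝ f) := hf.fderiv_right (by norm_num)
  exact (InnerProductSpace.toDual ℝ (Vec d)).symm.contDiff.comp h

theorem hasFDerivAt_gradient (hf : ContDiff ℝ 2 f) (w : Vec d) :
    HasFDerivAt (gradient f) (hess f w) w :=
  ((contDiff_gradient hf).differentiable (by norm_num) w).hasFDerivAt

theorem hasGradientAt_of_contDiff (hf : ContDiff ℝ 2 f) (w : Vec d) :
    HasGradientAt f (gradient f w) w :=
  (hf.differentiable (by norm_num) w).hasGradientAt

theorem continuous_gradient (hf : ContDiff ℝ 2 f) : Continuous (gradient f) :=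
  (contDiff_gradient hf).continuous

theorem continuous_hess (hf : ContDiff ℝ 2 f) : Continuous (hess f) :=
  (contDiff_gradient hf).continuous_fderiv (by norm_num)

theorem inner_hess_comm (hf : ContDiff ℝ 2 f) (w x y : Vec d) :
    inner ℝ (hess f w x) y = inner ℝ x (hess f w y) := by
  have hs : IsSymmSndFDerivAt ℝ f w := hf.contDiffAt.isSymmSndFDerivAt (by simp)
  have h1 : ∀ x y : Vec d, inner ℝ (hess f w x) y = fderiv ℝ (fderiv ℝ f) w x y := by
    intro x y
    have h2 : HasFDerivAt (fun u => inner ℝ (gradient f u) y)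
        ((innerSL ℝ y).comp (hess f w)) w := by
      have := ((innerSL ℝ y).hasFDerivAt (x := gradient f w)).comp w (hasFDerivAt_gradient hf w)
      refine this.congr_of_eventuallyEq (Filter.Eventually.of_forall fun u => ?_)
      simp
    have h3 : (fun u => inner ℝ (gradient f u) y) = fun u => fderiv ℝ f u y := by
      funext u
      simp [gradient]
    have h4 : HasFDerivAt (fun u => fderiv ℝ f u y)
        ((ContinuousLinearMap.apply ℝ ℝ y).comp (fderiv ℝ (fderiv ℝ f) w)) w := by
      have h5 : ContDiff ℝ 1 (fderiv ℝ f) := hf.fderiv_right (by norm_num)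
      exact ((ContinuousLinearMap.apply ℝ ℝ y).hasFDerivAt (x := fderiv ℝ f w)).comp w
        (h5.differentiable (by norm_num) w).hasFDerivAt
    rw [h3] at h2
    have h6 := congrArg (fun T => T x) (h2.unique h4)
    simpa [real_inner_comm] using h6
  rw [h1, real_inner_comm, h1, hs]

theorem norm_hess_le (hL : 0 ≤ L)
    (hlip : ∀ w w' : Vec d, ‖gradient f w - gradient f w'‖ ≤ L * ‖w - w'‖) (w : Vec d) :
    ‖hess f w‖ ≤ L :=
  norm_fderiv_le_of_lip' ℝ hL (Filter.Eventually.of_forall fun x => hlip x w)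

/-- Mean value inequality on the ball of radius `‖u‖` about `w`, where the Hessian is within `ρ‖u‖`
of its value at the centre. The sharper factor 1/2 from integration is not needed. -/
theorem norm_gradient_add_sub_le (hf : ContDiff ℝ 2 f) (hρ : 0 ≤ ρ)
    (hlip : ∀ w w' : Vec d, ‖hess f w - hess f w'‖ ≤ ρ * ‖w - w'‖) (w u : Vec d) :
    ‖gradient f (w + u) - gradient f w - hess f w u‖ ≤ ρ * ‖u‖ ^ 2 := by
  have h := (convex_closedBall w ‖u‖).norm_image_sub_le_of_norm_hasFDerivWithin_le'
    (f := gradient f) (f' := hess f) (φ := hess f w) (C := ρ * ‖u‖) (x := w) (y := w + u)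
    (fun x _ => (hasFDerivAt_gradient hf x).hasFDerivWithinAt)
    (fun x hx => (hlip x w).trans (by
      rw [Metric.mem_closedBall, dist_eq_norm] at hx
      gcongr))
    (by simp) (by simp)
  simpa [pow_two, mul_assoc] using h

/-- Along the segment from `w` to `w + u`, the derivative of the quadratic Taylor remainder is the
pairing of `u` with the first-order remainder of the gradient, hence is at most `ρ‖u‖³`. -/
theorem abs_apply_add_sub_quadratic_le (hf : ContDiff ℝ 2 f) (hρ : 0 ≤ ρ)
    (hlip : ∀ w w' : Vec d, ‖hess f w - hess f w'‖ ≤ ρ * ‖w - w'‖) (w u : Vec d) :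
    |f (w + u) - f w - inner ℝ (gradient f w) u - 1 / 2 * inner ℝ u (hess f w u)|
      ≤ ρ * ‖u‖ ^ 3 := by
  set φ : ℝ → ℝ := fun s => f (w + s • u) - s * inner ℝ (gradient f w) u
    - s ^ 2 / 2 * inner ℝ u (hess f w u) with hφ
  have hd : ∀ s : ℝ, HasDerivAt φ (inner ℝ (gradient f (w + s • u)) u
      - inner ℝ (gradient f w) u - s * inner ℝ u (hess f w u)) s := by
    intro s
    have h1 : HasDerivAt (fun s : ℝ => w + s • u) u s := by
      simpa using ((hasDerivAt_id s).smul_const u).const_add w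
    have h2 : HasDerivAt (fun s : ℝ => f (w + s • u)) (inner ℝ (gradient f (w + s • u)) u) s := by
      have := (hasGradientAt_of_contDiff hf (w + s • u)).hasFDerivAt.comp_hasDerivAt s h1
      exact this.congr_deriv (by simp)
    have h3 : HasDerivAt (fun s : ℝ => s * inner ℝ (gradient f w) u)
        (inner ℝ (gradient f w) u) s := by
      simpa using (hasDerivAt_id s).mul_const (inner ℝ (gradient f w) u)
    have h4 : HasDerivAt (fun s : ℝ => s ^ 2 / 2 * inner ℝ u (hess f w u))
        (s * inner ℝ u (hess f w u)) s := by
      have := ((hasDerivAt_pow 2 s).div_const 2).mul_const (inner ℝ u (hess f w u))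
      refine this.congr_deriv ?_
      norm_num
    exact (h2.sub h3).sub h4
  have h := (convex_Icc (0 : ℝ) 1).norm_image_sub_le_of_norm_hasDerivWithin_le
    (f := φ) (C := ρ * ‖u‖ ^ 3) (x := 0) (y := 1)
    (fun s _ => (hd s).hasDerivWithinAt)
    (fun s hs => by
      have e : inner ℝ (gradient f (w + s • u)) u - inner ℝ (gradient f w) u
          - s * inner ℝ u (hess f w u)
          = inner ℝ (gradient f (w + s • u) - gradient f w - hess f w (s • u)) u := by
        rw [inner_sub_left, inner_sub_left, map_smul, real_inner_smul_left,
          real_inner_comm u (hess f w u)]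
      rw [e]
      refine (norm_inner_le_norm _ _).trans ?_
      have h5 := norm_gradient_add_sub_le hf hρ hlip w (s • u)
      have h6 : ‖s • u‖ ≤ ‖u‖ := by
        rw [norm_smul, Real.norm_of_nonneg hs.1]
        exact mul_le_of_le_one_left (norm_nonneg _) hs.2
      calc _ ≤ ρ * ‖s • u‖ ^ 2 * ‖u‖ := by gcongr
        _ ≤ ρ * ‖u‖ ^ 2 * ‖u‖ := by gcongr
        _ = ρ * ‖u‖ ^ 3 := by ring)
    (by simp) (by simp)
  simp only [hφ, Real.norm_eq_abs] at h
  convert h using 1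
  · congr 1
    simp
    ring
  · simp

end Calculus

/-! ### Products of the operators `G_s`, diagonalized in an eigenbasis of `H` -/

section LinearAlgebra

/-- The geometric weight `∑_{j=1}^s β^{s-j}`. -/
def geomWeight (β : ℝ) (s : ℕ) : ℝ := ∑ j ∈ Finset.Icc 1 s, β ^ (s - j)

theorem geomWeight_nonneg {β : ℝ} (hβ : 0 ≤ β) (s : ℕ) : 0 ≤ geomWeight β s :=
  Finset.sum_nonneg fun _ _ => pow_nonneg hβ _

variable {d : ℕ} {H T T' : Vec d →L[ℝ] Vec d} {b : OrthonormalBasis (Fin d) ℝ (Vec d)}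

theorem gOp_eq (η β : ℝ) (H : Vec d →L[ℝ] Vec d) (s : ℕ) :
    gOp η β H s = 1 - (η * geomWeight β s) • H := rfl

theorem gProd_self (η β : ℝ) (H : Vec d →L[ℝ] Vec d) (a : ℕ) : gProd η β H a a = 1 := by
  simp [gProd]

theorem gProd_eq_mul (η β : ℝ) (H : Vec d →L[ℝ] Vec d) {a b : ℕ} (h : a < b) :
    gProd η β H a b = gOp η β H a * gProd η β H (a + 1) b := by
  simp [gProd, List.Ico.eq_cons h]

/-- `T` is diagonal with entries `c` in the orthonormal basis `b`. -/
def IsDiagIn (b : OrthonormalBasis (Fin d) ℝ (Vec d)) (T : Vec d →L[ℝ] Vec d)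
    (c : Fin d → ℝ) : Prop := ∀ i, T (b i) = c i • b i

theorem exists_isDiagIn (hH : ∀ x y, inner ℝ (H x) y = inner ℝ x (H y)) :
    ∃ (b : OrthonormalBasis (Fin d) ℝ (Vec d)) (c : Fin d → ℝ), IsDiagIn b H c := by
  have hs : (H : Vec d →ₗ[ℝ] Vec d).IsSymmetric := fun x y => hH x y
  have hn : Module.finrank ℝ (Vec d) = d := by simp
  exact ⟨hs.eigenvectorBasis hn, hs.eigenvalues hn, fun i => hs.apply_eigenvectorBasis hn i⟩

theorem IsDiagIn.repr_apply {c : Fin d → ℝ} (h : IsDiagIn b T c) (x : Vec d) (i : Fin d) :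
    inner ℝ (b i) (T x) = c i * inner ℝ (b i) x := by
  conv_lhs => rw [← b.sum_repr x]
  rw [map_sum, inner_sum, Finset.sum_eq_single i]
  · rw [map_smul, h i, inner_smul_right, inner_smul_right, b.repr_apply_apply]
    simp [mul_comm]
  · intro j _ hj
    rw [map_smul, h j, inner_smul_right, inner_smul_right, b.inner_eq_zero hj.symm]
    simp
  · simp

theorem IsDiagIn.inner_apply_apply {c c' : Fin d → ℝ} (h : IsDiagIn b T c)
    (h' : IsDiagIn b T' c') (x y : Vec d) :
    inner ℝ (T x) (T' y) = ∑ i, c i * c' i * (inner ℝ (b i) x * inner ℝ (b i) y) := by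
  rw [← b.sum_inner_mul_inner]
  refine Finset.sum_congr rfl fun i _ => ?_
  rw [real_inner_comm, h.repr_apply, h'.repr_apply]
  ring

theorem IsDiagIn.norm_le {c : Fin d → ℝ} (h : IsDiagIn b T c) {κ : ℝ} (hκ : 0 ≤ κ)
    (hc : ∀ i, |c i| ≤ κ) : ‖T‖ ≤ κ := by
  refine T.opNorm_le_bound hκ fun x => ?_
  refine le_of_sq_le_sq ?_ (by positivity)
  rw [mul_pow, ← real_inner_self_eq_norm_sq, ← real_inner_self_eq_norm_sq, h.inner_apply_apply h,
    ← b.sum_inner_mul_inner, Finset.mul_sum]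
  refine Finset.sum_le_sum fun i _ => ?_
  rw [real_inner_comm x (b i)]
  have h1 : c i * c i ≤ κ ^ 2 := by
    rw [← pow_two, ← sq_abs]
    exact pow_le_pow_left₀ (abs_nonneg _) (hc i) 2
  exact mul_le_mul_of_nonneg_right h1 (mul_self_nonneg _)

theorem IsDiagIn.abs_le_norm {c : Fin d → ℝ} (h : IsDiagIn b T c) (i : Fin d) : |c i| ≤ ‖T‖ := by
  have := T.le_opNorm (b i)
  rwa [h i, norm_smul, b.norm_eq_one, mul_one, mul_one, Real.norm_eq_abs] at this

theorem IsDiagIn.gOp {c : Fin d → ℝ} (h : IsDiagIn b H c) (η β : ℝ) (s : ℕ) :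
    IsDiagIn b (gOp η β H s) fun i => 1 - η * geomWeight β s * c i := by
  intro i
  rw [gOp_eq, sub_apply, smul_apply, h i, smul_smul,
    sub_smul, one_smul]
  rfl

theorem IsDiagIn.mul {c c' : Fin d → ℝ} (h : IsDiagIn b T c) (h' : IsDiagIn b T' c') :
    IsDiagIn b (T * T') fun i => c i * c' i := by
  intro i
  rw [mul_apply_eq_comp, h' i, map_smul, h i, smul_smul, mul_comm]

theorem IsDiagIn.gProd {c : Fin d → ℝ} (h : IsDiagIn b H c) (η β : ℝ) (s e : ℕ) :
    IsDiagIn b (gProd η β H s e) fun i => ∏ j ∈ Finset.Ico s e, (1 - η * geomWeight β j * c i) := by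
  rcases lt_or_ge e s with he | he
  · intro i
    simp [_root_.gProd, List.Ico.eq_nil_of_le he.le, Finset.Ico_eq_empty_of_le he.le]
  · induction he using Nat.decreasingInduction with
    | self => intro i; simp [gProd_self]
    | of_succ k hk ih =>
      rw [gProd_eq_mul η β H hk]
      intro i
      rw [((h.gOp η β k).mul ih) i]
      beta_reduce
      rw [Finset.prod_eq_prod_Ico_succ_bot hk]

/-- Both products are functions of the symmetric operator `H`, hence symmetric and commuting. This
puts a pairing of two products into the form `mOp` in which APCG is stated. -/
theorem inner_gProd_comm (hH : ∀ x y, inner ℝ (H x) y = inner ℝ x (H y)) (η β : ℝ) (s s' e : ℕ)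
    (x y : Vec d) :
    inner ℝ (gProd η β H s e x) (gProd η β H s' e y)
      = inner ℝ y ((gProd η β H s e * gProd η β H s' e) x) := by
  obtain ⟨b, c, h⟩ := exists_isDiagIn hH
  have h1 : IsDiagIn b (1 : Vec d →L[ℝ] Vec d) fun _ => 1 := fun i => by simp
  have h2 := h1.inner_apply_apply ((h.gProd η β s e).mul (h.gProd η β s' e)) y x
  rw [(h.gProd η β s e).inner_apply_apply (h.gProd η β s' e)]
  rw [one_apply_eq_self] at h2
  rw [h2]
  refine Finset.sum_congr rfl fun i _ => by ring

theorem isDiagIn_factor_nonneg {c : Fin d → ℝ} (h : IsDiagIn b H c) {η β : ℝ} (hη : 0 ≤ η)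
    (hβ : 0 ≤ β) (hG : ∀ s, η * geomWeight β s * ‖H‖ ≤ 1) (s : ℕ) (i : Fin d) :
    0 ≤ 1 - η * geomWeight β s * c i := by
  have h1 : c i ≤ ‖H‖ := (le_abs_self _).trans (h.abs_le_norm i)
  have h2 := mul_le_mul_of_nonneg_left h1 (mul_nonneg hη (geomWeight_nonneg hβ s))
  linarith [hG s]

/-- When `ηθ_s‖H‖ ≤ 1`, every factor has nonnegative spectrum. This gives the inherited-momentum
term a favourable sign. -/
theorem inner_gProd_nonneg (hH : ∀ x y, inner ℝ (H x) y = inner ℝ x (H y)) {η β : ℝ} (hη : 0 ≤ η)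
    (hβ : 0 ≤ β) (hG : ∀ s, η * geomWeight β s * ‖H‖ ≤ 1) (s s' e : ℕ) (x : Vec d) :
    0 ≤ inner ℝ (gProd η β H s e x) (gProd η β H s' e x) := by
  obtain ⟨b, c, h⟩ := exists_isDiagIn hH
  rw [(h.gProd η β s e).inner_apply_apply (h.gProd η β s' e)]
  refine Finset.sum_nonneg fun i _ => mul_nonneg (mul_nonneg ?_ ?_) (mul_self_nonneg _)
  all_goals exact Finset.prod_nonneg fun j _ => isDiagIn_factor_nonneg h hη hβ hG j i

theorem eigenvalue_mem_of_isDiagIn {c : Fin d → ℝ} (h : IsDiagIn b H c) (i : Fin d) :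
    c i ∈ eigenvalues H := by
  refine Module.End.hasEigenvalue_of_hasEigenvector (x := b i) ⟨?_, ?_⟩
  · rw [Module.End.mem_eigenspace_iff]
    exact h i
  · exact b.orthonormal.ne_zero i

theorem eigenvalue_eq_of_isDiagIn {c : Fin d → ℝ} (h : IsDiagIn b H c) {μ : ℝ}
    (hμ : μ ∈ eigenvalues H) : ∃ i, c i = μ := by
  obtain ⟨v, hv, hv0⟩ := Module.End.HasEigenvalue.exists_hasEigenvector hμ
  rw [Module.End.mem_eigenspace_iff] at hv
  by_contra! hne
  refine hv0 ?_
  rw [← b.sum_repr v]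
  refine Finset.sum_eq_zero fun i _ => ?_
  have h1 := h.repr_apply v i
  have hv' : H v = μ • v := hv
  rw [hv', inner_smul_right] at h1
  have h2 : (c i - μ) * inner ℝ (b i) v = 0 := by linarith
  rcases mul_eq_zero.1 h2 with h3 | h3
  · exact absurd (by linarith) (hne i)
  · rw [b.repr_apply_apply, h3, zero_smul]

/-- Converts failure of the second-order condition into the eigenvalue hypothesis of CNC and APCG.
-/
theorem exists_eigenvalue_lt (hH : ∀ x y, inner ℝ (H x) y = inner ℝ x (H y)) {ε : ℝ}
    (h : ¬ ∀ x : Vec d, -ε * ‖x‖ ^ 2 ≤ inner ℝ x (H x)) : ∃ μ ∈ eigenvalues H, μ < -ε := by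
  obtain ⟨b, c, hd⟩ := exists_isDiagIn hH
  by_contra! hc
  refine h fun x => ?_
  have h1 : IsDiagIn b (1 : Vec d →L[ℝ] Vec d) fun _ => 1 := fun i => by simp
  have h2 := h1.inner_apply_apply hd x x
  rw [one_apply_eq_self] at h2
  rw [h2, ← real_inner_self_eq_norm_sq, ← b.sum_inner_mul_inner, Finset.mul_sum]
  refine Finset.sum_le_sum fun i _ => ?_
  rw [real_inner_comm x (b i), one_mul]
  exact mul_le_mul_of_nonneg_right (hc _ (eigenvalue_mem_of_isDiagIn hd i)) (mul_self_nonneg _)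

/-- The norm of a product `G_s ⋯ G_{e-1}` is attained at the smallest eigenvalue. -/
theorem exists_norm_gProd_eq (hH : ∀ x y, inner ℝ (H x) y = inner ℝ x (H y)) {η β : ℝ}
    (hη : 0 ≤ η) (hβ : 0 ≤ β) (hG : ∀ s, η * geomWeight β s * ‖H‖ ≤ 1) {μ : ℝ}
    (hμ : IsLeast (eigenvalues H) μ) (s e : ℕ) :
    ‖gProd η β H s e‖ = ∏ j ∈ Finset.Ico s e, (1 - η * geomWeight β j * μ) := by
  obtain ⟨b, c, h⟩ := exists_isDiagIn hH
  obtain ⟨i, hi⟩ := eigenvalue_eq_of_isDiagIn h hμ.1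
  have hP := h.gProd η β s e
  have hnn := fun i => Finset.prod_nonneg (s := Finset.Ico s e) fun j _ =>
    isDiagIn_factor_nonneg h hη hβ hG j i
  refine le_antisymm (hP.norm_le (by rw [← hi]; exact hnn i) fun j => ?_) ?_
  · rw [abs_of_nonneg (hnn j)]
    -- A factor is nonnegative and nonincreasing as a function of the eigenvalue, so the smallest
    -- eigenvalue maximizes the whole product.
    refine Finset.prod_le_prod (fun k _ => isDiagIn_factor_nonneg h hη hβ hG k j) fun k _ => ?_
    have h1 := mul_le_mul_of_nonneg_left (hμ.2 (eigenvalue_mem_of_isDiagIn h j))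
      (mul_nonneg hη (geomWeight_nonneg hβ k))
    linarith
  · rw [← hi]
    exact (le_abs_self _).trans (hP.abs_le_norm i)

theorem exists_isLeast_eigenvalues (hH : ∀ x y, inner ℝ (H x) y = inner ℝ x (H y)) {μ : ℝ}
    (hμ : μ ∈ eigenvalues H) : ∃ ν, IsLeast (eigenvalues H) ν ∧ ν ≤ μ := by
  obtain ⟨b, c, h⟩ := exists_isDiagIn hH
  obtain ⟨i, hi⟩ := eigenvalue_eq_of_isDiagIn h hμ
  obtain ⟨j, -, hj⟩ := Finset.exists_min_image Finset.univ c ⟨i, Finset.mem_univ i⟩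
  refine ⟨c j, ⟨eigenvalue_mem_of_isDiagIn h j, fun ν hν => ?_⟩, hi ▸ hj i (Finset.mem_univ i)⟩
  obtain ⟨k, hk⟩ := eigenvalue_eq_of_isDiagIn h hν
  exact hk ▸ hj k (Finset.mem_univ k)

/-- The decay factor `∏_{j=1}^s (1 + η θ_j ε)⁻¹`, where `θ_j` is the geometric weight. -/
def decay (η β ε : ℝ) (s : ℕ) : ℝ := (∏ j ∈ Finset.Ico 1 (s + 1), (1 + η * geomWeight β j * ε))⁻¹

/-- Both norms are attained at the same smallest eigenvalue, so their ratio is the product of the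
omitted factors `G_1, …, G_s` there, each at least `1 + ηθ_j ε`. -/
theorem norm_gProd_le_decay_mul (hH : ∀ x y, inner ℝ (H x) y = inner ℝ x (H y)) {η β ε : ℝ}
    (hη : 0 ≤ η) (hβ : 0 ≤ β) (hε : 0 ≤ ε) (hG : ∀ s, η * geomWeight β s * ‖H‖ ≤ 1) {μ : ℝ}
    (hμ : μ ∈ eigenvalues H) (hμε : μ ≤ -ε) {s e : ℕ} (hs : s + 1 ≤ e) :
    ‖gProd η β H (s + 1) e‖ ≤ decay η β ε s * ‖gProd η β H 1 e‖ := by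
  obtain ⟨ν, hν, hνμ⟩ := exists_isLeast_eigenvalues hH hμ
  rw [exists_norm_gProd_eq hH hη hβ hG hν, exists_norm_gProd_eq hH hη hβ hG hν, decay,
    ← Finset.prod_Ico_consecutive _ (by omega : 1 ≤ s + 1) hs, ← mul_assoc]
  have hpos : ∀ j, 0 < 1 + η * geomWeight β j * ε := fun j =>
    add_pos_of_pos_of_nonneg one_pos
      (mul_nonneg (mul_nonneg hη (geomWeight_nonneg hβ j)) hε)
  have hle : ∀ j, 1 + η * geomWeight β j * ε ≤ 1 - η * geomWeight β j * ν := fun j => by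
    have := mul_le_mul_of_nonneg_left (hνμ.trans hμε) (mul_nonneg hη (geomWeight_nonneg hβ j))
    linarith
  refine le_mul_of_one_le_left (Finset.prod_nonneg fun j _ => (hpos j).le.trans (hle j)) ?_
  rw [inv_mul_eq_div, one_le_div (Finset.prod_pos fun j _ => hpos j)]
  exact Finset.prod_le_prod (fun j _ => (hpos j).le) fun j _ => hle j

/-- A lowest eigenvector `v` of `H` is an eigenvector of the product whose eigenvalue is the full
operator norm, so projecting the image of `x` onto `v` suffices. This is how CNC turns into growth.
-/
theorem norm_gProd_mul_abs_inner_le (hH : ∀ x y, inner ℝ (H x) y = inner ℝ x (H y)) {η β : ℝ}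
    (hη : 0 ≤ η) (hβ : 0 ≤ β) (hG : ∀ s, η * geomWeight β s * ‖H‖ ≤ 1) {v : Vec d}
    (hv : IsMinEigenvector H v) (s e : ℕ) (x : Vec d) :
    ‖gProd η β H s e‖ * |inner ℝ x v| ≤ ‖gProd η β H s e x‖ := by
  obtain ⟨hv1, μ, hμ, hHv⟩ := hv
  obtain ⟨b, c, h⟩ := exists_isDiagIn hH
  have hPv : gProd η β H s e v = ‖gProd η β H s e‖ • v := by
    rw [exists_norm_gProd_eq hH hη hβ hG hμ]
    refine b.repr.injective ?_
    ext i
    rw [b.repr_apply_apply, b.repr_apply_apply, (h.gProd η β s e).repr_apply, inner_smul_right]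
    have h1 := h.repr_apply v i
    rw [hHv, inner_smul_right] at h1
    have h2 : (c i - μ) * inner ℝ (b i) v = 0 := by linarith
    rcases mul_eq_zero.1 h2 with h3 | h3
    · rw [show c i = μ by linarith]
    · rw [h3]; simp
  have h1 : IsDiagIn b (1 : Vec d →L[ℝ] Vec d) fun _ => 1 := fun i => by simp
  have h2 : inner ℝ (gProd η β H s e x) v = inner ℝ x (gProd η β H s e v) := by
    have h3 := (h.gProd η β s e).inner_apply_apply h1 x v
    have h4 := h1.inner_apply_apply (h.gProd η β s e) x v
    simp only [one_apply_eq_self] at h3 h4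
    rw [h3, h4]
    simp
  rw [hPv, inner_smul_right] at h2
  have h3 := abs_real_inner_le_norm (gProd η β H s e x) v
  rwa [h2, hv1, mul_one, abs_mul, abs_norm] at h3

end LinearAlgebra

/-! ### Geometric weights, decay factors and their telescoping sums -/

section Weights

variable {η β ε : ℝ}

theorem geomWeight_eq_sum_range (β : ℝ) (s : ℕ) :
    geomWeight β s = ∑ k ∈ Finset.range s, β ^ k := by
  rw [geomWeight, ← Finset.sum_range_reflect]
  refine (Finset.sum_bij (fun k _ => k + 1) ?_ ?_ ?_ ?_).symm
  · intro k hk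
    simp only [Finset.mem_range] at hk
    simp only [Finset.mem_Icc]
    omega
  · intro a _ b _ h
    omega
  · intro j hj
    simp only [Finset.mem_Icc] at hj
    exact ⟨j - 1, by simp only [Finset.mem_range]; omega, by omega⟩
  · intro k hk
    congr 1
    omega

theorem geomWeight_zero (β : ℝ) : geomWeight β 0 = 0 := by simp [geomWeight_eq_sum_range]

theorem geomWeight_succ (β : ℝ) (s : ℕ) : geomWeight β (s + 1) = geomWeight β s + β ^ s := by
  simp only [geomWeight_eq_sum_range, Finset.sum_range_succ]

theorem geomWeight_succ' (β : ℝ) (s : ℕ) : geomWeight β (s + 1) = β * geomWeight β s + 1 := by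
  simp only [geomWeight_eq_sum_range, geom_sum_succ]

theorem one_sub_mul_geomWeight (β : ℝ) (s : ℕ) : (1 - β) * geomWeight β s = 1 - β ^ s := by
  induction s with
  | zero => simp [geomWeight_zero]
  | succ s ih => rw [geomWeight_succ, mul_add, ih]; ring

theorem geomWeight_le (hβ : 0 ≤ β) (hβ1 : β < 1) (s : ℕ) : geomWeight β s ≤ 1 / (1 - β) := by
  rw [le_div_iff₀' (by linarith), one_sub_mul_geomWeight]
  linarith [pow_nonneg hβ s]

theorem one_le_geomWeight (hβ : 0 ≤ β) {s : ℕ} (hs : 1 ≤ s) : 1 ≤ geomWeight β s := by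
  obtain ⟨k, rfl⟩ := Nat.exists_eq_add_of_le' hs
  rw [geomWeight_succ']
  linarith [mul_nonneg hβ (geomWeight_nonneg hβ k)]

/-- The sum satisfies `S_{s+1} = βS_s + βθ_s`, and this recursion preserves the bound because `β(2 -
β) ≤ 1`. -/
theorem sum_pow_sub_mul_le (hβ : 0 ≤ β) (hβ1 : β < 1) (s : ℕ) :
    ∑ i ∈ Finset.Icc 1 s, β ^ (s - i) * ((s : ℝ) - i) ≤ 1 / (1 - β) ^ 2 := by
  have h1 : 0 < 1 - β := by linarith
  induction s with
  | zero => simpa using sq_nonneg (1 - β)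
  | succ s ih =>
    have h2 : ∑ i ∈ Finset.Icc 1 (s + 1), β ^ (s + 1 - i) * (((s + 1 : ℕ) : ℝ) - i)
        = β * ∑ i ∈ Finset.Icc 1 s, β ^ (s - i) * ((s : ℝ) - i) + β * geomWeight β s := by
      rw [Finset.sum_Icc_succ_top (by omega), geomWeight, Finset.mul_sum, Finset.mul_sum,
        ← Finset.sum_add_distrib]
      simp only [sub_self, mul_zero, add_zero]
      refine Finset.sum_congr rfl fun i hi => ?_
      rw [Nat.succ_sub (Finset.mem_Icc.1 hi).2, pow_succ]
      push_cast
      ring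
    rw [h2]
    have h3 := geomWeight_le hβ hβ1 s
    calc _ ≤ β * (1 / (1 - β) ^ 2) + β * (1 / (1 - β)) := by gcongr
      _ ≤ 1 / (1 - β) ^ 2 := by
        have : β * (1 / (1 - β) ^ 2) + β * (1 / (1 - β)) = β * (2 - β) / (1 - β) ^ 2 := by
          field_simp
          ring
        rw [this]
        gcongr
        nlinarith [sq_nonneg (1 - β)]

theorem decay_zero (η β ε : ℝ) : decay η β ε 0 = 1 := by simp [decay]

theorem one_add_weight_pos (hη : 0 ≤ η) (hβ : 0 ≤ β) (hε : 0 ≤ ε) (j : ℕ) :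
    0 < 1 + η * geomWeight β j * ε :=
  add_pos_of_pos_of_nonneg one_pos (mul_nonneg (mul_nonneg hη (geomWeight_nonneg hβ j)) hε)

theorem decay_pos (hη : 0 ≤ η) (hβ : 0 ≤ β) (hε : 0 ≤ ε) (s : ℕ) : 0 < decay η β ε s :=
  inv_pos.2 (Finset.prod_pos fun j _ => one_add_weight_pos hη hβ hε j)

/-- The telescoping identity behind the sums below: they converge with bounds that do not involve
the period length. -/
theorem decay_succ (hη : 0 ≤ η) (hβ : 0 ≤ β) (hε : 0 ≤ ε) (s : ℕ) :
    η * geomWeight β (s + 1) * decay η β ε (s + 1) * ε = decay η β ε s - decay η β ε (s + 1) := by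
  have h : decay η β ε s = decay η β ε (s + 1) * (1 + η * geomWeight β (s + 1) * ε) := by
    rw [decay, decay, Finset.prod_Ico_succ_top (by omega : 1 ≤ s + 1), mul_inv, mul_assoc,
      inv_mul_cancel₀ (one_add_weight_pos hη hβ hε _).ne', mul_one]
  rw [h]
  ring

theorem sum_weight_decay_le (hη : 0 ≤ η) (hβ : 0 ≤ β) (hε : 0 < ε) {n : ℕ} (hn : 1 ≤ n) :
    ∑ s ∈ Finset.Ico 1 n, η * geomWeight β s * decay η β ε s ≤ 1 / ε := by
  rw [le_div_iff₀ hε]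
  have : (∑ s ∈ Finset.Ico 1 n, η * geomWeight β s * decay η β ε s) * ε
      = 1 - decay η β ε (n - 1) := by
    induction n, hn using Nat.le_induction with
    | base => simp [decay_zero]
    | succ n hn ih =>
      rw [Finset.sum_Ico_succ_top hn, add_mul, ih]
      obtain ⟨k, rfl⟩ := Nat.exists_eq_add_of_le' hn
      rw [decay_succ hη hβ hε.le]
      simp
  rw [this]
  linarith [decay_pos hη hβ hε.le (n - 1)]

/-- Abel summation based on `decay_succ` reduces this to the plain sum of decay factors, which is at
most `2/(ηε)` because every weight of positive index is at least 1. -/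
theorem sum_weight_decay_mul_le (hη : 0 < η) (hβ : 0 ≤ β) (hε : 0 < ε) (hηε : η * ε ≤ 1) {n : ℕ}
    (hn : 1 ≤ n) :
    ∑ s ∈ Finset.Ico 1 n, η * geomWeight β s * decay η β ε s * s ≤ 2 / (η * ε ^ 2) := by
  have h1 : (∑ s ∈ Finset.Ico 1 n, η * geomWeight β s * decay η β ε s * s) * ε
      = ∑ s ∈ Finset.range (n - 1), decay η β ε s - (n - 1 : ℕ) * decay η β ε (n - 1) := by
    induction n, hn using Nat.le_induction with
    | base => simp
    | succ n hn ih =>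
      rw [Finset.sum_Ico_succ_top hn, add_mul, ih]
      obtain ⟨k, rfl⟩ := Nat.exists_eq_add_of_le' hn
      have := decay_succ hη.le hβ hε.le k
      simp only [Nat.add_sub_cancel, Finset.sum_range_succ]
      push_cast
      linear_combination ((k : ℝ) + 1) * this
  have h2 : ∑ s ∈ Finset.range (n - 1), decay η β ε s ≤ 2 / (η * ε) := by
    have h3 : ∑ s ∈ Finset.range n, decay η β ε s
        = 1 + ∑ s ∈ Finset.Ico 1 n, decay η β ε s := by
      rw [Finset.range_eq_Ico, Finset.sum_eq_sum_Ico_succ_bot (by omega), decay_zero]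
    have h4 : η * ∑ s ∈ Finset.Ico 1 n, decay η β ε s ≤ 1 / ε := by
      refine le_trans ?_ (sum_weight_decay_le hη.le hβ hε hn)
      rw [Finset.mul_sum]
      refine Finset.sum_le_sum fun s hs => ?_
      have := one_le_geomWeight hβ (Finset.mem_Ico.1 hs).1
      refine mul_le_mul_of_nonneg_right ?_ (decay_pos hη.le hβ hε.le s).le
      exact le_mul_of_one_le_right hη.le this
    calc _ ≤ ∑ s ∈ Finset.range n, decay η β ε s :=
          Finset.sum_le_sum_of_subset_of_nonneg (Finset.range_mono (by omega))
            fun s _ _ => (decay_pos hη.le hβ hε.le s).le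
      _ ≤ 2 / (η * ε) := by
        rw [h3, le_div_iff₀ (by positivity)]
        rw [le_div_iff₀ hε] at h4
        linarith
  have h5 : (0 : ℝ) ≤ (n - 1 : ℕ) * decay η β ε (n - 1) :=
    mul_nonneg (Nat.cast_nonneg _) (decay_pos hη.le hβ hε.le _).le
  have h6 : (∑ s ∈ Finset.Ico 1 n, η * geomWeight β s * decay η β ε s * s) * ε ≤ 2 / (η * ε) := by
    rw [h1]
    linarith
  calc _ ≤ 2 / (η * ε) / ε := by rwa [le_div_iff₀ hε]
    _ = 2 / (η * ε ^ 2) := by rw [div_div]; ring_nf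

/-- Up to the factor `1 - β`, the sum is `n - 1` minus a geometric tail of size at most `β/(1 - β)`.
The lower bound on `n` makes that tail at most `(n - 1)/2`, and `(n - 1)/2 ≥ n/4`. -/
theorem sum_geomWeight_ge (hβ : 0 ≤ β) (hβ1 : β < 1) {n : ℕ} (hn : 2 ≤ n)
    (h : 1 + 2 * β / (1 - β) ≤ n) :
    n / (4 * (1 - β)) ≤ ∑ j ∈ Finset.Ico 1 n, geomWeight β j := by
  have h1 : 0 < 1 - β := by linarith
  have h2 : (1 - β) * ∑ j ∈ Finset.Ico 1 n, geomWeight β j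
      = ((n : ℝ) - 1) - ∑ j ∈ Finset.Ico 1 n, β ^ j := by
    rw [Finset.mul_sum, Finset.sum_congr rfl fun j _ => one_sub_mul_geomWeight β j,
      Finset.sum_sub_distrib]
    simp [Nat.cast_sub (by omega : 1 ≤ n)]
  have h3 : ∑ j ∈ Finset.Ico 1 n, β ^ j ≤ β / (1 - β) := by
    have h4 : geomWeight β n = 1 + ∑ j ∈ Finset.Ico 1 n, β ^ j := by
      rw [geomWeight_eq_sum_range, Finset.range_eq_Ico,
        Finset.sum_eq_sum_Ico_succ_bot (by omega), pow_zero]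
    have h5 := geomWeight_le hβ hβ1 n
    have h6 : β / (1 - β) = 1 / (1 - β) - 1 := by field_simp; ring
    linarith
  have h7 : (2 : ℝ) ≤ n := by exact_mod_cast hn
  rw [div_le_iff₀ (by positivity)]
  have h8 : 2 * β / (1 - β) = 2 * (β / (1 - β)) := by ring
  nlinarith

/-- The condition `ηε ≤ 1 - β` keeps each increment `y = ηθ_jε` in `[0, 1]`, where `1 + y ≥
exp(y/2)`. The exponents are then summed with `sum_geomWeight_ge`. -/
theorem decay_le_exp (hη : 0 < η) (hβ : 0 ≤ β) (hβ1 : β < 1) (hε : 0 < ε)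
    (hηε : η ≤ (1 - β) / ε) {n : ℕ} (hn : 2 ≤ n) (h : 1 + 2 * β / (1 - β) ≤ n) :
    decay η β ε (n - 1) ≤ Real.exp (-(η * ε * n / (8 * (1 - β)))) := by
  have h1 : 0 < 1 - β := by linarith
  have h2 : ∀ j, Real.exp (η * geomWeight β j * ε / 2) ≤ 1 + η * geomWeight β j * ε := by
    intro j
    set y := η * geomWeight β j * ε with hy
    have hy0 : 0 ≤ y := mul_nonneg (mul_nonneg hη.le (geomWeight_nonneg hβ j)) hε.le
    have hy1 : y ≤ 1 := by
      have h3 := geomWeight_le hβ hβ1 j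
      have h0 := geomWeight_nonneg hβ j
      rw [le_div_iff₀ hε] at hηε
      calc y = η * ε * geomWeight β j := by ring
        _ ≤ (1 - β) * (1 / (1 - β)) := by gcongr
        _ = 1 := by field_simp
    have h4 := Real.one_sub_le_exp_neg (y / 2)
    rw [Real.exp_neg] at h4
    have h5 := Real.exp_pos (y / 2)
    have h6 : (1 - y / 2) * Real.exp (y / 2) ≤ 1 := by
      calc _ ≤ (Real.exp (y / 2))⁻¹ * Real.exp (y / 2) := by gcongr
        _ = 1 := inv_mul_cancel₀ h5.ne'
    have h7 : 1 ≤ (1 + y) * (1 - y / 2) := by nlinarith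
    nlinarith
  have h3 := sum_geomWeight_ge hβ hβ1 hn h
  rw [decay, Real.exp_neg, Nat.sub_add_cancel (by omega)]
  refine inv_anti₀ (Real.exp_pos _) ?_
  calc _ ≤ Real.exp (∑ j ∈ Finset.Ico 1 n, η * geomWeight β j * ε / 2) := by
        refine Real.exp_le_exp.2 ?_
        have : ∑ j ∈ Finset.Ico 1 n, η * geomWeight β j * ε / 2
            = η * ε / 2 * ∑ j ∈ Finset.Ico 1 n, geomWeight β j := by
          rw [Finset.mul_sum]
          exact Finset.sum_congr rfl fun j _ => by ring
        rw [this]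
        calc _ = η * ε / 2 * (n / (4 * (1 - β))) := by field_simp; ring
          _ ≤ _ := by gcongr
    _ = ∏ j ∈ Finset.Ico 1 n, Real.exp (η * geomWeight β j * ε / 2) := Real.exp_sum _ _
    _ ≤ _ := Finset.prod_le_prod (fun j _ => (Real.exp_pos _).le) fun j _ => h2 j

end Weights

/-! ### Almost surely bounded random variables -/

section BoundedRandomVariables

variable {Ω E E' : Type*} [MeasurableSpace Ω] {P : Measure Ω}
  [NormedAddCommGroup E] [MeasurableSpace E] [NormedAddCommGroup E'] [MeasurableSpace E']

/-- A measurable random variable that is almost surely bounded. -/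
def BddRV (P : Measure Ω) (X : Ω → E) : Prop := Measurable X ∧ ∃ C : ℝ, ∀ᵐ ω ∂P, ‖X ω‖ ≤ C

theorem BddRV.prodMk {X : Ω → E} {Y : Ω → E'} (hX : BddRV P X) (hY : BddRV P Y) :
    BddRV P fun ω => (X ω, Y ω) := by
  obtain ⟨C, hC⟩ := hX.2
  obtain ⟨C', hC'⟩ := hY.2
  refine ⟨hX.1.prodMk hY.1, max C C', ?_⟩
  filter_upwards [hC, hC'] with ω h h'
  exact max_le_max h h'

theorem BddRV.comp [ProperSpace E] [OpensMeasurableSpace E] [BorelSpace E'] {X : Ω → E}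
    (hX : BddRV P X) {φ : E → E'} (hφ : Continuous φ) : BddRV P fun ω => φ (X ω) := by
  obtain ⟨C, hC⟩ := hX.2
  obtain ⟨C', hC'⟩ := (isCompact_closedBall (0 : E) C).exists_bound_of_continuousOn hφ.continuousOn
  refine ⟨hφ.measurable.comp hX.1, C', ?_⟩
  filter_upwards [hC] with ω h
  exact hC' _ (by simpa using h)

theorem BddRV.integrable [IsFiniteMeasure P] {X : Ω → ℝ} (hX : BddRV P X) : Integrable X P := by
  obtain ⟨C, hC⟩ := hX.2
  exact Integrable.of_bound hX.1.aestronglyMeasurable C hC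

theorem BddRV.mul {X Y : Ω → ℝ} (hX : BddRV P X) (hY : BddRV P Y) :
    BddRV P fun ω => X ω * Y ω :=
  (hX.prodMk hY).comp (φ := fun p : ℝ × ℝ => p.1 * p.2) (by fun_prop)

end BoundedRandomVariables

/-! ### Measurability of the run and unbiasedness of the noise -/

section Run

variable {d : ℕ} {Ξ Ω : Type*} [MeasurableSpace Ξ] [MeasurableSpace Ω]

/-- A run of stochastic heavy ball with bounded momentum on a smooth stochastic objective. -/
structure MomentumRun (D : Measure Ξ) (P : Measure Ω) (F : Vec d → Ξ → ℝ) (ξ : ℕ → Ω → Ξ)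
    (w₀ : Vec d) (L ρ σ c_m β r η : ℝ) (τ : ℕ) (w g m : ℕ → Ω → Vec d) : Prop where
  smooth : SmoothStochastic D F L ρ σ
  iid : IIDSamples P D ξ
  run : HeavyBall F ξ w₀ β r η τ w g m
  momentum_le : ∀ t, ∀ᵐ ω ∂P, ‖m t ω‖ ≤ c_m
  lipschitz_nonneg : 0 ≤ L
  lipschitz_hess_nonneg : 0 ≤ ρ
  momentum_nonneg : 0 ≤ c_m
  large_step_pos : 0 < r
  step_pos : 0 < η
  beta_nonneg : 0 ≤ β
  beta_lt_one : β < 1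

/-- The σ-algebra generated by the samples `ξ_0, …, ξ_{t-1}`. -/
abbrev samplePast (ξ : ℕ → Ω → Ξ) (t : ℕ) : MeasurableSpace Ω :=
  ⨆ i ∈ Set.Iio t, MeasurableSpace.comap (ξ i) inferInstance

variable {D : Measure Ξ} {P : Measure Ω} {F : Vec d → Ξ → ℝ} {ξ : ℕ → Ω → Ξ}
  {w₀ : Vec d} {L ρ σ c_m β r η : ℝ} {τ : ℕ} {w g m : ℕ → Ω → Vec d}

theorem samplePast_le (hξ : IIDSamples P D ξ) (t : ℕ) :
    samplePast ξ t ≤ (inferInstance : MeasurableSpace Ω) :=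
  iSup₂_le fun i _ => (hξ.measurable i).comap_le

omit [MeasurableSpace Ω] in
theorem samplePast_mono (ξ : ℕ → Ω → Ξ) : Monotone (samplePast ξ) := fun _ _ h =>
  iSup₂_le fun i hi => le_iSup₂_of_le i (lt_of_lt_of_le hi h) le_rfl

omit [MeasurableSpace Ω] in
theorem measurable_sample (ξ : ℕ → Ω → Ξ) (t : ℕ) : Measurable[samplePast ξ (t + 1)] (ξ t) :=
  Measurable.mono (comap_measurable (ξ t)) (le_iSup₂_of_le t (Nat.lt_succ_self t) le_rfl) le_rfl

theorem indep_samplePast (hξ : IIDSamples P D ξ) (t : ℕ) :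
    Indep (samplePast ξ t) (MeasurableSpace.comap (ξ t) inferInstance) P := by
  have h := indep_iSup_of_disjoint (fun i => (hξ.measurable i).comap_le) hξ.indep
    (S := Set.Iio t) (T := {t}) (by simp)
  simp only [Set.mem_singleton_iff, iSup_iSup_eq_left] at h
  exact h

theorem step_nonneg (hr : 0 < r) (hη : 0 < η) (τ t : ℕ) : 0 < stepSize r η τ t := by
  unfold stepSize
  split_ifs <;> assumption

namespace MomentumRun

variable (R : MomentumRun D P F ξ w₀ L ρ σ c_m β r η τ w g m)
include R

theorem measurable_aux (t : ℕ) :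
    Measurable[samplePast ξ t] (w t) ∧ Measurable[samplePast ξ (t + 1)] (m t) := by
  have hg : ∀ t, Measurable[samplePast ξ t] (w t) → Measurable[samplePast ξ (t + 1)] (g t) := by
    intro t ht
    have h1 : g t = fun ω => stochGrad F (w t ω) (ξ t ω) := funext fun ω => R.run.grad t ω
    rw [h1]
    exact R.smooth.measurable_grad.comp
      ((ht.mono (samplePast_mono ξ t.le_succ) le_rfl).prodMk (measurable_sample ξ t))
  induction t with
  | zero =>
    have h0 : w 0 = fun _ => w₀ := funext R.run.init
    have h1 : Measurable[samplePast ξ 0] (w 0) := by rw [h0]; exact measurable_const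
    refine ⟨h1, ?_⟩
    rw [funext R.run.momentum_zero]
    exact hg 0 h1
  | succ t ih =>
    have h1 : Measurable[samplePast ξ (t + 1)] (w (t + 1)) := by
      rw [funext (R.run.update t)]
      exact (ih.1.mono (samplePast_mono ξ t.le_succ) le_rfl).sub (ih.2.const_smul (stepSize r η τ t))
    refine ⟨h1, ?_⟩
    rw [funext (R.run.momentum_succ t)]
    exact ((ih.2.mono (samplePast_mono ξ (t + 1).le_succ) le_rfl).const_smul β).add (hg _ h1)

theorem measurable_iterate (t : ℕ) : Measurable[samplePast ξ t] (w t) := (R.measurable_aux t).1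

theorem measurable_momentum (t : ℕ) : Measurable[samplePast ξ (t + 1)] (m t) :=
  (R.measurable_aux t).2

theorem past_le_samplePast (t : ℕ) : past w t ≤ samplePast ξ t :=
  iSup₂_le fun i hi => ((R.measurable_iterate i).mono
    (samplePast_mono ξ (Finset.mem_Icc.1 hi).2) le_rfl).comap_le

theorem past_le (t : ℕ) : past w t ≤ (inferInstance : MeasurableSpace Ω) :=
  (R.past_le_samplePast t).trans (samplePast_le R.iid t)

theorem measurable_past (t : ℕ) : Measurable[past w t] (w t) := by
  rcases Nat.eq_zero_or_pos t with rfl | ht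
  · rw [funext R.run.init]
    exact measurable_const
  · exact Measurable.mono (comap_measurable (w t))
      (le_iSup₂_of_le t (Finset.mem_Icc.2 ⟨ht, le_rfl⟩) le_rfl) le_rfl

omit [MeasurableSpace Ω] R in
theorem past_mono (w : ℕ → Ω → Vec d) : Monotone (past w) := fun _ _ h =>
  iSup₂_le fun i hi => le_iSup₂_of_le i
    (Finset.mem_Icc.2 ⟨(Finset.mem_Icc.1 hi).1, (Finset.mem_Icc.1 hi).2.trans h⟩) le_rfl

theorem bddRV_momentum (t : ℕ) : BddRV P (m t) :=
  ⟨(R.measurable_momentum t).mono (samplePast_le R.iid _) le_rfl, c_m, R.momentum_le t⟩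

/-- A deterministic start and bounded momenta keep each iterate bounded, with a bound depending on
`t`. Continuous expressions in the run are therefore integrable with no further moment assumptions.
-/
theorem bddRV_iterate (t : ℕ) : BddRV P (w t) := by
  induction t with
  | zero =>
    refine ⟨(R.measurable_iterate 0).mono (samplePast_le R.iid _) le_rfl, ‖w₀‖, ?_⟩
    exact Filter.Eventually.of_forall fun ω => by rw [R.run.init]
  | succ t ih =>
    rw [funext (R.run.update t)]
    exact (ih.prodMk (R.bddRV_momentum t)).comp
      (φ := fun p : Vec d × Vec d => p.1 - stepSize r η τ t • p.2) (by fun_prop)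

theorem bddRV_grad (t : ℕ) : BddRV P (g t) := by
  cases t with
  | zero =>
    rw [← funext R.run.momentum_zero]
    exact R.bddRV_momentum 0
  | succ t =>
    have h : g (t + 1) = fun ω => m (t + 1) ω - β • m t ω := by
      funext ω
      rw [R.run.momentum_succ, add_sub_cancel_left]
    rw [h]
    exact ((R.bddRV_momentum (t + 1)).prodMk (R.bddRV_momentum t)).comp
      (φ := fun p : Vec d × Vec d => p.1 - β • p.2) (by fun_prop)

theorem continuous_gradient : Continuous (gradient (objective D F)) :=
  _root_.continuous_gradient R.smooth.contDiff

theorem continuous_hess : Continuous (hess (objective D F)) :=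
  _root_.continuous_hess R.smooth.contDiff

theorem norm_hess_le (u : Vec d) : ‖hess (objective D F) u‖ ≤ L :=
  _root_.norm_hess_le R.lipschitz_nonneg R.smooth.lipschitz_grad u

theorem bddRV_gradient (t : ℕ) : BddRV P fun ω => gradient (objective D F) (w t ω) :=
  (R.bddRV_iterate t).comp R.continuous_gradient

theorem bddRV_noise (t : ℕ) : BddRV P fun ω => g t ω - gradient (objective D F) (w t ω) :=
  ((R.bddRV_grad t).prodMk (R.bddRV_gradient t)).comp
    (φ := fun p : Vec d × Vec d => p.1 - p.2) (by fun_prop)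

theorem noise_sq_le (t : ℕ) :
    ∀ᵐ ω ∂P, ‖g t ω - gradient (objective D F) (w t ω)‖ ^ 2 ≤ σ ^ 2 := by
  have h : ∀ᵐ x ∂(P.map (ξ t)), ∀ u : Vec d,
      ‖gradient (objective D F) u - stochGrad F u x‖ ^ 2 ≤ σ ^ 2 := by
    rw [R.iid.law t]
    exact R.smooth.noise
  filter_upwards [ae_of_ae_map (R.iid.measurable t).aemeasurable h] with ω hω
  rw [norm_sub_rev, R.run.grad]
  exact hω (w t ω)

end MomentumRun

/-- Unbiasedness is a consequence of the setting: one differentiates under the integral sign. Near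
`u` the uniform noise bound and the Lipschitz gradient provide a constant dominating function. -/
theorem integral_stochGrad [IsProbabilityMeasure D] (hF : SmoothStochastic D F L ρ σ) (u : Vec d) :
    Integrable (stochGrad F u) D ∧ ∫ x, stochGrad F u x ∂D = gradient (objective D F) u := by
  have hmeas : ∀ u, Measurable (stochGrad F u) := fun u =>
    hF.measurable_grad.comp (measurable_const.prodMk measurable_id)
  have hL : ∀ᵐ x ∂D, ∀ y ∈ Metric.ball u 1,
      ‖stochGrad F y x‖ ≤ ‖gradient (objective D F) u‖ + |L| + |σ| := by
    filter_upwards [hF.noise] with x hx y hy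
    have h1 : ‖gradient (objective D F) y - stochGrad F y x‖ ≤ |σ| := by
      simpa only [abs_norm] using sq_le_sq.1 (hx y)
    have h2 : ‖gradient (objective D F) y - gradient (objective D F) u‖ ≤ |L| := by
      refine (hF.lipschitz_grad y u).trans ?_
      rw [Metric.mem_ball, dist_eq_norm] at hy
      calc L * ‖y - u‖ ≤ |L| * ‖y - u‖ := by gcongr; exact le_abs_self L
        _ ≤ |L| := mul_le_of_le_one_right (abs_nonneg _) hy.le
    have h3 : stochGrad F y x = gradient (objective D F) u
        + (gradient (objective D F) y - gradient (objective D F) u)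
        - (gradient (objective D F) y - stochGrad F y x) := by abel
    rw [h3]
    exact (norm_sub_le _ _).trans (add_le_add ((norm_add_le _ _).trans (add_le_add le_rfl h2)) h1)
  have hint : Integrable (stochGrad F u) D :=
    Integrable.of_bound (hmeas u).aestronglyMeasurable _
      (hL.mono fun x hx => hx u (Metric.mem_ball_self one_pos))
  refine ⟨hint, ?_⟩
  have h := hasFDerivAt_integral_of_dominated_of_fderiv_le (μ := D) (𝕜 := ℝ) (F := F) (x₀ := u)
    (F' := fun y x => InnerProductSpace.toDual ℝ (Vec d) (stochGrad F y x))
    (bound := fun _ => ‖gradient (objective D F) u‖ + |L| + |σ|)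
    (Metric.ball_mem_nhds u one_pos)
    (Filter.Eventually.of_forall fun y => (hF.integrable y).aestronglyMeasurable)
    (hF.integrable u)
    ((InnerProductSpace.toDual ℝ (Vec d)).continuous.comp_aestronglyMeasurable
      (hmeas u).aestronglyMeasurable)
    (hL.mono fun x hx y hy => by rw [LinearIsometryEquiv.norm_map]; exact hx y hy)
    (integrable_const _)
    (hF.differentiable.mono fun x hx y _ => (hx y).hasGradientAt.hasFDerivAt)
  have h2 : ∫ x, InnerProductSpace.toDual ℝ (Vec d) (stochGrad F u x) ∂D
      = InnerProductSpace.toDual ℝ (Vec d) (∫ x, stochGrad F u x ∂D) :=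
    (InnerProductSpace.toDual ℝ (Vec d)).toContinuousLinearEquiv.toContinuousLinearMap.integral_comp_comm hint
  rw [h2] at h
  have h3 : HasGradientAt (objective D F) (∫ x, stochGrad F u x ∂D) u := h
  exact h3.gradient.symm

/-- `Y` and `w_t` depend only on samples before `ξ_t`, so their joint law with `ξ_t` is a product.
By Fubini one integrates over the fresh sample first, where the noise has mean zero. The sample
filtration is used since it may be larger than that of the iterates; later `Y` involves momenta. -/
theorem MomentumRun.integral_inner_noise [IsProbabilityMeasure D] [IsProbabilityMeasure P]
    (R : MomentumRun D P F ξ w₀ L ρ σ c_m β r η τ w g m) {t : ℕ} {Y : Ω → Vec d}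
    (hY : Measurable[samplePast ξ t] Y) (hYb : ∃ C : ℝ, ∀ᵐ ω ∂P, ‖Y ω‖ ≤ C) :
    ∫ ω, inner ℝ (Y ω) (g t ω - gradient (objective D F) (w t ω)) ∂P = 0 := by
  set Φ : (Vec d × Vec d) × Ξ → ℝ := fun p =>
    inner ℝ p.1.1 (stochGrad F p.1.2 p.2 - gradient (objective D F) p.1.2) with hΦ
  have hΦm : Measurable Φ := by
    refine Measurable.inner (by fun_prop) (Measurable.sub ?_ ?_)
    · exact R.smooth.measurable_grad.comp (f := fun p : (Vec d × Vec d) × Ξ => (p.1.2, p.2))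
        (by fun_prop)
    · exact R.continuous_gradient.measurable.comp (f := fun p : (Vec d × Vec d) × Ξ => p.1.2)
        (by fun_prop)
  have hle := samplePast_le R.iid t
  set Z : Ω → Vec d × Vec d := fun ω => (Y ω, w t ω) with hZ
  have hZm' : Measurable[samplePast ξ t] Z := hY.prodMk (R.measurable_iterate t)
  have hZm : Measurable Z := hZm'.mono hle le_rfl
  have hind : IndepFun Z (ξ t) P :=
    indep_of_indep_of_le_left (indep_samplePast R.iid t) hZm'.comap_le
  have hlaw := (indepFun_iff_map_prod_eq_prod_map_map hZm.aemeasurable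
    (R.iid.measurable t).aemeasurable).1 hind
  rw [R.iid.law t] at hlaw
  have hpm : Measurable fun ω => (Z ω, ξ t ω) := hZm.prodMk (R.iid.measurable t)
  have heq : (fun ω => inner ℝ (Y ω) (g t ω - gradient (objective D F) (w t ω)))
      = fun ω => Φ (Z ω, ξ t ω) := by
    funext ω
    simp only [hΦ, hZ, R.run.grad]
  have hYB : BddRV P Y := ⟨hY.mono hle le_rfl, hYb⟩
  have hint : Integrable (fun ω => Φ (Z ω, ξ t ω)) P := by
    rw [← heq]
    exact ((hYB.prodMk (R.bddRV_noise t)).comp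
      (φ := fun p : Vec d × Vec d => (inner ℝ p.1 p.2 : ℝ)) (by fun_prop)).integrable
  have hint' : Integrable Φ ((P.map Z).prod D) := by
    rw [← hlaw]
    exact (integrable_map_measure hΦm.aestronglyMeasurable hpm.aemeasurable).2 hint
  rw [heq, ← integral_map hpm.aemeasurable hΦm.aestronglyMeasurable, hlaw, integral_prod _ hint']
  refine integral_eq_zero_of_ae (Filter.Eventually.of_forall fun z => ?_)
  obtain ⟨hi, he⟩ := integral_stochGrad R.smooth z.2
  simp only [hΦ, Pi.zero_apply]
  have h := integral_inner (𝕜 := ℝ) (hi.sub (integrable_const (gradient (objective D F) z.2))) z.1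
  simp only [Pi.sub_apply] at h
  rw [h, integral_sub hi (integrable_const _), he]
  simp

end Run

/-! ### Descent over one step and over one period -/

section Descent

variable {d : ℕ} {Ξ Ω : Type*} [MeasurableSpace Ξ] [MeasurableSpace Ω]
  {D : Measure Ξ} {P : Measure Ω} [IsProbabilityMeasure D] [IsProbabilityMeasure P]
  {F : Vec d → Ξ → ℝ} {ξ : ℕ → Ω → Ξ}
  {w₀ : Vec d} {L ρ σ c_m β r η c_h ε : ℝ} {τ : ℕ} {w g m : ℕ → Ω → Vec d}

theorem setIntegral_linear_combination {X Y Z : Ω → ℝ} (hX : Integrable X P)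
    (hY : Integrable Y P) (hZ : Integrable Z P) (a b c k : ℝ) (B : Set Ω) :
    Integrable (fun ω => a * X ω + b * Y ω + c * Z ω + k) P ∧
    ∫ ω in B, (a * X ω + b * Y ω + c * Z ω + k) ∂P
      = a * ∫ ω in B, X ω ∂P + b * ∫ ω in B, Y ω ∂P + c * ∫ ω in B, Z ω ∂P + k * P.real B := by
  have h1 : Integrable (fun ω => a * X ω) P := hX.const_mul a
  have h2 : Integrable (fun ω => b * Y ω) P := hY.const_mul b
  have h3 : Integrable (fun ω => c * Z ω) P := hZ.const_mul c
  have h4 : Integrable (fun ω => a * X ω + b * Y ω) P := h1.add h2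
  have h5 : Integrable (fun ω => a * X ω + b * Y ω + c * Z ω) P := h4.add h3
  refine ⟨h5.add (integrable_const k), ?_⟩
  rw [integral_add h5.integrableOn (integrable_const k).integrableOn,
    integral_add h4.integrableOn h3.integrableOn, integral_add h1.integrableOn h2.integrableOn,
    integral_const_mul, integral_const_mul, integral_const_mul, setIntegral_const, smul_eq_mul,
    mul_comm k]

theorem stepSize_of_dvd {t : ℕ} (r η : ℝ) (ht : τ ∣ t) : stepSize r η τ t = r :=
  if_pos (Nat.mod_eq_zero_of_dvd ht)

theorem stepSize_add {t i : ℕ} (r η : ℝ) (ht : τ ∣ t) (hi : 1 ≤ i) (hi' : i < τ) :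
    stepSize r η τ (t + i) = η := by
  refine if_neg fun h => ?_
  have h1 : τ ∣ i := (Nat.dvd_add_right ht).1 (Nat.dvd_of_mod_eq_zero h)
  have := Nat.le_of_dvd (by omega) h1
  omega

namespace MomentumRun

variable (R : MomentumRun D P F ξ w₀ L ρ σ c_m β r η τ w g m)
include R

theorem bddRV_objective (t : ℕ) : BddRV P fun ω => objective D F (w t ω) :=
  (R.bddRV_iterate t).comp R.smooth.contDiff.continuous

theorem setIntegral_inner_noise {t : ℕ} {Y : Ω → Vec d} {B : Set Ω}
    (hB : MeasurableSet[samplePast ξ t] B) (hY : Measurable[samplePast ξ t] Y)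
    (hYb : ∃ C : ℝ, ∀ᵐ ω ∂P, ‖Y ω‖ ≤ C) :
    ∫ ω in B, inner ℝ (Y ω) (g t ω - gradient (objective D F) (w t ω)) ∂P = 0 := by
  rw [← integral_indicator (samplePast_le R.iid t _ hB),
    ← R.integral_inner_noise (hY.indicator hB) ?_]
  · congr 1
    funext ω
    by_cases h : ω ∈ B <;> simp [h]
  · obtain ⟨C, hC⟩ := hYb
    refine ⟨C, hC.mono fun ω h => (norm_indicator_le_norm_self Y ω).trans h⟩

theorem setIntegral_condE {t : ℕ} {X : Ω → ℝ} {B : Set Ω} (hX : Integrable X P)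
    (hB : MeasurableSet[past w t] B) :
    ∫ ω in B, condE P w t X ω ∂P = ∫ ω in B, X ω ∂P :=
  setIntegral_condExp (R.past_le t) hX hB

theorem measurableSet_of_past {t : ℕ} {B : Set Ω} (hB : MeasurableSet[past w t] B) :
    MeasurableSet B := R.past_le t _ hB

theorem integrable_normSq_gradient (t : ℕ) :
    Integrable (fun ω => ‖gradient (objective D F) (w t ω)‖ ^ 2) P :=
  ((R.bddRV_gradient t).comp (φ := fun x : Vec d => ‖x‖ ^ 2) (by fun_prop)).integrable

theorem integrable_inner_gradient_noise (t : ℕ) :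
    Integrable (fun ω => (inner ℝ (gradient (objective D F) (w t ω))
      (g t ω - gradient (objective D F) (w t ω)) : ℝ)) P :=
  (((R.bddRV_gradient t).prodMk (R.bddRV_noise t)).comp
    (φ := fun p : Vec d × Vec d => (inner ℝ p.1 p.2 : ℝ)) (by fun_prop)).integrable

theorem setIntegral_inner_gradient_noise {t : ℕ} {B : Set Ω} (hB : MeasurableSet[past w t] B) :
    ∫ ω in B, (inner ℝ (gradient (objective D F) (w t ω))
      (g t ω - gradient (objective D F) (w t ω)) : ℝ) ∂P = 0 :=
  R.setIntegral_inner_noise (R.past_le_samplePast t _ hB)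
    (R.continuous_gradient.measurable.comp (R.measurable_iterate t)) (R.bddRV_gradient t).2

theorem objective_succ_le (t : ℕ) : ∀ᵐ ω ∂P,
    objective D F (w (t + 1) ω) - objective D F (w t ω)
      ≤ -stepSize r η τ t * inner ℝ (gradient (objective D F) (w t ω)) (m t ω)
        + stepSize r η τ t ^ 2 / 2 * inner ℝ (m t ω) (hess (objective D F) (w t ω) (m t ω))
        + stepSize r η τ t ^ 3 * (ρ * c_m ^ 3) := by
  filter_upwards [R.momentum_le t] with ω hω
  set h := stepSize r η τ t with hh
  have h0 : 0 < h := step_nonneg R.large_step_pos R.step_pos τ t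
  have h1 := le_of_abs_le (abs_apply_add_sub_quadratic_le R.smooth.contDiff R.lipschitz_hess_nonneg
    R.smooth.lipschitz_hess (w t ω) (-(h • m t ω)))
  rw [← sub_eq_add_neg, ← R.run.update t ω, norm_neg, norm_smul, Real.norm_of_nonneg h0.le,
    inner_neg_right, real_inner_smul_right, map_neg, inner_neg_neg, map_smul,
    real_inner_smul_left, real_inner_smul_right] at h1
  have h2 : ρ * (h * ‖m t ω‖) ^ 3 ≤ h ^ 3 * (ρ * c_m ^ 3) := by
    have := R.lipschitz_hess_nonneg
    calc _ ≤ ρ * (h * c_m) ^ 3 := by gcongr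
      _ = _ := by ring
  linarith

/-- One step of the algorithm, integrated over an event of the past. -/
theorem setIntegral_objective_succ_le {t : ℕ} {B : Set Ω} (hB : MeasurableSet[past w t] B)
    (hGr : GrACE P (objective D F) (stepSize r η τ) c_h w g m) :
    ∫ ω in B, (objective D F (w (t + 1) ω) - objective D F (w t ω)) ∂P
      ≤ -stepSize r η τ t * ∫ ω in B, ‖gradient (objective D F) (w t ω)‖ ^ 2 ∂P
        + stepSize r η τ t ^ 2 * (c_h + stepSize r η τ t * (ρ * c_m ^ 3)) * P.real B := by
  set h := stepSize r η τ t with hh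
  set X : Ω → ℝ := fun ω => h * inner ℝ (gradient (objective D F) (w t ω)) (g t ω - m t ω)
      + h ^ 2 / 2 * inner ℝ (m t ω) (hess (objective D F) (w t ω) (m t ω)) with hX
  have hXint : Integrable X P := by
    have := R.continuous_gradient
    have := R.continuous_hess
    refine ((((R.bddRV_iterate t).prodMk (R.bddRV_grad t)).prodMk (R.bddRV_momentum t)).comp
      (φ := fun p : (Vec d × Vec d) × Vec d =>
        h * inner ℝ (gradient (objective D F) p.1.1) (p.1.2 - p.2)
          + h ^ 2 / 2 * inner ℝ p.2 (hess (objective D F) p.1.1 p.2)) ?_).integrable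
    fun_prop
  have hX1 : ∫ ω in B, X ω ∂P ≤ h ^ 2 * c_h * P.real B := by
    rw [← R.setIntegral_condE hXint hB]
    have h1 : ∫ _ in B, h ^ 2 * c_h ∂P = h ^ 2 * c_h * P.real B := by
      rw [setIntegral_const, smul_eq_mul, mul_comm]
    rw [← h1]
    refine setIntegral_mono_ae integrable_condExp.integrableOn (integrable_const _).integrableOn ?_
    exact hGr t
  have hN := R.setIntegral_inner_gradient_noise hB
  have hNi := R.integrable_inner_gradient_noise t
  have hSi := R.integrable_normSq_gradient t
  obtain ⟨hi, he⟩ := setIntegral_linear_combination hXint hNi hSi 1 (-h) (-h)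
    (h ^ 3 * (ρ * c_m ^ 3)) B
  have key : ∫ ω in B, (objective D F (w (t + 1) ω) - objective D F (w t ω)) ∂P
      ≤ ∫ ω in B, (1 * X ω + -h * inner ℝ (gradient (objective D F) (w t ω))
          (g t ω - gradient (objective D F) (w t ω))
        + -h * ‖gradient (objective D F) (w t ω)‖ ^ 2 + h ^ 3 * (ρ * c_m ^ 3)) ∂P := by
    refine setIntegral_mono_ae
      ((R.bddRV_objective (t + 1)).integrable.sub (R.bddRV_objective t).integrable).integrableOn
      hi.integrableOn ?_
    filter_upwards [R.objective_succ_le t] with ω hω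
    -- With `h` the step size, `-h⟨∇f, m⟩ = h⟨∇f, g - m⟩ - h⟨∇f, g - ∇f⟩ - h‖∇f‖²`. The first part
    -- joins the curvature term under GrACE, the second integrates to zero, and the third is the
    -- retained descent.
    refine hω.trans (le_of_eq ?_)
    simp only [hX, ← hh, inner_sub_right, real_inner_self_eq_norm_sq]
    ring
  rw [he, hN] at key
  linarith

/-- An event of the past at time `t` remains one at every later time, so the one-step bound can be
iterated over the small steps of the period. -/
theorem setIntegral_tail_le {t : ℕ} {B : Set Ω} (hB : MeasurableSet[past w t] B) (ht : τ ∣ t)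
    (hGr : GrACE P (objective D F) (stepSize r η τ) c_h w g m) {n : ℕ} (hn : 1 ≤ n)
    (hnτ : n ≤ τ) :
    ∫ ω in B, (objective D F (w (t + n) ω) - objective D F (w (t + 1) ω)) ∂P
      ≤ -η * ∑ i ∈ Finset.Ico 1 n, ∫ ω in B, ‖gradient (objective D F) (w (t + i) ω)‖ ^ 2 ∂P
        + (n - 1) * η ^ 2 * (c_h + η * (ρ * c_m ^ 3)) * P.real B := by
  induction n, hn using Nat.le_induction with
  | base => simp
  | succ n hn ih =>
    have h1 := ih (by omega)
    have h2 := R.setIntegral_objective_succ_le (t := t + n) (past_mono w (by omega) _ hB) hGr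
    rw [stepSize_add r η ht hn (by omega)] at h2
    have i := fun s => ((R.bddRV_objective s).integrable).integrableOn (s := B)
    rw [Finset.sum_Ico_succ_top hn]
    rw [integral_sub (i _) (i _)] at h1 h2 ⊢
    rw [← add_assoc]
    push_cast
    nlinarith

/-- The large step and the tail each raise the integral by at most `2r²c_h P(B)`: the tail because
`τη² ≤ r²`, and both because the cubic Taylor error is at most `c_h` after division by the squared
step. The retained gradient sum later limits the displacement. -/
theorem setIntegral_period_le {t : ℕ} {B : Set Ω} (hB : MeasurableSet[past w t] B) (ht : τ ∣ t)
    (hGr : GrACE P (objective D F) (stepSize r η τ) c_h w g m) (hτ : 1 ≤ τ) (hηr : η ≤ r)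
    (hητ : τ * η ^ 2 ≤ r ^ 2) (hr : r * (ρ * c_m ^ 3) ≤ c_h) (hc : 0 ≤ c_h) :
    ∫ ω in B, (objective D F (w (t + τ) ω) - objective D F (w t ω)) ∂P
      ≤ -r * ∫ ω in B, ‖gradient (objective D F) (w t ω)‖ ^ 2 ∂P
        - η * ∑ i ∈ Finset.Ico 1 τ, ∫ ω in B, ‖gradient (objective D F) (w (t + i) ω)‖ ^ 2 ∂P
        + 4 * r ^ 2 * c_h * P.real B := by
  have h1 := R.setIntegral_tail_le hB ht hGr hτ le_rfl
  have h2 := R.setIntegral_objective_succ_le hB hGr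
  rw [stepSize_of_dvd r η ht] at h2
  have i := fun s => ((R.bddRV_objective s).integrable).integrableOn (s := B)
  rw [integral_sub (i _) (i _)] at h1 h2 ⊢
  have hP : 0 ≤ P.real B := measureReal_nonneg
  have hρ : 0 ≤ ρ * c_m ^ 3 := mul_nonneg R.lipschitz_hess_nonneg (pow_nonneg R.momentum_nonneg 3)
  have hη := R.step_pos
  have h3 : ((τ : ℝ) - 1) * η ^ 2 * (c_h + η * (ρ * c_m ^ 3)) * P.real B
      ≤ r ^ 2 * (2 * c_h) * P.real B := by
    have h4 : ((τ : ℝ) - 1) * η ^ 2 ≤ r ^ 2 := by nlinarith [sq_nonneg η]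
    have h5 : c_h + η * (ρ * c_m ^ 3) ≤ 2 * c_h := by nlinarith
    gcongr
  have h4 : r ^ 2 * (c_h + r * (ρ * c_m ^ 3)) * P.real B ≤ r ^ 2 * (2 * c_h) * P.real B := by
    gcongr
    linarith
  linarith

/-- Decrease over a period that starts at a large gradient. -/
theorem setIntegral_period_le_of_large_gradient {t : ℕ} {B : Set Ω}
    (hB : MeasurableSet[past w t] B) (ht : τ ∣ t)
    (hGr : GrACE P (objective D F) (stepSize r η τ) c_h w g m)
    (hAP : APAG P (objective D F) ε w g m) (hε : 0 ≤ ε)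
    (hBε : ∀ ω ∈ B, ε ≤ ‖gradient (objective D F) (w t ω)‖) (hτ : 1 ≤ τ) (hηr : η ≤ r)
    (hητ : τ * η ^ 2 ≤ r ^ 2) (hr : r * (ρ * c_m ^ 3) ≤ c_h) (hc : 0 ≤ c_h) :
    ∫ ω in B, (objective D F (w (t + τ) ω) - objective D F (w t ω)) ∂P
      ≤ (-(r / 2) * ε ^ 2 + r ^ 2 * (L * c_m ^ 2 + 3 * c_h)) * P.real B := by
  have hBm := R.measurableSet_of_past hB
  have h1 := R.setIntegral_tail_le hB ht hGr hτ le_rfl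
  have i := fun s => ((R.bddRV_objective s).integrable).integrableOn (s := B)
  have hP : 0 ≤ P.real B := measureReal_nonneg
  have hρ : 0 ≤ ρ * c_m ^ 3 := mul_nonneg R.lipschitz_hess_nonneg (pow_nonneg R.momentum_nonneg 3)
  have hη := R.step_pos
  have hr0 := R.large_step_pos
  have hL := R.lipschitz_nonneg
  have hcm := R.momentum_nonneg
  have hNi := R.integrable_inner_gradient_noise t
  have hN := R.setIntegral_inner_gradient_noise hB
  have hSi := R.integrable_normSq_gradient t
  set X : Ω → ℝ := fun ω => inner ℝ (gradient (objective D F) (w t ω)) (m t ω - g t ω) with hX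
  have hXi : Integrable X P :=
    (((R.bddRV_gradient t).prodMk ((R.bddRV_momentum t).prodMk (R.bddRV_grad t))).comp
      (φ := fun p : Vec d × Vec d × Vec d => (inner ℝ p.1 (p.2.1 - p.2.2) : ℝ))
      (by fun_prop)).integrable
  -- Integrated APAG: together with mean-zero noise it makes the large step keep at least half of
  -- the integrated squared gradient.
  have h2 : -(1 / 2) * ∫ ω in B, ‖gradient (objective D F) (w t ω)‖ ^ 2 ∂P ≤ ∫ ω in B, X ω ∂P := by
    rw [← R.setIntegral_condE hXi hB, ← integral_const_mul]
    refine setIntegral_mono_on_ae (hSi.const_mul _).integrableOn integrable_condExp.integrableOn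
      hBm ?_
    filter_upwards [hAP t] with ω hω hωB using hω (hBε ω hωB)
  have h3 : ε ^ 2 * P.real B ≤ ∫ ω in B, ‖gradient (objective D F) (w t ω)‖ ^ 2 ∂P := by
    have : ∫ _ in B, ε ^ 2 ∂P = ε ^ 2 * P.real B := by
      rw [setIntegral_const, smul_eq_mul, mul_comm]
    rw [← this]
    refine setIntegral_mono_on (integrable_const _).integrableOn hSi.integrableOn hBm ?_
    intro ω hω
    have := hBε ω hω
    gcongr
  obtain ⟨hi, he⟩ := setIntegral_linear_combination hXi hNi hSi (-r) (-r) (-r)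
    (r ^ 2 * (L * c_m ^ 2 + c_h)) B
  have key : ∫ ω in B, (objective D F (w (t + 1) ω) - objective D F (w t ω)) ∂P
      ≤ ∫ ω in B, (-r * X ω + -r * inner ℝ (gradient (objective D F) (w t ω))
          (g t ω - gradient (objective D F) (w t ω))
        + -r * ‖gradient (objective D F) (w t ω)‖ ^ 2 + r ^ 2 * (L * c_m ^ 2 + c_h)) ∂P := by
    refine setIntegral_mono_ae
      ((R.bddRV_objective (t + 1)).integrable.sub (R.bddRV_objective t).integrable).integrableOn
      hi.integrableOn ?_
    filter_upwards [R.objective_succ_le t, R.momentum_le t] with ω hω hm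
    refine hω.trans ?_
    rw [stepSize_of_dvd r η ht]
    have h5 : inner ℝ (m t ω) (hess (objective D F) (w t ω) (m t ω)) ≤ L * c_m ^ 2 := by
      calc _ ≤ ‖m t ω‖ * (‖hess (objective D F) (w t ω)‖ * ‖m t ω‖) :=
            (real_inner_le_norm _ _).trans (by gcongr; exact ContinuousLinearMap.le_opNorm _ _)
        _ ≤ c_m * (L * c_m) := by
            have := R.norm_hess_le (w t ω)
            gcongr
        _ = L * c_m ^ 2 := by ring
    have h6 : r ^ 2 / 2 * inner ℝ (m t ω) (hess (objective D F) (w t ω) (m t ω))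
        ≤ r ^ 2 * (L * c_m ^ 2) := by
      have : 0 ≤ r ^ 2 * (L * c_m ^ 2) := by positivity
      nlinarith [sq_nonneg r]
    have h7 : r ^ 3 * (ρ * c_m ^ 3) ≤ r ^ 2 * c_h := by
      calc _ = r ^ 2 * (r * (ρ * c_m ^ 3)) := by ring
        _ ≤ _ := by gcongr
    simp only [hX, inner_sub_right, real_inner_self_eq_norm_sq]
    linarith
  rw [he, hN] at key
  have h4 : ((τ : ℝ) - 1) * η ^ 2 * (c_h + η * (ρ * c_m ^ 3)) * P.real B
      ≤ r ^ 2 * (2 * c_h) * P.real B := by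
    have h4 : ((τ : ℝ) - 1) * η ^ 2 ≤ r ^ 2 := by nlinarith [sq_nonneg η]
    have h5 : c_h + η * (ρ * c_m ^ 3) ≤ 2 * c_h := by nlinarith
    gcongr
  have h5 : 0 ≤ ∑ i ∈ Finset.Ico 1 τ,
      ∫ ω in B, ‖gradient (objective D F) (w (t + i) ω)‖ ^ 2 ∂P :=
    Finset.sum_nonneg fun _ _ => integral_nonneg fun _ => by positivity
  have h6 := mul_nonneg hη.le h5
  have h7 := mul_le_mul_of_nonneg_left h2 hr0.le
  have h8 := mul_le_mul_of_nonneg_left h3 hr0.le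
  rw [integral_sub (i _) (i _)] at h1 key ⊢
  linarith

end MomentumRun

end Descent

/-! ### Pathwise recursion for the displacement within a period -/

section Recursion

variable {d : ℕ} {H : Vec d →L[ℝ] Vec d} {L ρ c_m β r η ε : ℝ} {τ : ℕ} {u m y : ℕ → Vec d}

theorem momentum_eq_sum (hm : ∀ s, m (s + 1) = β • m s + y (s + 1)) (s : ℕ) :
    m s = β ^ s • m 0 + ∑ i ∈ Finset.Icc 1 s, β ^ (s - i) • y i := by
  induction s with
  | zero => simp
  | succ s ih =>
    rw [hm, Finset.sum_Icc_succ_top (by omega), ih, smul_add, smul_smul, ← pow_succ',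
      Finset.smul_sum, Nat.sub_self, pow_zero, one_smul, add_assoc]
    congr 2
    refine Finset.sum_congr rfl fun i hi => ?_
    rw [smul_smul, ← pow_succ', Nat.sub_add_comm (Finset.mem_Icc.1 hi).2]

/-- The displacement as a weighted sum of the gradients. -/
theorem displacement_eq_sum (hu1 : u 1 = -(r • m 0))
    (hu : ∀ s, 1 ≤ s → s < τ → u (s + 1) = u s - η • m s)
    (hm : ∀ s, m (s + 1) = β • m s + y (s + 1)) {s : ℕ} (hs : 1 ≤ s) (hsτ : s ≤ τ) :
    u s = -(r • m 0) - η • ((∑ j ∈ Finset.Ico 1 s, β ^ j) • m 0)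
      - η • ∑ i ∈ Finset.Ico 1 s, geomWeight β (s - i) • y i := by
  induction s, hs using Nat.le_induction with
  | base => simp [hu1]
  | succ s hs ih =>
    have h1 : ∑ i ∈ Finset.Ico 1 (s + 1), geomWeight β (s + 1 - i) • y i
        = ∑ i ∈ Finset.Ico 1 s, geomWeight β (s - i) • y i
          + ∑ i ∈ Finset.Icc 1 s, β ^ (s - i) • y i := by
      have h2 : ∑ i ∈ Finset.Ico 1 s, geomWeight β (s - i) • y i
          = ∑ i ∈ Finset.Ico 1 (s + 1), geomWeight β (s - i) • y i := by
        rw [Finset.sum_Ico_succ_top hs, Nat.sub_self, geomWeight_zero, zero_smul, add_zero]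
      rw [h2, show Finset.Icc 1 s = Finset.Ico 1 (s + 1) by rfl, ← Finset.sum_add_distrib]
      refine Finset.sum_congr rfl fun i hi => ?_
      rw [Nat.succ_sub (Nat.lt_succ_iff.1 (Finset.mem_Ico.1 hi).2), geomWeight_succ, add_smul]
    rw [hu s hs (by omega), ih (by omega), h1, Finset.sum_Ico_succ_top hs, momentum_eq_sum hm s]
    simp only [smul_add, add_smul]
    abel

/-- The perturbation of the linear recursion `u_{s+1} = G_s u_s`. -/
def perturbation (β : ℝ) (H : Vec d →L[ℝ] Vec d) (u m y : ℕ → Vec d) (s : ℕ) : Vec d :=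
  ∑ i ∈ Finset.Icc 1 s, β ^ (s - i) • (H (u s - u i) - (y i - H (u i))) - β ^ s • m 0

/-- Replacing each past gradient by `H u_s` collects the momentum weights into `G_s`. The errors of
this replacement, together with the momentum inherited from the start, form the perturbation. -/
theorem displacement_succ (hu : ∀ s, 1 ≤ s → s < τ → u (s + 1) = u s - η • m s)
    (hm : ∀ s, m (s + 1) = β • m s + y (s + 1)) {s : ℕ} (hs : 1 ≤ s) (hsτ : s < τ) :
    u (s + 1) = gOp η β H s (u s) + η • perturbation β H u m y s := by
  have h1 : ∑ i ∈ Finset.Icc 1 s, β ^ (s - i) • (H (u s - u i) - (y i - H (u i)))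
      = geomWeight β s • H (u s) - ∑ i ∈ Finset.Icc 1 s, β ^ (s - i) • y i := by
    rw [geomWeight, Finset.sum_smul, ← Finset.sum_sub_distrib]
    refine Finset.sum_congr rfl fun i _ => ?_
    rw [map_sub, ← smul_sub]
    congr 1
    abel
  rw [hu s hs hsτ, momentum_eq_sum hm s, perturbation, h1, gOp_eq, sub_apply, smul_apply,
    one_apply_eq_self]
  simp only [smul_add, smul_sub, smul_smul]
  abel

theorem gOp_mul_gProd_comm (η β : ℝ) (H : Vec d →L[ℝ] Vec d) (s a b : ℕ) :
    gOp η β H s * gProd η β H a b = gProd η β H a b * gOp η β H s := by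
  refine (Commute.list_prod_right _ _ fun x hx => ?_).eq
  obtain ⟨k, -, rfl⟩ := List.mem_map.1 hx
  rw [gOp_eq, gOp_eq]
  have h : Commute ((η * geomWeight β s) • H) ((η * geomWeight β k) • H) := by
    refine ContinuousLinearMap.ext fun x => ?_
    simp only [mul_apply_eq_comp, smul_apply, map_smul]
    rw [smul_comm]
  exact (Commute.sub_left (Commute.one_left _)
    ((Commute.one_right _).sub_right h))

/-- Discrete variation of constants, by downward induction on the starting index. Commutation of the
factors lets the new factor be moved next to `u k`. -/
theorem displacement_eq_gProd (hu : ∀ s, 1 ≤ s → s < τ → u (s + 1) = u s - η • m s)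
    (hm : ∀ s, m (s + 1) = β • m s + y (s + 1)) {k : ℕ} (hk : 1 ≤ k) (hkτ : k ≤ τ) :
    u τ = gProd η β H k τ (u k)
      + η • ∑ s ∈ Finset.Ico k τ, gProd η β H (s + 1) τ (perturbation β H u m y s) := by
  induction hkτ using Nat.decreasingInduction with
  | self => simp [gProd_self]
  | of_succ k hkτ ih =>
    rw [ih (by omega), displacement_succ (H := H) hu hm hk hkτ, map_add, map_smul,
      gProd_eq_mul η β H hkτ, gOp_mul_gProd_comm, mul_apply_eq_comp,
      Finset.sum_eq_sum_Ico_succ_bot hkτ, smul_add, add_assoc]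

/-- Starting at `i ≥ 1` excludes the large step, so every increment is at most `ηc_m`. -/
theorem norm_displacement_sub_le (hη : 0 ≤ η)
    (hu : ∀ s, 1 ≤ s → s < τ → u (s + 1) = u s - η • m s) (hmc : ∀ s, ‖m s‖ ≤ c_m) {i s : ℕ}
    (hi : 1 ≤ i) (his : i ≤ s) (hs : s ≤ τ) : ‖u s - u i‖ ≤ ((s : ℝ) - i) * (η * c_m) := by
  induction s, his using Nat.le_induction with
  | base => simp
  | succ s his ih =>
    rw [hu s (by omega) (by omega), sub_right_comm]
    refine (norm_sub_le _ _).trans ?_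
    rw [norm_smul, Real.norm_of_nonneg hη]
    have := mul_le_mul_of_nonneg_left (hmc s) hη
    have := ih (by omega)
    push_cast
    linarith

/-- The pieces proportional to the initial gradient and to the noise are kept exactly, to be
averaged later. The Hessian differences and Taylor remainders are bounded in norm, gaining `decay`
from the ratio of the two products, and the inherited momentum is dropped by sign. -/
theorem inner_gProd_perturbation_le (hH : ∀ x y, inner ℝ (H x) y = inner ℝ x (H y)) (hη : 0 ≤ η)
    (hβ : 0 ≤ β) (hβ1 : β < 1) (hε : 0 ≤ ε) (hcm : 0 ≤ c_m) (hHL : ‖H‖ ≤ L)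
    (hG : ∀ s, η * geomWeight β s * ‖H‖ ≤ 1) {μ : ℝ} (hμ : μ ∈ eigenvalues H) (hμε : μ ≤ -ε)
    (hu : ∀ s, 1 ≤ s → s < τ → u (s + 1) = u s - η • m s) (hmc : ∀ s, ‖m s‖ ≤ c_m)
    {G₀ : Vec d} {n q : ℕ → Vec d} (hy : ∀ i, y i = G₀ + H (u i) + q i + n i)
    (hq : ∀ i, ‖q i‖ ≤ ρ * ‖u i‖ ^ 2) {s : ℕ} (hsτ : s < τ) :
    inner ℝ (gProd η β H 1 τ (m 0)) (gProd η β H (s + 1) τ (perturbation β H u m y s))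
      ≤ -(geomWeight β s * inner ℝ G₀ (mOp η β τ (s + 1) H (m 0))
          + ∑ i ∈ Finset.Icc 1 s, β ^ (s - i) * inner ℝ (n i) (mOp η β τ (s + 1) H (m 0)))
        + c_m * ‖gProd η β H 1 τ‖ ^ 2 * (decay η β ε s * (L * η * c_m / (1 - β) ^ 2
          + ρ * ∑ i ∈ Finset.Icc 1 s, β ^ (s - i) * ‖u i‖ ^ 2)) := by
  set Q := gProd η β H 1 τ
  set S := gProd η β H (s + 1) τ with hS
  have hL : 0 ≤ L := (norm_nonneg H).trans hHL
  have hcomm : ∀ x, inner ℝ (Q (m 0)) (S x) = inner ℝ x (mOp η β τ (s + 1) H (m 0)) :=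
    fun x => inner_gProd_comm hH η β 1 (s + 1) τ (m 0) x
  have e : perturbation β H u m y s
      = ∑ i ∈ Finset.Icc 1 s, β ^ (s - i) • (H (u s - u i) - q i)
        - (geomWeight β s • G₀ + ∑ i ∈ Finset.Icc 1 s, β ^ (s - i) • n i) - β ^ s • m 0 := by
    rw [perturbation, geomWeight, Finset.sum_smul, ← Finset.sum_add_distrib,
      ← Finset.sum_sub_distrib]
    congr 1
    refine Finset.sum_congr rfl fun i _ => ?_
    rw [hy, ← smul_add, ← smul_sub]
    congr 1
    abel
  have hpos : 0 ≤ β ^ s * inner ℝ (Q (m 0)) (S (m 0)) :=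
    mul_nonneg (pow_nonneg hβ s) (inner_gProd_nonneg hH hη hβ hG 1 (s + 1) τ (m 0))
  have hSQ : ‖S‖ ≤ decay η β ε s * ‖Q‖ :=
    norm_gProd_le_decay_mul hH hη hβ hε hG hμ hμε (by omega)
  have hd : 0 ≤ decay η β ε s := (decay_pos hη hβ hε s).le
  have hQm : ‖Q (m 0)‖ ≤ ‖Q‖ * c_m := Q.le_of_opNorm_le_of_le le_rfl (hmc 0)
  have hmain : ∑ i ∈ Finset.Icc 1 s, β ^ (s - i) * inner ℝ (Q (m 0)) (S (H (u s - u i) - q i))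
      ≤ c_m * ‖Q‖ ^ 2 * (decay η β ε s * (L * η * c_m / (1 - β) ^ 2
          + ρ * ∑ i ∈ Finset.Icc 1 s, β ^ (s - i) * ‖u i‖ ^ 2)) := by
    have h1 : ∀ i ∈ Finset.Icc 1 s,
        β ^ (s - i) * inner ℝ (Q (m 0)) (S (H (u s - u i) - q i))
          ≤ c_m * ‖Q‖ ^ 2 * decay η β ε s * (L * η * c_m * (β ^ (s - i) * ((s : ℝ) - i))
            + ρ * (β ^ (s - i) * ‖u i‖ ^ 2)) := by
      intro i hi
      obtain ⟨hi1, hi2⟩ := Finset.mem_Icc.1 hi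
      have h2 := norm_displacement_sub_le hη hu hmc hi1 hi2 hsτ.le
      have h3 : ‖H (u s - u i) - q i‖ ≤ L * (((s : ℝ) - i) * (η * c_m)) + ρ * ‖u i‖ ^ 2 :=
        (norm_sub_le _ _).trans (add_le_add (H.le_of_opNorm_le_of_le hHL h2) (hq i))
      have h4 : inner ℝ (Q (m 0)) (S (H (u s - u i) - q i))
          ≤ (‖Q‖ * c_m) * ((decay η β ε s * ‖Q‖)
            * (L * (((s : ℝ) - i) * (η * c_m)) + ρ * ‖u i‖ ^ 2)) := by
        refine (real_inner_le_norm _ _).trans ?_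
        exact mul_le_mul hQm (S.le_of_opNorm_le_of_le hSQ h3) (norm_nonneg _) (by positivity)
      calc _ ≤ β ^ (s - i) * _ := mul_le_mul_of_nonneg_left h4 (pow_nonneg hβ _)
        _ = _ := by ring
    refine (Finset.sum_le_sum h1).trans ?_
    rw [← Finset.mul_sum, Finset.sum_add_distrib, ← Finset.mul_sum, ← Finset.mul_sum]
    have h5 := sum_pow_sub_mul_le hβ hβ1 s
    rw [mul_assoc (c_m * ‖Q‖ ^ 2)]
    have h6 : L * η * c_m * ∑ i ∈ Finset.Icc 1 s, β ^ (s - i) * ((s : ℝ) - i)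
        ≤ L * η * c_m / (1 - β) ^ 2 := by
      rw [div_eq_mul_one_div]
      gcongr
    gcongr
  have hS0 : S (perturbation β H u m y s)
      = ∑ i ∈ Finset.Icc 1 s, β ^ (s - i) • S (H (u s - u i) - q i)
        - S (geomWeight β s • G₀ + ∑ i ∈ Finset.Icc 1 s, β ^ (s - i) • n i)
        - β ^ s • S (m 0) := by
    rw [e]
    simp only [map_sub, map_smul, map_sum]
  have hS1 : inner ℝ (Q (m 0)) (S (geomWeight β s • G₀ + ∑ i ∈ Finset.Icc 1 s, β ^ (s - i) • n i))
      = geomWeight β s * inner ℝ G₀ (mOp η β τ (s + 1) H (m 0))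
          + ∑ i ∈ Finset.Icc 1 s, β ^ (s - i) * inner ℝ (n i) (mOp η β τ (s + 1) H (m 0)) := by
    rw [hcomm, inner_add_left, real_inner_smul_left, sum_inner]
    simp only [real_inner_smul_left]
  rw [hS0, inner_sub_right, inner_sub_right, hS1, real_inner_smul_right, inner_sum]
  simp only [real_inner_smul_right]
  linarith

/-- Exponential growth of the displacement along the direction of negative curvature, up to the
alignment, noise and higher-order terms. -/
theorem normSq_displacement_ge (hH : ∀ x y, inner ℝ (H x) y = inner ℝ x (H y)) (hη : 0 ≤ η)
    (hr : 0 ≤ r) (hβ : 0 ≤ β) (hβ1 : β < 1) (hε : 0 ≤ ε) (hcm : 0 ≤ c_m)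
    (hHL : ‖H‖ ≤ L) (hG : ∀ s, η * geomWeight β s * ‖H‖ ≤ 1) {μ : ℝ} (hμ : μ ∈ eigenvalues H)
    (hμε : μ ≤ -ε) (hu1 : u 1 = -(r • m 0))
    (hu : ∀ s, 1 ≤ s → s < τ → u (s + 1) = u s - η • m s)
    (hm : ∀ s, m (s + 1) = β • m s + y (s + 1)) (hmc : ∀ s, ‖m s‖ ≤ c_m)
    {G₀ : Vec d} {n q : ℕ → Vec d} (hy : ∀ i, y i = G₀ + H (u i) + q i + n i)
    (hq : ∀ i, ‖q i‖ ≤ ρ * ‖u i‖ ^ 2) (hτ : 1 ≤ τ) :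
    r ^ 2 * ‖gProd η β H 1 τ (m 0)‖ ^ 2
      + 2 * r * ∑ s ∈ Finset.Ico 1 τ, η *
        (geomWeight β s * inner ℝ G₀ (mOp η β τ (s + 1) H (m 0))
          + ∑ i ∈ Finset.Icc 1 s, β ^ (s - i) * inner ℝ (n i) (mOp η β τ (s + 1) H (m 0)))
      - 2 * r * c_m * ‖gProd η β H 1 τ‖ ^ 2 * ∑ s ∈ Finset.Ico 1 τ, η *
        (decay η β ε s * (L * η * c_m / (1 - β) ^ 2
          + ρ * ∑ i ∈ Finset.Icc 1 s, β ^ (s - i) * ‖u i‖ ^ 2))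
      ≤ ‖u τ‖ ^ 2 := by
  rw [displacement_eq_gProd (H := H) hu hm le_rfl hτ, norm_add_sq_real, hu1, map_neg, map_smul,
    norm_neg, norm_smul, mul_pow, Real.norm_of_nonneg hr, inner_neg_left, real_inner_smul_left,
    real_inner_smul_right, inner_sum]
  have h1 : ∑ s ∈ Finset.Ico 1 τ, inner ℝ (gProd η β H 1 τ (m 0))
      (gProd η β H (s + 1) τ (perturbation β H u m y s)) ≤ _ :=
    Finset.sum_le_sum fun s hs => inner_gProd_perturbation_le hH hη hβ hβ1 hε hcm hHL hG hμ hμε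
      hu hmc hy hq (Finset.mem_Ico.1 hs).2
  rw [Finset.sum_add_distrib, Finset.sum_neg_distrib, ← Finset.mul_sum] at h1
  have h2 := mul_le_mul_of_nonneg_left h1 (mul_nonneg hr hη)
  -- The square of the accumulated perturbation is discarded; only its cross term with the leading
  -- part matters.
  have h3 : 0 ≤ ‖η • ∑ s ∈ Finset.Ico 1 τ,
      gProd η β H (s + 1) τ (perturbation β H u m y s)‖ ^ 2 := by positivity
  rw [← Finset.mul_sum, ← Finset.mul_sum]
  linarith

end Recursion

/-! ### Linear upper bound for the mean-square displacement -/

section Displacement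

variable {d : ℕ} {Ξ Ω : Type*} [MeasurableSpace Ξ] [MeasurableSpace Ω]
  {D : Measure Ξ} {P : Measure Ω} [IsProbabilityMeasure D] [IsProbabilityMeasure P]
  {F : Vec d → Ξ → ℝ} {ξ : ℕ → Ω → Ξ}
  {w₀ : Vec d} {L ρ σ c_m β r η c_h ε : ℝ} {τ : ℕ} {w g m : ℕ → Ω → Vec d}

theorem normSq_sub_sub_sub_le (a b c e : Vec d) :
    ‖a - b - (c + e)‖ ^ 2 ≤ 4 * (‖a‖ ^ 2 + ‖b‖ ^ 2 + ‖c‖ ^ 2 + ‖e‖ ^ 2) := by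
  have h : ‖a - b - (c + e)‖ ≤ ‖a‖ + ‖b‖ + (‖c‖ + ‖e‖) :=
    (norm_sub_le _ _).trans (add_le_add (norm_sub_le _ _) (norm_add_le _ _))
  calc _ ≤ (‖a‖ + ‖b‖ + (‖c‖ + ‖e‖)) ^ 2 := by gcongr
    _ ≤ _ := by
      nlinarith [sq_nonneg (‖a‖ - ‖b‖), sq_nonneg (‖c‖ - ‖e‖),
        sq_nonneg (‖a‖ + ‖b‖ - (‖c‖ + ‖e‖))]

theorem normSq_sum_smul_le {κ : ℝ} (a : ℕ → ℝ) (x : ℕ → Vec d) (S : Finset ℕ)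
    (ha : ∀ i ∈ S, |a i| ≤ κ) :
    ‖∑ i ∈ S, a i • x i‖ ^ 2 ≤ S.card * κ ^ 2 * ∑ i ∈ S, ‖x i‖ ^ 2 := by
  calc _ ≤ (∑ i ∈ S, ‖a i • x i‖) ^ 2 := by
        gcongr
        exact norm_sum_le _ _
    _ ≤ S.card * ∑ i ∈ S, ‖a i • x i‖ ^ 2 := sq_sum_le_card_mul_sum_sq
    _ ≤ S.card * ∑ i ∈ S, κ ^ 2 * ‖x i‖ ^ 2 := by
        gcongr with i hi
        rw [norm_smul, mul_pow, Real.norm_eq_abs]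
        have := ha i hi
        gcongr
    _ = _ := by rw [← Finset.mul_sum, mul_assoc]

namespace MomentumRun

variable (R : MomentumRun D P F ξ w₀ L ρ σ c_m β r η τ w g m)
include R

theorem measurable_noise (t : ℕ) :
    Measurable[samplePast ξ (t + 1)] fun ω => g t ω - gradient (objective D F) (w t ω) := by
  have hw : Measurable[samplePast ξ (t + 1)] (w t) :=
    (R.measurable_iterate t).mono (samplePast_mono ξ t.le_succ) le_rfl
  refine Measurable.sub ?_ (R.continuous_gradient.measurable.comp hw)
  rw [show g t = fun ω => stochGrad F (w t ω) (ξ t ω) from funext fun ω => R.run.grad t ω]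
  exact R.smooth.measurable_grad.comp (hw.prodMk (measurable_sample ξ t))

theorem noise_sum_aux (a : ℕ → ℝ) (t : ℕ) {n : ℕ} (hn : 1 ≤ n) :
    Measurable[samplePast ξ (t + n)] (fun ω => ∑ i ∈ Finset.Ico 1 n,
      a i • (g (t + i) ω - gradient (objective D F) (w (t + i) ω))) ∧
    BddRV P (fun ω => ∑ i ∈ Finset.Ico 1 n,
      a i • (g (t + i) ω - gradient (objective D F) (w (t + i) ω))) := by
  induction n, hn using Nat.le_induction with
  | base => exact ⟨by simp, by simp, 0, by simp⟩
  | succ n hn ih =>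
    simp only [Finset.sum_Ico_succ_top hn]
    refine ⟨?_, ?_⟩
    · exact (ih.1.mono (samplePast_mono ξ (Nat.le_succ _)) le_rfl).add
        ((R.measurable_noise (t + n)).const_smul (a n))
    · exact (ih.2.prodMk (R.bddRV_noise (t + n))).comp
        (φ := fun p : Vec d × Vec d => p.1 + a n • p.2) (by fun_prop)

/-- The weighted noise terms are orthogonal. -/
theorem setIntegral_normSq_noise_sum_le (a : ℕ → ℝ) {t : ℕ} {B : Set Ω}
    (hB : MeasurableSet[past w t] B) {n : ℕ} (hn : 1 ≤ n) :
    ∫ ω in B, ‖∑ i ∈ Finset.Ico 1 n,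
      a i • (g (t + i) ω - gradient (objective D F) (w (t + i) ω))‖ ^ 2 ∂P
      ≤ (∑ i ∈ Finset.Ico 1 n, a i ^ 2) * σ ^ 2 * P.real B := by
  induction n, hn using Nat.le_induction with
  | base => simp
  | succ n hn ih =>
    obtain ⟨hSm, hSb⟩ := R.noise_sum_aux a t hn
    set S : Ω → Vec d := fun ω => ∑ i ∈ Finset.Ico 1 n,
      a i • (g (t + i) ω - gradient (objective D F) (w (t + i) ω)) with hS
    set N : Ω → Vec d := fun ω => g (t + n) ω - gradient (objective D F) (w (t + n) ω) with hN
    have hB' : MeasurableSet[samplePast ξ (t + n)] B :=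
      samplePast_mono ξ (Nat.le_add_right t n) _ (R.past_le_samplePast t _ hB)
    -- The partial sum uses only samples before time `t + n`, so the fresh noise is orthogonal to
    -- it.
    have h0 : ∫ ω in B, inner ℝ (S ω) (N ω) ∂P = 0 :=
      R.setIntegral_inner_noise hB' hSm hSb.2
    have hNb : BddRV P N := R.bddRV_noise (t + n)
    have i1 : Integrable (fun ω => ‖S ω‖ ^ 2) P :=
      (hSb.comp (φ := fun x : Vec d => ‖x‖ ^ 2) (by fun_prop)).integrable
    have i2 : Integrable (fun ω => (inner ℝ (S ω) (N ω) : ℝ)) P :=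
      ((hSb.prodMk hNb).comp
        (φ := fun p : Vec d × Vec d => (inner ℝ p.1 p.2 : ℝ)) (by fun_prop)).integrable
    have i3 : Integrable (fun ω => ‖N ω‖ ^ 2) P :=
      (hNb.comp (φ := fun x : Vec d => ‖x‖ ^ 2) (by fun_prop)).integrable
    have e := (setIntegral_linear_combination i1 i2 i3 1 (2 * a n) (a n ^ 2) 0 B).2
    have h1 : ∫ ω in B, ‖∑ i ∈ Finset.Ico 1 (n + 1),
        a i • (g (t + i) ω - gradient (objective D F) (w (t + i) ω))‖ ^ 2 ∂P
        = ∫ ω in B, (1 * ‖S ω‖ ^ 2 + 2 * a n * inner ℝ (S ω) (N ω) + a n ^ 2 * ‖N ω‖ ^ 2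
          + 0) ∂P := by
      congr 1
      funext ω
      rw [Finset.sum_Ico_succ_top hn]
      change ‖S ω + a n • N ω‖ ^ 2 = _
      rw [norm_add_sq_real, real_inner_smul_right, norm_smul, mul_pow, Real.norm_eq_abs, sq_abs]
      ring
    have h2 : ∫ ω in B, ‖N ω‖ ^ 2 ∂P ≤ σ ^ 2 * P.real B := by
      have : ∫ _ in B, σ ^ 2 ∂P = σ ^ 2 * P.real B := by
        rw [setIntegral_const, smul_eq_mul, mul_comm]
      rw [← this]
      exact setIntegral_mono_ae i3.integrableOn (integrable_const _).integrableOn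
        (R.noise_sq_le (t + n))
    have h3 := mul_le_mul_of_nonneg_left h2 (sq_nonneg (a n))
    rw [h1, e, h0, Finset.sum_Ico_succ_top hn]
    linarith

theorem bddRV_displacement (t s : ℕ) : BddRV P fun ω => w (t + s) ω - w t ω :=
  ((R.bddRV_iterate (t + s)).prodMk (R.bddRV_iterate t)).comp
    (φ := fun p : Vec d × Vec d => p.1 - p.2) (by fun_prop)

theorem integrable_normSq_displacement (t s : ℕ) :
    Integrable (fun ω => ‖w (t + s) ω - w t ω‖ ^ 2) P :=
  ((R.bddRV_displacement t s).comp (φ := fun x : Vec d => ‖x‖ ^ 2) (by fun_prop)).integrable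

theorem displacement_one {t : ℕ} (ht : τ ∣ t) (ω : Ω) :
    w (t + 1) ω - w t ω = -(r • m t ω) := by
  rw [R.run.update, stepSize_of_dvd r η ht]
  abel

theorem displacement_step {t : ℕ} (ht : τ ∣ t) (ω : Ω) (s : ℕ) (hs : 1 ≤ s) (hsτ : s < τ) :
    w (t + (s + 1)) ω - w t ω = w (t + s) ω - w t ω - η • m (t + s) ω := by
  rw [← add_assoc, R.run.update, stepSize_add r η ht hs hsτ]
  abel

/-- The mean-square displacement within a period grows at most linearly. -/
theorem setIntegral_normSq_displacement_le {t : ℕ} {B : Set Ω} (hB : MeasurableSet[past w t] B)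
    (ht : τ ∣ t) {s : ℕ} (hs : 1 ≤ s) (hsτ : s ≤ τ) :
    ∫ ω in B, ‖w (t + s) ω - w t ω‖ ^ 2 ∂P
      ≤ (4 * (r ^ 2 * c_m ^ 2 + η ^ 2 * c_m ^ 2 / (1 - β) ^ 2)
          + 4 * η ^ 2 * σ ^ 2 / (1 - β) ^ 2 * s) * P.real B
        + 4 * η ^ 2 / (1 - β) ^ 2 * s
          * ∑ i ∈ Finset.Ico 1 τ, ∫ ω in B, ‖gradient (objective D F) (w (t + i) ω)‖ ^ 2 ∂P := by
  have hβ := R.beta_nonneg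
  have hβ1 : 0 < 1 - β := by linarith [R.beta_lt_one]
  have hr := R.large_step_pos
  have hη := R.step_pos
  have hθ : ∀ i, |geomWeight β (s - i)| ≤ 1 / (1 - β) := fun i => by
    rw [abs_of_nonneg (geomWeight_nonneg hβ _)]
    exact geomWeight_le hβ R.beta_lt_one _
  obtain ⟨-, hNb⟩ := R.noise_sum_aux (fun i => geomWeight β (s - i)) t hs
  have hNle := R.setIntegral_normSq_noise_sum_le (fun i => geomWeight β (s - i)) hB hs
  set N : Ω → Vec d := fun ω => ∑ i ∈ Finset.Ico 1 s, geomWeight β (s - i) •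
    (g (t + i) ω - gradient (objective D F) (w (t + i) ω)) with hN
  have hNi : Integrable (fun ω => ‖N ω‖ ^ 2) P :=
    (hNb.comp (φ := fun x : Vec d => ‖x‖ ^ 2) (by fun_prop)).integrable
  set S : Ω → ℝ := fun ω =>
    ∑ i ∈ Finset.Ico 1 s, ‖gradient (objective D F) (w (t + i) ω)‖ ^ 2 with hS
  have hSi : Integrable S P := integrable_finsetSum _ fun i _ =>
    R.integrable_normSq_gradient (t + i)
  -- The displacement splits into large step, inherited momentum, gradients and noise.
  -- Cauchy–Schwarz costs a factor `s` on the gradient sum, while orthogonality keeps the noise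
  -- linear in `s`. The third slot is a dummy with coefficient 0.
  obtain ⟨hi, he⟩ := setIntegral_linear_combination hSi hNi hNi
    (4 * (η ^ 2 * (s * (1 / (1 - β)) ^ 2))) (4 * η ^ 2) 0
    (4 * (r ^ 2 * c_m ^ 2 + η ^ 2 * c_m ^ 2 / (1 - β) ^ 2)) B
  have key : ∫ ω in B, ‖w (t + s) ω - w t ω‖ ^ 2 ∂P ≤ _ :=
    setIntegral_mono_ae (R.integrable_normSq_displacement t s).integrableOn hi.integrableOn (by
      filter_upwards [R.momentum_le t] with ω hm
      have h1 := displacement_eq_sum (u := fun s => w (t + s) ω - w t ω)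
        (m := fun s => m (t + s) ω) (y := fun s => g (t + s) ω)
        (R.displacement_one ht ω) (R.displacement_step ht ω)
        (fun s => R.run.momentum_succ (t + s) ω) hs hsτ
      have h2 : ∑ i ∈ Finset.Ico 1 s, geomWeight β (s - i) • g (t + i) ω
          = ∑ i ∈ Finset.Ico 1 s, geomWeight β (s - i) • gradient (objective D F) (w (t + i) ω)
            + N ω := by
        rw [hN, ← Finset.sum_add_distrib]
        refine Finset.sum_congr rfl fun i _ => ?_
        rw [← smul_add, add_sub_cancel]
      have h3 := normSq_sum_smul_le (fun i => geomWeight β (s - i))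
        (fun i => gradient (objective D F) (w (t + i) ω)) (Finset.Ico 1 s) fun i _ => hθ i
      have h4 : ((Finset.Ico 1 s).card : ℝ) ≤ s := by
        rw [Nat.card_Ico]
        exact_mod_cast Nat.sub_le s 1
      have h5 : |∑ j ∈ Finset.Ico 1 s, β ^ j| ≤ 1 / (1 - β) := by
        rw [abs_of_nonneg (Finset.sum_nonneg fun j _ => pow_nonneg hβ j)]
        refine le_trans ?_ (geomWeight_le hβ R.beta_lt_one s)
        rw [geomWeight_eq_sum_range, Finset.range_eq_Ico]
        exact Finset.sum_le_sum_of_subset_of_nonneg (Finset.Ico_subset_Ico_left zero_le_one)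
          fun j _ _ => pow_nonneg hβ j
      simp only [add_zero] at h1
      rw [h1, h2, smul_add]
      refine (normSq_sub_sub_sub_le _ _ _ _).trans ?_
      rw [norm_neg]
      simp only [norm_smul, mul_pow, Real.norm_eq_abs, sq_abs]
      have h6 : r ^ 2 * ‖m t ω‖ ^ 2 ≤ r ^ 2 * c_m ^ 2 := by gcongr
      have h7 : η ^ 2 * ((∑ j ∈ Finset.Ico 1 s, β ^ j) ^ 2 * ‖m t ω‖ ^ 2)
          ≤ η ^ 2 * c_m ^ 2 / (1 - β) ^ 2 := by
        rw [← sq_abs (∑ j ∈ Finset.Ico 1 s, β ^ j)]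
        calc _ ≤ η ^ 2 * ((1 / (1 - β)) ^ 2 * c_m ^ 2) := by gcongr
          _ = _ := by field_simp
      have h8 : η ^ 2 * ‖∑ i ∈ Finset.Ico 1 s,
          geomWeight β (s - i) • gradient (objective D F) (w (t + i) ω)‖ ^ 2
          ≤ η ^ 2 * (s * (1 / (1 - β)) ^ 2 * S ω) := by
        have : 0 ≤ S ω := Finset.sum_nonneg fun _ _ => by positivity
        refine mul_le_mul_of_nonneg_left (h3.trans ?_) (sq_nonneg η)
        gcongr
      linarith)
  rw [he] at key
  refine key.trans ?_
  have h1 : ∫ ω in B, S ω ∂P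
      ≤ ∑ i ∈ Finset.Ico 1 τ, ∫ ω in B, ‖gradient (objective D F) (w (t + i) ω)‖ ^ 2 ∂P := by
    rw [hS, integral_finsetSum _ fun i _ => (R.integrable_normSq_gradient (t + i)).integrableOn]
    exact Finset.sum_le_sum_of_subset_of_nonneg (Finset.Ico_subset_Ico_right hsτ)
      fun _ _ _ => integral_nonneg fun _ => by positivity
  have h2 : ∑ i ∈ Finset.Ico 1 s, geomWeight β (s - i) ^ 2 ≤ s * (1 / (1 - β)) ^ 2 := by
    calc _ ≤ ∑ i ∈ Finset.Ico 1 s, (1 / (1 - β)) ^ 2 := by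
          refine Finset.sum_le_sum fun i _ => ?_
          rw [← sq_abs]
          have := hθ i
          gcongr
      _ = ((s - 1 : ℕ) : ℝ) * (1 / (1 - β)) ^ 2 := by simp
      _ ≤ _ := by
          have : ((s - 1 : ℕ) : ℝ) ≤ s := by exact_mod_cast Nat.sub_le s 1
          gcongr
  have hP : 0 ≤ P.real B := measureReal_nonneg
  have h3 : ∫ ω in B, ‖N ω‖ ^ 2 ∂P ≤ s * (1 / (1 - β)) ^ 2 * σ ^ 2 * P.real B :=
    hNle.trans (by gcongr)
  have h4 : 4 * (η ^ 2 * (s * (1 / (1 - β)) ^ 2)) * ∫ ω in B, S ω ∂P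
      ≤ 4 * (η ^ 2 * (s * (1 / (1 - β)) ^ 2)) * ∑ i ∈ Finset.Ico 1 τ,
        ∫ ω in B, ‖gradient (objective D F) (w (t + i) ω)‖ ^ 2 ∂P := by gcongr
  have h5 := mul_le_mul_of_nonneg_left h3 (by positivity : 0 ≤ 4 * η ^ 2)
  refine (by linarith : _ ≤ 4 * (η ^ 2 * (s * (1 / (1 - β)) ^ 2)) * ∑ i ∈ Finset.Ico 1 τ,
        ∫ ω in B, ‖gradient (objective D F) (w (t + i) ω)‖ ^ 2 ∂P
      + 4 * η ^ 2 * (s * (1 / (1 - β)) ^ 2 * σ ^ 2 * P.real B)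
      + 4 * (r ^ 2 * c_m ^ 2 + η ^ 2 * c_m ^ 2 / (1 - β) ^ 2) * P.real B).trans (le_of_eq ?_)
  field_simp
  ring

end MomentumRun

end Displacement

/-! ### Exponential growth in mean square near a strict saddle -/

section SaddleEscape

/-- Linearity of the integral alone, in the shape of the weighted pathwise growth inequality. -/
theorem integral_growth_inequality {Ω : Type*} [MeasurableSpace Ω] {P : Measure Ω}
    {X V Y : Ω → ℝ} {J Z : ℕ → Ω → ℝ} {N : ℕ → ℕ → Ω → ℝ} (hX : Integrable X P)
    (hV : Integrable V P) (hY : Integrable Y P) (hJ : ∀ s, Integrable (J s) P)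
    (hZ : ∀ s, Integrable (Z s) P) (hN : ∀ s i, 1 ≤ i → Integrable (N s i) P)
    (c₁ c₂ c₃ c₄ c₅ η : ℝ) (θ a : ℕ → ℝ) (b : ℕ → ℕ → ℝ) (τ : ℕ)
    (h : ∀ᵐ ω ∂P, c₁ * X ω + c₂ * ∑ s ∈ Finset.Ico 1 τ, η * (θ s * J s ω
        + ∑ i ∈ Finset.Icc 1 s, b s i * N s i ω)
      - c₃ * ∑ s ∈ Finset.Ico 1 τ, η * (a s * (c₄ * Y ω
        + c₅ * ∑ i ∈ Finset.Icc 1 s, b s i * Z i ω)) ≤ V ω) :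
    c₁ * ∫ ω, X ω ∂P + c₂ * ∑ s ∈ Finset.Ico 1 τ, η * (θ s * ∫ ω, J s ω ∂P
        + ∑ i ∈ Finset.Icc 1 s, b s i * ∫ ω, N s i ω ∂P)
      - c₃ * ∑ s ∈ Finset.Ico 1 τ, η * (a s * (c₄ * ∫ ω, Y ω ∂P
        + c₅ * ∑ i ∈ Finset.Icc 1 s, b s i * ∫ ω, Z i ω ∂P)) ≤ ∫ ω, V ω ∂P := by
  have n1 : ∀ s, ∀ i ∈ Finset.Icc 1 s, Integrable (fun ω => b s i * N s i ω) P :=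
    fun s i hi => (hN s i (Finset.mem_Icc.1 hi).1).const_mul _
  have n2 : ∀ s, Integrable (fun ω => ∑ i ∈ Finset.Icc 1 s, b s i * N s i ω) P :=
    fun s => integrable_finsetSum _ (n1 s)
  have n3 : ∀ s, Integrable (fun ω => θ s * J s ω) P := fun s => (hJ s).const_mul _
  have n4 : ∀ s, Integrable (fun ω => η * (θ s * J s ω
      + ∑ i ∈ Finset.Icc 1 s, b s i * N s i ω)) P := fun s => ((n3 s).add (n2 s)).const_mul _
  have n5 : Integrable (fun ω => c₂ * ∑ s ∈ Finset.Ico 1 τ, η * (θ s * J s ω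
      + ∑ i ∈ Finset.Icc 1 s, b s i * N s i ω)) P :=
    (integrable_finsetSum _ fun s _ => n4 s).const_mul _
  have n6 : Integrable (fun ω => c₁ * X ω) P := hX.const_mul _
  have z1 : ∀ s, ∀ i ∈ Finset.Icc 1 s, Integrable (fun ω => b s i * Z i ω) P :=
    fun s i _ => (hZ i).const_mul _
  have z2 : ∀ s, Integrable (fun ω => c₅ * ∑ i ∈ Finset.Icc 1 s, b s i * Z i ω) P :=
    fun s => (integrable_finsetSum _ (z1 s)).const_mul _
  have z3 : Integrable (fun ω => c₄ * Y ω) P := hY.const_mul _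
  have z4 : ∀ s, Integrable (fun ω => η * (a s * (c₄ * Y ω
      + c₅ * ∑ i ∈ Finset.Icc 1 s, b s i * Z i ω))) P :=
    fun s => ((z3.add (z2 s)).const_mul _).const_mul _
  have z5 : Integrable (fun ω => c₃ * ∑ s ∈ Finset.Ico 1 τ, η * (a s * (c₄ * Y ω
      + c₅ * ∑ i ∈ Finset.Icc 1 s, b s i * Z i ω))) P :=
    (integrable_finsetSum _ fun s _ => z4 s).const_mul _
  have n7 : Integrable (fun ω => c₁ * X ω + c₂ * ∑ s ∈ Finset.Ico 1 τ, η * (θ s * J s ω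
      + ∑ i ∈ Finset.Icc 1 s, b s i * N s i ω)) P := n6.add n5
  have key := integral_mono_ae (n7.sub z5) hV h
  simp only [Pi.sub_apply] at key
  rw [integral_sub n7 z5, integral_add n6 n5, integral_const_mul, integral_const_mul,
    integral_const_mul, integral_finsetSum _ fun s _ => n4 s,
    integral_finsetSum _ fun s _ => z4 s] at key
  have e1 : ∀ s ∈ Finset.Ico 1 τ, ∫ ω, η * (θ s * J s ω
      + ∑ i ∈ Finset.Icc 1 s, b s i * N s i ω) ∂P = η * (θ s * ∫ ω, J s ω ∂P
        + ∑ i ∈ Finset.Icc 1 s, b s i * ∫ ω, N s i ω ∂P) := fun s _ => by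
    rw [integral_const_mul, integral_add (n3 s) (n2 s), integral_const_mul,
      integral_finsetSum _ (n1 s)]
    simp only [integral_const_mul]
  have e2 : ∀ s ∈ Finset.Ico 1 τ, ∫ ω, η * (a s * (c₄ * Y ω
      + c₅ * ∑ i ∈ Finset.Icc 1 s, b s i * Z i ω)) ∂P = η * (a s * (c₄ * ∫ ω, Y ω ∂P
        + c₅ * ∑ i ∈ Finset.Icc 1 s, b s i * ∫ ω, Z i ω ∂P)) := fun s _ => by
    rw [integral_const_mul, integral_const_mul, integral_add z3 (z2 s), integral_const_mul,
      integral_const_mul, integral_finsetSum _ (z1 s)]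
    simp only [integral_const_mul]
  rwa [Finset.sum_congr rfl e1, Finset.sum_congr rfl e2] at key

/-- Makes `1/‖Q‖²` at most the square of a deterministic decay factor. -/
theorem one_le_decay_mul_norm_gProd {d : ℕ} {H : Vec d →L[ℝ] Vec d}
    (hH : ∀ x y, inner ℝ (H x) y = inner ℝ x (H y)) {η β ε : ℝ}
    (hη : 0 ≤ η) (hβ : 0 ≤ β) (hε : 0 ≤ ε) (hG : ∀ s, η * geomWeight β s * ‖H‖ ≤ 1) {μ : ℝ}
    (hμ : μ ∈ eigenvalues H) (hμε : μ ≤ -ε) {e : ℕ} (he : 1 ≤ e) :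
    1 ≤ decay η β ε (e - 1) * ‖gProd η β H 1 e‖ := by
  obtain ⟨ν, hν, hνμ⟩ := exists_isLeast_eigenvalues hH hμ
  rw [exists_norm_gProd_eq hH hη hβ hG hν, decay, Nat.sub_add_cancel he, inv_mul_eq_div,
    one_le_div (Finset.prod_pos fun j _ => one_add_weight_pos hη hβ hε j)]
  refine Finset.prod_le_prod (fun j _ => (one_add_weight_pos hη hβ hε j).le) fun j _ => ?_
  have := mul_le_mul_of_nonneg_left (hνμ.trans hμε) (mul_nonneg hη (geomWeight_nonneg hβ j))
  linarith

theorem continuous_gProd {d : ℕ} (η β : ℝ) (a b : ℕ) :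
    Continuous fun H : Vec d →L[ℝ] Vec d => gProd η β H a b := by
  unfold gProd
  refine continuous_list_prod _ fun s _ => ?_
  simp only [gOp_eq]
  fun_prop

theorem continuous_mOp {d : ℕ} (η β : ℝ) (τ k : ℕ) :
    Continuous fun H : Vec d →L[ℝ] Vec d => mOp η β τ k H :=
  (continuous_gProd η β 1 τ).mul (continuous_gProd η β k τ)

variable {d : ℕ} {Ξ Ω : Type*} [MeasurableSpace Ξ] [MeasurableSpace Ω]
  {D : Measure Ξ} {P : Measure Ω} [IsProbabilityMeasure D] [IsProbabilityMeasure P]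
  {F : Vec d → Ξ → ℝ} {ξ : ℕ → Ω → Ξ}
  {w₀ : Vec d} {L ρ σ c_m c' β r η ε γ U₀ U₁ : ℝ} {τ : ℕ} {w g m : ℕ → Ω → Vec d}

namespace MomentumRun

variable (R : MomentumRun D P F ξ w₀ L ρ σ c_m β r η τ w g m)
include R

theorem integral_mul_condE {t : ℕ} {W X : Ω → ℝ} {C : ℝ} (hW : Measurable[past w t] W)
    (hWC : ∀ ω, |W ω| ≤ C) (hX : Integrable X P) :
    ∫ ω, W ω * condE P w t X ω ∂P = ∫ ω, W ω * X ω ∂P := by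
  have h := condExp_stronglyMeasurable_mul_of_bound (μ := P) (R.past_le t)
    hW.stronglyMeasurable hX C (Filter.Eventually.of_forall hWC)
  rw [← integral_condExp (R.past_le t) (f := fun ω => W ω * X ω)]
  exact (integral_congr_ae h).symm

theorem step_mul_geomWeight_le (hηL : η ≤ (1 - β) / L) (hL : 0 < L) (u : Vec d) (s : ℕ) :
    η * geomWeight β s * ‖hess (objective D F) u‖ ≤ 1 := by
  have h1 : 0 < 1 - β := by linarith [R.beta_lt_one]
  have h2 := geomWeight_le R.beta_nonneg R.beta_lt_one s
  have h3 := geomWeight_nonneg R.beta_nonneg s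
  have h4 := R.norm_hess_le u
  have h5 := R.step_pos
  rw [le_div_iff₀ hL] at hηL
  calc _ ≤ η * (1 / (1 - β)) * L := by gcongr
    _ = η * L / (1 - β) := by ring
    _ ≤ 1 := (div_le_one h1).2 hηL

theorem inner_hess_comm (u x y : Vec d) :
    inner ℝ (hess (objective D F) u x) y = inner ℝ x (hess (objective D F) u y) :=
  _root_.inner_hess_comm R.smooth.contDiff u x y

/-- The weight `1_B / ‖∏_{s=1}^{τ-1} G_s‖²`. -/
def _root_.invNormSqWeight (f : Vec d → ℝ) (η β : ℝ) (τ : ℕ) (X : Ω → Vec d) (B : Set Ω) :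
    Ω → ℝ :=
  B.indicator fun ω => (‖gProd η β (hess f (X ω)) 1 τ‖ ^ 2)⁻¹

theorem measurable_invNormSqWeight {t : ℕ} {B : Set Ω} (hB : MeasurableSet[past w t] B) :
    Measurable[past w t] (invNormSqWeight (objective D F) η β τ (w t) B) := by
  refine Measurable.indicator ?_ hB
  have h : Continuous fun u => ‖gProd η β (hess (objective D F) u) 1 τ‖ ^ 2 :=
    (((continuous_gProd η β 1 τ).comp R.continuous_hess).norm).pow 2
  exact (h.measurable.comp (R.measurable_past t)).inv

theorem continuous_mOp_hess (k : ℕ) : Continuous fun p : Vec d × Vec d =>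
    mOp η β τ k (hess (objective D F) p.1) p.2 :=
  (((continuous_mOp η β τ k).comp R.continuous_hess).comp continuous_fst).clm_apply continuous_snd

theorem bddRV_mOp_momentum (k t : ℕ) :
    BddRV P fun ω => mOp η β τ k (hess (objective D F) (w t ω)) (m t ω) :=
  ((R.bddRV_iterate t).prodMk (R.bddRV_momentum t)).comp (R.continuous_mOp_hess k)

theorem measurable_comp_iterate_momentum (t : ℕ) {φ : Vec d × Vec d → Vec d}
    (hφ : Continuous φ) : Measurable[samplePast ξ (t + 1)] fun ω => φ (w t ω, m t ω) := by
  have h1 : Measurable[samplePast ξ (t + 1)] (w t) :=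
    (R.measurable_iterate t).mono (samplePast_mono ξ t.le_succ) le_rfl
  have h2 : Measurable[samplePast ξ (t + 1)] fun ω => (w t ω, m t ω) :=
    h1.prodMk (R.measurable_momentum t)
  exact hφ.measurable.comp h2

theorem measurable_mOp_momentum (k t : ℕ) : Measurable[samplePast ξ (t + 1)]
    fun ω => mOp η β τ k (hess (objective D F) (w t ω)) (m t ω) :=
  R.measurable_comp_iterate_momentum t (R.continuous_mOp_hess k)

/-- The momentum `m_t` contains `ξ_t`, so `Y` may use that sample. With `i ≥ 1`, the noise comes
from a strictly later sample and still averages to zero. -/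
theorem integral_weight_noise {t : ℕ} {W : Ω → ℝ} (hW : Measurable[past w t] W)
    (hWb : BddRV P W) {Y : Ω → Vec d} (hY : Measurable[samplePast ξ (t + 1)] Y)
    (hYb : BddRV P Y) {i : ℕ} (hi : 1 ≤ i) :
    Integrable (fun ω => W ω *
        inner ℝ (g (t + i) ω - gradient (objective D F) (w (t + i) ω)) (Y ω)) P ∧
      ∫ ω, W ω *
        inner ℝ (g (t + i) ω - gradient (objective D F) (w (t + i) ω)) (Y ω) ∂P = 0 := by
  have h2 : Measurable[samplePast ξ (t + i)] Y := hY.mono (samplePast_mono ξ (by omega)) le_rfl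
  have h3 : Measurable[samplePast ξ (t + i)] W :=
    hW.mono ((R.past_le_samplePast t).trans (samplePast_mono ξ (by omega))) le_rfl
  have h4 : BddRV P fun ω => W ω • Y ω :=
    (hWb.prodMk hYb).comp (φ := fun p : ℝ × Vec d => p.1 • p.2) (by fun_prop)
  have e : (fun ω => W ω *
        inner ℝ (g (t + i) ω - gradient (objective D F) (w (t + i) ω)) (Y ω))
      = fun ω => inner ℝ (W ω • Y ω) (g (t + i) ω - gradient (objective D F) (w (t + i) ω)) := by
    funext ω
    rw [real_inner_smul_left, real_inner_comm]
  rw [e]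
  refine ⟨((h4.prodMk (R.bddRV_noise (t + i))).comp
    (φ := fun p : Vec d × Vec d => (inner ℝ p.1 p.2 : ℝ)) (by fun_prop)).integrable, ?_⟩
  exact R.integral_inner_noise (h3.smul h2) h4.2

set_option maxHeartbeats 1000000 in
/-- The mean-square growth over a period that starts near a strict saddle point. -/
theorem saddle_growth {t : ℕ} {B : Set Ω} (hB : MeasurableSet[past w t] B) (ht : τ ∣ t)
    (hτ : 2 ≤ τ) (hε : 0 < ε) (hγ : 0 < γ) (hc' : 0 ≤ c') (hL : 0 < L)
    (hηL : η ≤ (1 - β) / L) (hηε : η * ε ≤ 1)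
    (hBg : ∀ ω ∈ B, ‖gradient (objective D F) (w t ω)‖ ≤ ε)
    (hBh : ∀ ω ∈ B, ¬ ∀ x : Vec d, -ε * ‖x‖ ^ 2 ≤ inner ℝ x (hess (objective D F) (w t ω) x))
    (hCNC : CNC P (objective D F) ε γ w m) (hAPCG : APCG P (objective D F) ε η β τ c' w m)
    (hU₀ : 0 ≤ U₀) (hU₁ : 0 ≤ U₁)
    (hU : ∀ i, 1 ≤ i → i ≤ τ →
      ∫ ω in B, ‖w (t + i) ω - w t ω‖ ^ 2 ∂P ≤ (U₀ + U₁ * i) * P.real B) :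
    (r ^ 2 * γ - 2 * r * (c' * η * ε) - 2 * r * (ε * c_m * (η / (1 - β)))
      - 2 * r * c_m * (L * η * c_m / (1 - β) ^ 2 / ε
        + ρ * (U₀ / ε + U₁ * (2 / (η * ε ^ 2))))) * P.real B
      ≤ decay η β ε (τ - 1) ^ 2 * (U₀ + U₁ * τ) * P.real B := by
  have hη := R.step_pos
  have hr := R.large_step_pos
  have hβ := R.beta_nonneg
  have hβ1 : 0 < 1 - β := by linarith [R.beta_lt_one]
  have hρ := R.lipschitz_hess_nonneg
  have hcm := R.momentum_nonneg
  have hBm := R.measurableSet_of_past hB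
  have hP : 0 ≤ P.real B := measureReal_nonneg
  rcases hP.eq_or_lt with hP0 | hPpos
  · rw [← hP0]; simp
  have hd : ∀ s, 0 ≤ decay η β ε s := fun s => (decay_pos hη.le hβ hε.le s).le
  have hG := R.step_mul_geomWeight_le hηL hL
  have hch := R.continuous_hess
  -- The norm of `Q` is random through `w_t`. Weighting by its inverse square makes all later bounds
  -- deterministic, and `W` can be pulled through `𝔼_t`.
  set W := invNormSqWeight (objective D F) η β τ (w t) B with hWdef
  have hWm : Measurable[past w t] W := R.measurable_invNormSqWeight hB
  have hμ : ∀ ω ∈ B, ∃ μ ∈ eigenvalues (hess (objective D F) (w t ω)), μ < -ε :=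
    fun ω hω => exists_eigenvalue_lt (R.inner_hess_comm (w t ω)) (hBh ω hω)
  have hQ : ∀ ω ∈ B, 1 ≤ decay η β ε (τ - 1) * ‖gProd η β (hess (objective D F) (w t ω)) 1 τ‖ := by
    intro ω hω
    obtain ⟨μ, h1, h2⟩ := hμ ω hω
    exact one_le_decay_mul_norm_gProd (R.inner_hess_comm _) hη.le hβ hε.le (hG _) h1 h2.le
      (by omega)
  have hQpos : ∀ ω ∈ B, 0 < ‖gProd η β (hess (objective D F) (w t ω)) 1 τ‖ := fun ω hω =>
    pos_of_mul_pos_right (one_pos.trans_le (hQ ω hω)) (hd _)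
  have hWin : ∀ ω ∈ B, W ω = (‖gProd η β (hess (objective D F) (w t ω)) 1 τ‖ ^ 2)⁻¹ :=
    fun ω hω => Set.indicator_of_mem hω _
  have hWout : ∀ ω, ω ∉ B → W ω = 0 := fun ω hω => Set.indicator_of_notMem hω _
  have hWQ : ∀ ω ∈ B, W ω * ‖gProd η β (hess (objective D F) (w t ω)) 1 τ‖ ^ 2 = 1 := by
    intro ω hω
    rw [hWin ω hω]
    exact inv_mul_cancel₀ (pow_pos (hQpos ω hω) 2).ne'
  have hW0 : ∀ ω, 0 ≤ W ω := by
    intro ω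
    by_cases hω : ω ∈ B
    · rw [hWin ω hω]; positivity
    · rw [hWout ω hω]
  have hWd : ∀ ω, W ω ≤ decay η β ε (τ - 1) ^ 2 := by
    intro ω
    by_cases hω : ω ∈ B
    · have h1 := hQ ω hω
      have h2 := hWQ ω hω
      have h3 : 1 ≤ decay η β ε (τ - 1) ^ 2
          * ‖gProd η β (hess (objective D F) (w t ω)) 1 τ‖ ^ 2 := by
        rw [← mul_pow]
        exact one_le_pow₀ h1
      rw [← h2] at h3
      exact le_of_mul_le_mul_right h3 (pow_pos (hQpos ω hω) 2)
    · rw [hWout ω hω]; positivity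
  have hWabs : ∀ ω, |W ω| ≤ decay η β ε (τ - 1) ^ 2 := fun ω => by
    rw [abs_of_nonneg (hW0 ω)]; exact hWd ω
  have hWb : BddRV P W := ⟨hWm.mono (R.past_le t) le_rfl, _,
    Filter.Eventually.of_forall hWabs⟩
  have hind1 : ∫ ω, B.indicator (fun _ => (1 : ℝ)) ω ∂P = P.real B := by
    rw [integral_indicator hBm, setIntegral_const, smul_eq_mul, mul_one]
  -- the alignment terms
  set J : ℕ → Ω → ℝ := fun s ω => W ω * inner ℝ (gradient (objective D F) (w t ω))
    (mOp η β τ (s + 1) (hess (objective D F) (w t ω)) (m t ω)) with hJ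
  have hJ' : ∀ s, Integrable (fun ω => (inner ℝ (gradient (objective D F) (w t ω))
      (mOp η β τ (s + 1) (hess (objective D F) (w t ω)) (m t ω)) : ℝ)) P ∧
      Integrable (J s) P := by
    intro s
    have h1 : BddRV P (fun ω => (inner ℝ (gradient (objective D F) (w t ω))
        (mOp η β τ (s + 1) (hess (objective D F) (w t ω)) (m t ω)) : ℝ)) :=
      ((R.bddRV_gradient t).prodMk (R.bddRV_mOp_momentum (s + 1) t)).comp
        (φ := fun p : Vec d × Vec d => (inner ℝ p.1 p.2 : ℝ)) (by fun_prop)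
    exact ⟨h1.integrable, (hWb.mul h1).integrable⟩
  have hMle : ∀ s, s < τ → ∀ ω ∈ B, ‖mOp η β τ (s + 1) (hess (objective D F) (w t ω))‖
      ≤ decay η β ε s * ‖gProd η β (hess (objective D F) (w t ω)) 1 τ‖ ^ 2 := by
    intro s hs ω hω
    obtain ⟨μ, h1, h2⟩ := hμ ω hω
    have h3 := norm_gProd_le_decay_mul (R.inner_hess_comm (w t ω)) hη.le hβ hε.le (hG _) h1 h2.le
      (s := s) (e := τ) (by omega)
    calc _ ≤ ‖gProd η β (hess (objective D F) (w t ω)) 1 τ‖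
          * ‖gProd η β (hess (objective D F) (w t ω)) (s + 1) τ‖ := norm_mul_le _ _
      _ ≤ ‖gProd η β (hess (objective D F) (w t ω)) 1 τ‖ * (decay η β ε s
          * ‖gProd η β (hess (objective D F) (w t ω)) 1 τ‖) := by gcongr
      _ = _ := by ring
  have hconst : ∀ k : ℝ, ∫ ω, k * B.indicator (fun _ => (1 : ℝ)) ω ∂P = k * P.real B := fun k => by
    rw [integral_const_mul, hind1]
  have hindi : Integrable (B.indicator fun _ => (1 : ℝ)) P := (integrable_const _).indicator hBm
  -- The index `k = s + 1` is in the range of APCG exactly while `s + 1 ≤ τ - 1`; `hJ2` covers the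
  -- remaining index.
  have hJ1 : ∀ s, s + 1 < τ → -(c' * η * ε ^ 2) * decay η β ε s * P.real B ≤ ∫ ω, J s ω ∂P := by
    intro s hs
    rw [← R.integral_mul_condE hWm hWabs (hJ' s).1, ← hconst]
    refine integral_mono_ae (hindi.const_mul _)
      (integrable_condExp.bdd_mul hWb.1.aestronglyMeasurable
        (Filter.Eventually.of_forall hWabs)) ?_
    filter_upwards [hAPCG (s + 1) (by omega) (by omega) t] with ω hω
    by_cases hωB : ω ∈ B
    · obtain ⟨μ, h1, h2⟩ := hμ ω hωB
      have h3 := hω (hBg ω hωB) ⟨μ, h1, h2.le⟩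
      rw [Set.indicator_of_mem hωB, mul_one]
      refine le_trans ?_ (mul_le_mul_of_nonneg_left h3 (hW0 ω))
      have h4 := hMle s (by omega) ω hωB
      have h5 := hBg ω hωB
      have hds := hd s
      have h6 : c' * η * ‖mOp η β τ (s + 1) (hess (objective D F) (w t ω))‖
          * ‖gradient (objective D F) (w t ω)‖ ^ 2
          ≤ c' * η * (decay η β ε s
            * ‖gProd η β (hess (objective D F) (w t ω)) 1 τ‖ ^ 2) * ε ^ 2 := by
        gcongr
      have h7 := mul_le_mul_of_nonneg_left h6 (hW0 ω)
      have h8 := hWQ ω hωB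
      have h9 : W ω * (c' * η * (decay η β ε s
            * ‖gProd η β (hess (objective D F) (w t ω)) 1 τ‖ ^ 2) * ε ^ 2)
          = c' * η * ε ^ 2 * decay η β ε s := by
        linear_combination (c' * η * ε ^ 2 * decay η β ε s) * h8
      linarith
    · rw [Set.indicator_of_notMem hωB, hWout ω hωB]
      simp
  -- Here `k = τ` is outside the range of APCG, so Cauchy–Schwarz is used. A single term carrying a
  -- factor `η/(1 - β)` is affordable.
  have hJ2 : -(ε * c_m) * P.real B ≤ ∫ ω, J (τ - 1) ω ∂P := by
    rw [← hconst]
    refine integral_mono_ae (hindi.const_mul _) (hJ' (τ - 1)).2 ?_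
    filter_upwards [R.momentum_le t] with ω hω
    by_cases hωB : ω ∈ B
    · rw [Set.indicator_of_mem hωB, mul_one]
      have h1 := hMle (τ - 1) (by omega) ω hωB
      have h2 : decay η β ε (τ - 1) ≤ 1 := by
        have := antitone_nat_of_succ_le (f := decay η β ε) (fun s => by
          have := decay_succ hη.le hβ hε.le s
          have := mul_nonneg (mul_nonneg (mul_nonneg hη.le (geomWeight_nonneg hβ (s + 1)))
            (hd (s + 1))) hε.le
          linarith) (Nat.zero_le (τ - 1))
        rwa [decay_zero] at this
      have h3 : -(ε * (‖gProd η β (hess (objective D F) (w t ω)) 1 τ‖ ^ 2 * c_m))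
          ≤ inner ℝ (gradient (objective D F) (w t ω))
            (mOp η β τ (τ - 1 + 1) (hess (objective D F) (w t ω)) (m t ω)) := by
        refine (abs_le.1 ((abs_real_inner_le_norm _ _).trans ?_)).1
        refine mul_le_mul (hBg ω hωB) (ContinuousLinearMap.le_of_opNorm_le_of_le _
          (h1.trans (mul_le_of_le_one_left (by positivity) h2)) hω) (norm_nonneg _) hε.le
      have h4 := mul_le_mul_of_nonneg_left h3 (hW0 ω)
      have h5 := hWQ ω hωB
      have h6 : W ω * -(ε * (‖gProd η β (hess (objective D F) (w t ω)) 1 τ‖ ^ 2 * c_m))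
          = -(ε * c_m) := by linear_combination (-(ε * c_m)) * h5
      rw [h6] at h4
      exact h4
    · rw [Set.indicator_of_notMem hωB]
      simp [hJ, hWout ω hωB]
  -- the noise terms
  set N : ℕ → ℕ → Ω → ℝ := fun s i ω => W ω * inner ℝ
    (g (t + i) ω - gradient (objective D F) (w (t + i) ω))
    (mOp η β τ (s + 1) (hess (objective D F) (w t ω)) (m t ω)) with hN
  have hN' : ∀ s i, 1 ≤ i → Integrable (N s i) P ∧ ∫ ω, N s i ω ∂P = 0 := by
    intro s i hi
    exact R.integral_weight_noise hWm hWb (R.measurable_mOp_momentum (s + 1) t)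
      (R.bddRV_mOp_momentum (s + 1) t) hi
  -- the main term
  set X : Ω → ℝ := fun ω => W ω * ‖gProd η β (hess (objective D F) (w t ω)) 1 τ (m t ω)‖ ^ 2
    with hX
  have hXi : Integrable X P := by
    have hc := (continuous_gProd (d := d) η β 1 τ).comp hch
    have hcont : Continuous fun p : Vec d × Vec d =>
        ‖gProd η β (hess (objective D F) p.1) 1 τ p.2‖ ^ 2 :=
      ((hc.comp continuous_fst).clm_apply continuous_snd).norm.pow 2
    have hb : BddRV P fun ω => ‖gProd η β (hess (objective D F) (w t ω)) 1 τ (m t ω)‖ ^ 2 :=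
      ((R.bddRV_iterate t).prodMk (R.bddRV_momentum t)).comp hcont
    exact (hWb.mul hb).integrable
  have hX1 : γ * P.real B ≤ ∫ ω, X ω ∂P := by
    obtain ⟨v, -, hv⟩ := hCNC
    have hvt := hv t
    have hsq : Integrable (fun ω' => (inner ℝ (m t ω') (v t ω')) ^ 2) P := by
      -- `v` is controlled only at saddle points, so integrability needs an argument. A
      -- nonintegrable function has conditional expectation 0 by convention, which contradicts `γ >
      -- 0` on an event of positive probability.
      by_contra hni
      have h0 : condE P w t (fun ω' => (inner ℝ (m t ω') (v t ω')) ^ 2) = 0 :=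
        condExp_of_not_integrable hni
      have h1 : ∀ᵐ ω ∂P, ω ∉ B := by
        filter_upwards [hvt] with ω hω hωB
        have h2 := (hω (hBg ω hωB) (hμ ω hωB)).2
        rw [h0] at h2
        exact absurd h2 (not_le.2 hγ)
      have h2 : P B = 0 := by
        rw [ae_iff] at h1
        simpa using h1
      rw [measureReal_def, h2] at hPpos
      simp at hPpos
    have h1 : γ * P.real B ≤ ∫ ω in B, (inner ℝ (m t ω) (v t ω)) ^ 2 ∂P := by
      rw [← R.setIntegral_condE hsq hB]
      have : ∫ _ in B, γ ∂P = γ * P.real B := by rw [setIntegral_const, smul_eq_mul, mul_comm]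
      rw [← this]
      refine setIntegral_mono_on_ae (integrable_const _).integrableOn
        integrable_condExp.integrableOn hBm ?_
      filter_upwards [hvt] with ω hω hωB using (hω (hBg ω hωB) (hμ ω hωB)).2
    refine h1.trans ?_
    rw [← integral_indicator hBm]
    refine integral_mono_ae (hsq.indicator hBm) hXi ?_
    filter_upwards [hvt] with ω hω
    by_cases hωB : ω ∈ B
    · rw [Set.indicator_of_mem hωB]
      have h2 := norm_gProd_mul_abs_inner_le (R.inner_hess_comm (w t ω)) hη.le hβ (hG _)
        (hω (hBg ω hωB) (hμ ω hωB)).1 1 τ (m t ω)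
      have h3 := mul_le_mul_of_nonneg_left (pow_le_pow_left₀ (by positivity) h2 2) (hW0 ω)
      rw [mul_pow, sq_abs, ← mul_assoc, hWQ ω hωB, one_mul] at h3
      exact h3
    · rw [Set.indicator_of_notMem hωB]
      exact mul_nonneg (hW0 ω) (by positivity)
  -- the displacement terms
  set Z : ℕ → Ω → ℝ := fun i => B.indicator fun ω => ‖w (t + i) ω - w t ω‖ ^ 2 with hZ
  have hZi : ∀ i, Integrable (Z i) P := fun i =>
    (R.integrable_normSq_displacement t i).indicator hBm
  have hZe : ∀ i, ∫ ω, Z i ω ∂P = ∫ ω in B, ‖w (t + i) ω - w t ω‖ ^ 2 ∂P := fun i =>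
    integral_indicator hBm
  have hZle : ∀ i, 1 ≤ i → i ≤ τ → ∫ ω, Z i ω ∂P ≤ (U₀ + U₁ * i) * P.real B :=
    fun i h1 h2 => (hZe i).trans_le (hU i h1 h2)
  have hpath : ∀ᵐ ω ∂P, r ^ 2 * X ω + 2 * r * ∑ s ∈ Finset.Ico 1 τ, η * (geomWeight β s * J s ω
        + ∑ i ∈ Finset.Icc 1 s, β ^ (s - i) * N s i ω)
      - 2 * r * c_m * ∑ s ∈ Finset.Ico 1 τ, η * (decay η β ε s * (L * η * c_m / (1 - β) ^ 2
          * B.indicator (fun _ => (1 : ℝ)) ω + ρ * ∑ i ∈ Finset.Icc 1 s, β ^ (s - i) * Z i ω))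
      ≤ decay η β ε (τ - 1) ^ 2 * Z τ ω := by
    filter_upwards [ae_all_iff.2 fun s => R.momentum_le (t + s)] with ω hmω
    by_cases hωB : ω ∈ B
    · obtain ⟨μ, h1, h2⟩ := hμ ω hωB
      have h3 := normSq_displacement_ge (r := r) (τ := τ) (u := fun s => w (t + s) ω - w t ω)
        (m := fun s => m (t + s) ω) (y := fun s => g (t + s) ω) (R.inner_hess_comm (w t ω)) hη.le
        hr.le hβ R.beta_lt_one hε.le hcm (R.norm_hess_le (w t ω)) (hG _) h1 h2.le
        (R.displacement_one ht ω) (R.displacement_step ht ω)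
        (fun s => R.run.momentum_succ (t + s) ω) hmω
        (G₀ := gradient (objective D F) (w t ω))
        (n := fun i => g (t + i) ω - gradient (objective D F) (w (t + i) ω))
        (q := fun i => gradient (objective D F) (w (t + i) ω) - gradient (objective D F) (w t ω)
          - hess (objective D F) (w t ω) (w (t + i) ω - w t ω)) (fun i => by abel)
        (fun i => by
          have := norm_gradient_add_sub_le R.smooth.contDiff hρ R.smooth.lipschitz_hess (w t ω)
            (w (t + i) ω - w t ω)
          rwa [add_sub_cancel] at this) (by omega)
      have h4 := mul_le_mul_of_nonneg_left h3 (hW0 ω)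
      have h5 := hWQ ω hωB
      have h6 := mul_le_mul_of_nonneg_right (hWd ω) (sq_nonneg ‖w (t + τ) ω - w t ω‖)
      simp only [hX, hJ, hN, hZ, Set.indicator_of_mem hωB, add_zero, mul_one] at h4 ⊢
      refine le_trans (le_of_eq ?_) (h4.trans h6)
      rw [mul_sub, mul_add]
      congr 1
      · congr 1
        · ring
        · rw [mul_left_comm (W ω), Finset.mul_sum _ _ (W ω)]
          congr 1
          refine Finset.sum_congr rfl fun s _ => ?_
          rw [mul_left_comm (W ω), mul_add (W ω), Finset.mul_sum _ _ (W ω),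
            mul_left_comm (W ω)]
          congr 2
          exact Finset.sum_congr rfl fun i _ => by rw [mul_left_comm]
      · linear_combination (-(2 * r * c_m * ∑ s ∈ Finset.Ico 1 τ, η * (decay η β ε s *
          (L * η * c_m / (1 - β) ^ 2
            + ρ * ∑ i ∈ Finset.Icc 1 s, β ^ (s - i) * ‖w (t + i) ω - w t ω‖ ^ 2)))) * h5
    · simp [hX, hJ, hN, hZ, hWout ω hωB, Set.indicator_of_notMem hωB]
  have key := integral_growth_inequality hXi ((hZi τ).const_mul _) hindi (fun s => (hJ' s).2) hZi
    (fun s i hi => (hN' s i hi).1) _ _ _ _ _ _ _ _ (fun s i => β ^ (s - i)) τ hpath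
  rw [hind1, integral_const_mul] at key
  refine le_trans ?_ (key.trans (?_ : _ ≤ decay η β ε (τ - 1) ^ 2 * (U₀ + U₁ * τ) * P.real B))
  swap
  · rw [mul_assoc]
    exact mul_le_mul_of_nonneg_left (hZle τ (by omega) le_rfl) (sq_nonneg _)
  have hsumJ : -(c' * η * ε + ε * c_m * (η / (1 - β))) * P.real B
      ≤ ∑ s ∈ Finset.Ico 1 τ, η * (geomWeight β s * ∫ ω, J s ω ∂P
        + ∑ i ∈ Finset.Icc 1 s, β ^ (s - i) * ∫ ω, N s i ω ∂P) := by
    have e1 : ∑ s ∈ Finset.Ico 1 τ, η * (geomWeight β s * ∫ ω, J s ω ∂P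
        + ∑ i ∈ Finset.Icc 1 s, β ^ (s - i) * ∫ ω, N s i ω ∂P)
        = ∑ s ∈ Finset.Ico 1 τ, η * geomWeight β s * ∫ ω, J s ω ∂P := by
      refine Finset.sum_congr rfl fun s _ => ?_
      rw [Finset.sum_eq_zero, add_zero, mul_assoc]
      intro i hi
      rw [(hN' s i (Finset.mem_Icc.1 hi).1).2, mul_zero]
    rw [e1]
    obtain ⟨n, rfl⟩ := Nat.exists_eq_add_of_le' (by omega : 1 ≤ τ)
    rw [Finset.sum_Ico_succ_top (by omega)]
    rw [Nat.add_sub_cancel] at hJ2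
    have h1 : -(c' * η * ε) * P.real B
        ≤ ∑ s ∈ Finset.Ico 1 n, η * geomWeight β s * ∫ ω, J s ω ∂P := by
      have h2 : ∑ s ∈ Finset.Ico 1 n, η * geomWeight β s
          * (-(c' * η * ε ^ 2) * decay η β ε s * P.real B)
          ≤ ∑ s ∈ Finset.Ico 1 n, η * geomWeight β s * ∫ ω, J s ω ∂P := by
        refine Finset.sum_le_sum fun s hs => ?_
        exact mul_le_mul_of_nonneg_left (hJ1 s (by have := (Finset.mem_Ico.1 hs).2; omega))
          (mul_nonneg hη.le (geomWeight_nonneg hβ s))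
      refine le_trans ?_ h2
      have h3 := sum_weight_decay_le hη.le hβ hε (n := n) (by omega)
      have h4 : ∑ s ∈ Finset.Ico 1 n, η * geomWeight β s
          * (-(c' * η * ε ^ 2) * decay η β ε s * P.real B)
          = -(c' * η * ε ^ 2 * P.real B
            * ∑ s ∈ Finset.Ico 1 n, η * geomWeight β s * decay η β ε s) := by
        rw [Finset.mul_sum, ← Finset.sum_neg_distrib]
        exact Finset.sum_congr rfl fun s _ => by ring
      rw [h4]
      have h5 := mul_le_mul_of_nonneg_left h3
        (by positivity : 0 ≤ c' * η * ε ^ 2 * P.real B)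
      have h6 : c' * η * ε ^ 2 * P.real B * (1 / ε) = c' * η * ε * P.real B := by
        field_simp
      linarith
    have h7 : -(ε * c_m * (η / (1 - β))) * P.real B
        ≤ η * geomWeight β n * ∫ ω, J n ω ∂P := by
      have h8 := mul_le_mul_of_nonneg_left hJ2 (mul_nonneg hη.le (geomWeight_nonneg hβ n))
      refine le_trans ?_ h8
      have h9 : η * geomWeight β n ≤ η * (1 / (1 - β)) := by
        have := geomWeight_le hβ R.beta_lt_one n
        gcongr
      have h10 := mul_le_mul_of_nonneg_right h9 (by positivity : 0 ≤ ε * c_m * P.real B)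
      have h11 : η * (1 / (1 - β)) * (ε * c_m * P.real B)
          = ε * c_m * (η / (1 - β)) * P.real B := by ring
      linarith
    linarith
  have hsumZ : ∑ s ∈ Finset.Ico 1 τ, η * (decay η β ε s * (L * η * c_m / (1 - β) ^ 2 * P.real B
        + ρ * ∑ i ∈ Finset.Icc 1 s, β ^ (s - i) * ∫ ω, Z i ω ∂P))
      ≤ (L * η * c_m / (1 - β) ^ 2 / ε + ρ * (U₀ / ε + U₁ * (2 / (η * ε ^ 2)))) * P.real B := by
    have h1 : ∀ s ∈ Finset.Ico 1 τ, η * (decay η β ε s * (L * η * c_m / (1 - β) ^ 2 * P.real B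
        + ρ * ∑ i ∈ Finset.Icc 1 s, β ^ (s - i) * ∫ ω, Z i ω ∂P))
        ≤ (L * η * c_m / (1 - β) ^ 2 + ρ * U₀) * P.real B
            * (η * geomWeight β s * decay η β ε s)
          + ρ * U₁ * P.real B * (η * geomWeight β s * decay η β ε s * s) := by
      intro s hs
      obtain ⟨hs1, hs2⟩ := Finset.mem_Ico.1 hs
      have h2 : ∑ i ∈ Finset.Icc 1 s, β ^ (s - i) * ∫ ω, Z i ω ∂P
          ≤ geomWeight β s * ((U₀ + U₁ * s) * P.real B) := by
        rw [geomWeight, Finset.sum_mul]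
        refine Finset.sum_le_sum fun i hi => ?_
        obtain ⟨hi1, hi2⟩ := Finset.mem_Icc.1 hi
        have h3 := hZle i hi1 (by omega)
        have h4 : (i : ℝ) ≤ s := by exact_mod_cast hi2
        refine mul_le_mul_of_nonneg_left (h3.trans ?_) (pow_nonneg hβ _)
        gcongr
      -- The drift term has no geometric weight of its own; inserting one, at least 1, allows the
      -- same telescoping bound to be used.
      have h3 := one_le_geomWeight hβ hs1
      have h4 : L * η * c_m / (1 - β) ^ 2 * P.real B
          ≤ geomWeight β s * (L * η * c_m / (1 - β) ^ 2 * P.real B) :=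
        le_mul_of_one_le_left (by positivity) h3
      have h5 := hd s
      calc _ ≤ η * (decay η β ε s * (geomWeight β s * (L * η * c_m / (1 - β) ^ 2 * P.real B)
            + ρ * (geomWeight β s * ((U₀ + U₁ * s) * P.real B)))) := by gcongr
        _ = _ := by ring
    refine (Finset.sum_le_sum h1).trans ?_
    rw [Finset.sum_add_distrib, ← Finset.mul_sum, ← Finset.mul_sum]
    have h2 := sum_weight_decay_le hη.le hβ hε (n := τ) (by omega)
    have h3 := sum_weight_decay_mul_le hη hβ hε hηε (n := τ) (by omega)
    have h4 := mul_le_mul_of_nonneg_left h2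
      (by positivity : 0 ≤ (L * η * c_m / (1 - β) ^ 2 + ρ * U₀) * P.real B)
    have h5 := mul_le_mul_of_nonneg_left h3 (by positivity : 0 ≤ ρ * U₁ * P.real B)
    refine (add_le_add h4 h5).trans (le_of_eq ?_)
    ring
  have h1 := mul_le_mul_of_nonneg_left hX1 (sq_nonneg r)
  have h2 := mul_le_mul_of_nonneg_left hsumJ (by positivity : 0 ≤ 2 * r)
  have h3 := mul_le_mul_of_nonneg_left hsumZ (by positivity : 0 ≤ 2 * r * c_m)
  linarith

end MomentumRun

end SaddleEscape

/-! ### Decrease near a strict saddle, by contradiction -/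

section SaddleDescent

variable {d : ℕ} {Ξ Ω : Type*} [MeasurableSpace Ξ] [MeasurableSpace Ω]
  {D : Measure Ξ} {P : Measure Ω} [IsProbabilityMeasure D] [IsProbabilityMeasure P]
  {F : Vec d → Ξ → ℝ} {ξ : ℕ → Ω → Ξ}
  {w₀ : Vec d} {L ρ σ c_m c' c_h β r η ε γ K : ℝ} {τ : ℕ} {w g m : ℕ → Ω → Vec d}

/-- The constant part of the bound on the mean-square displacement. -/
def displacementConst (c_m β r η : ℝ) : ℝ :=
  4 * (r ^ 2 * c_m ^ 2 + η ^ 2 * c_m ^ 2 / (1 - β) ^ 2)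

/-- The slope of the bound on the mean-square displacement, when the objective decreases by at
most `K` over the period. -/
def displacementSlope (σ c_h β r η K : ℝ) : ℝ :=
  4 * (η * (K + 4 * r ^ 2 * c_h) + η ^ 2 * σ ^ 2) / (1 - β) ^ 2

/-- Decrease over a period that starts near a strict saddle point. -/
theorem MomentumRun.setIntegral_period_le_of_saddle
    (R : MomentumRun D P F ξ w₀ L ρ σ c_m β r η τ w g m)
    {t : ℕ} {B : Set Ω} (hB : MeasurableSet[past w t] B) (ht : τ ∣ t)
    (hτ : 2 ≤ τ) (hε : 0 < ε) (hγ : 0 < γ) (hc' : 0 ≤ c') (hc : 0 ≤ c_h) (hK : 0 ≤ K) (hL : 0 < L)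
    (hηL : η ≤ (1 - β) / L) (hηε : η * ε ≤ 1) (hηr : η ≤ r)
    (hητ : τ * η ^ 2 ≤ r ^ 2) (hr : r * (ρ * c_m ^ 3) ≤ c_h)
    (hBg : ∀ ω ∈ B, ‖gradient (objective D F) (w t ω)‖ ≤ ε)
    (hBh : ∀ ω ∈ B, ¬ ∀ x : Vec d, -ε * ‖x‖ ^ 2 ≤ inner ℝ x (hess (objective D F) (w t ω) x))
    (hCNC : CNC P (objective D F) ε γ w m) (hAPCG : APCG P (objective D F) ε η β τ c' w m)
    (hGr : GrACE P (objective D F) (stepSize r η τ) c_h w g m)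
    (hnum : decay η β ε (τ - 1) ^ 2
        * (displacementConst c_m β r η + displacementSlope σ c_h β r η K * τ)
      < r ^ 2 * γ - 2 * r * (c' * η * ε) - 2 * r * (ε * c_m * (η / (1 - β)))
      - 2 * r * c_m * (L * η * c_m / (1 - β) ^ 2 / ε + ρ * (displacementConst c_m β r η / ε
        + displacementSlope σ c_h β r η K * (2 / (η * ε ^ 2))))) :
    ∫ ω in B, (objective D F (w (t + τ) ω) - objective D F (w t ω)) ∂P ≤ -K * P.real B := by
  by_contra! hcon
  have hη := R.step_pos
  have hP : 0 ≤ P.real B := measureReal_nonneg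
  have h1 := R.setIntegral_period_le hB ht hGr (by omega) hηr hητ hr hc
  set S := ∑ i ∈ Finset.Ico 1 τ, ∫ ω in B, ‖gradient (objective D F) (w (t + i) ω)‖ ^ 2 ∂P with hS
  -- Insufficient decrease leaves no room for large gradients along the period. This is what makes
  -- the displacement bound linear with slope `displacementSlope`.
  have h2 : η * S ≤ (K + 4 * r ^ 2 * c_h) * P.real B := by
    have h3 : 0 ≤ r * ∫ ω in B, ‖gradient (objective D F) (w t ω)‖ ^ 2 ∂P :=
      mul_nonneg R.large_step_pos.le (integral_nonneg fun _ => by positivity)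
    linarith
  have h3 := R.saddle_growth hB ht hτ hε hγ hc' hL hηL hηε hBg hBh hCNC hAPCG
    (U₀ := displacementConst c_m β r η) (U₁ := displacementSlope σ c_h β r η K)
    (by unfold displacementConst; positivity) (by unfold displacementSlope; positivity)
    (fun s hs hsτ => by
      refine (R.setIntegral_normSq_displacement_le hB ht hs hsτ).trans ?_
      have h4 := mul_le_mul_of_nonneg_left h2
        (by positivity : 0 ≤ 4 * η / (1 - β) ^ 2 * (s : ℝ))
      rw [← hS]
      unfold displacementConst displacementSlope
      have e1 : 4 * η ^ 2 / (1 - β) ^ 2 * s * S = 4 * η / (1 - β) ^ 2 * s * (η * S) := by ring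
      rw [e1]
      refine (add_le_add le_rfl h4).trans (le_of_eq ?_)
      ring)
  rcases hP.eq_or_lt with hP0 | hP0
  · rw [← hP0, mul_zero, setIntegral_measure_zero _ ((measureReal_eq_zero_iff).1 hP0.symm)] at hcon
    exact lt_irrefl _ hcon
  · exact absurd (le_of_mul_le_mul_right h3 hP0) (not_le.2 hnum)

end SaddleDescent

/-! ### Explicit step sizes and the exponential estimate -/

section Parameters

variable {L ρ s c_m c' c_h γ δ b ε r η c_η K A x : ℝ}

theorem step_size_bound (hL : 1 ≤ L) (hρ : 1 ≤ ρ) (hs : 1 ≤ s) (hcm : 1 ≤ c_m) (hc' : 1 ≤ c')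
    (hch : 1 ≤ c_h) (hδ : 0 < δ) (hγ : 0 < γ) (hε : 0 < ε)
    (hr : r = δ * γ * ε ^ 2 * ((1 / 10000) / (c_m ^ 3 * ρ * L * s * c_h)))
    (hcη : c_η ≤ (1 / 1000000) / (c_m ^ 5 * ρ * L ^ 2 * s * c' * c_h))
    (hη : η = δ ^ 2 * γ ^ 2 * ε ^ 5 * c_η) :
    η * (c_m ^ 2 * L * c') ≤ 1 / 100 * (r * (δ * γ * ε ^ 3)) := by
  calc η * (c_m ^ 2 * L * c')
      ≤ δ ^ 2 * γ ^ 2 * ε ^ 5 * ((1 / 1000000) / (c_m ^ 5 * ρ * L ^ 2 * s * c' * c_h))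
        * (c_m ^ 2 * L * c') := by
        rw [hη]
        gcongr
    _ = _ := by
      rw [hr]
      field_simp
      norm_num

theorem large_step_eq (hL : 1 ≤ L) (hρ : 1 ≤ ρ) (hs : 1 ≤ s) (hcm : 1 ≤ c_m) (hch : 1 ≤ c_h)
    (hr : r = δ * γ * ε ^ 2 * ((1 / 10000) / (c_m ^ 3 * ρ * L * s * c_h))) :
    r * (c_m ^ 3 * ρ * L * s * c_h) = 1 / 10000 * (δ * γ * ε ^ 2) := by
  rw [hr]
  field_simp

theorem threshold_eq (hL : 1 ≤ L) (hρ : 1 ≤ ρ) (hs : 1 ≤ s) (hcm : 1 ≤ c_m) (hch : 1 ≤ c_h)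
    (hr : r = δ * γ * ε ^ 2 * ((1 / 10000) / (c_m ^ 3 * ρ * L * s * c_h)))
    (hK : K = δ * γ ^ 2 * ε ^ 4 * ((1 / 10000000) / (c_m ^ 4 * ρ ^ 2 * L * s ^ 2 * c_h))) :
    K * (c_m * ρ * s) = 1 / 1000 * (r * γ * ε ^ 2) := by
  rw [hr, hK]
  field_simp
  ring

/-- Here `x` stands for `ηετ/(1 - β)` and `a` for the decay. The factor `y = exp(-x/8)` is at most
`A⁻²⁵`. One copy of `y` absorbs the linear growth through `xy ≤ 8`, the other absorbs `c_m²/γ` and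
`1/r`, which are polynomial in `A`. The remaining power `A²² ≥ 2²²` beats the numerical constants;
this is where `A ≥ 2` is needed. -/
theorem half_lt_exp_bound (hr : 0 < r) (hγ : 0 < γ) (hA : 2 ≤ A) (hx : 200 * Real.log A ≤ x)
    {U V a : ℝ} (ha : 0 ≤ a) (hax : a ≤ Real.exp (-(x / 8)))
    (hU : U ≤ 8 * r ^ 2 * c_m ^ 2) (hV : V ≤ r * γ * x / 48) (hcA : c_m ^ 2 ≤ A ^ 3 * γ)
    (hrA : 1 / 10000 ≤ A ^ 3 * r) :
    a ^ 2 * (U + V) < r ^ 2 * γ / 2 := by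
  have hA0 : 0 < A := by linarith
  have hlog : 0 ≤ Real.log A := Real.log_nonneg (by linarith)
  have hx0 : 0 ≤ x := by linarith
  set y := Real.exp (-(x / 8)) with hy
  have hy0 : 0 < y := Real.exp_pos _
  have hy1 : y ≤ 1 := Real.exp_le_one_iff.2 (by linarith)
  have hxy : x * y ≤ 8 := by
    have h1 : x / 8 ≤ Real.exp (x / 8) := by linarith [Real.add_one_le_exp (x / 8)]
    have h2 : Real.exp (x / 8) * y = 1 := by rw [hy, ← Real.exp_add]; simp
    nlinarith
  have hyA : y * A ^ 25 ≤ 1 := by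
    have h1 : A ^ 25 = Real.exp (25 * Real.log A) := by
      rw [mul_comm, Real.exp_mul, Real.exp_log hA0]
      norm_cast
    rw [h1, hy, ← Real.exp_add]
    exact Real.exp_le_one_iff.2 (by linarith)
  have hA22 : (2 : ℝ) ^ 22 ≤ A ^ 22 := by gcongr
  have hyA3 : y * A ^ 3 * 2 ^ 22 ≤ 1 := by
    calc _ ≤ y * A ^ 3 * A ^ 22 := by gcongr
      _ = y * A ^ 25 := by ring
      _ ≤ 1 := hyA
  have h1 : a ^ 2 * (U + V) ≤ y ^ 2 * (8 * r ^ 2 * c_m ^ 2 + r * γ * x / 48) := by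
    calc _ ≤ a ^ 2 * (8 * r ^ 2 * c_m ^ 2 + r * γ * x / 48) := by gcongr
      _ ≤ _ := by gcongr
  have h2 : y ^ 2 * (8 * r ^ 2 * c_m ^ 2) ≤ 8 * r ^ 2 * γ * (y * A ^ 3) := by
    calc _ ≤ (y * 1) * (8 * r ^ 2 * (A ^ 3 * γ)) := by
          rw [pow_two]
          gcongr
      _ = _ := by ring
  have h3 : y ^ 2 * (r * γ * x / 48) ≤ 10000 / 6 * r ^ 2 * γ * (y * A ^ 3) := by
    calc _ = (x * y) * (y * r * γ / 48) := by ring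
      _ ≤ 8 * (y * r * γ / 48) := by gcongr
      _ = y * r * γ * 10000 / 6 * (1 / 10000) := by ring
      _ ≤ y * r * γ * 10000 / 6 * (A ^ 3 * r) := by gcongr
      _ = _ := by ring
  have h4 : 0 < r ^ 2 * γ := by positivity
  have h5 : y * A ^ 3 ≤ 1 / 2 ^ 22 := by
    rw [le_div_iff₀ (by positivity)]
    exact hyA3
  have h6 := mul_le_mul_of_nonneg_left h5 h4.le
  nlinarith

end Parameters

/-! ### Consequences of the parameter choices -/

section Parameters

/-- Device for discarding the constants not needed in a bound: `k` gathers the surplus factors, all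
at least 1. -/
theorem le_of_eq_mul_one_le {M N k : ℝ} (hM : 0 ≤ M) (hk : 1 ≤ k) (h : N = M * k) : M ≤ N :=
  h ▸ le_mul_of_one_le_right hM hk

/-- The inequalities between the parameters on which the analysis rests. -/
structure AdmissibleParameters (L ρ s c_m c' c_h γ δ b ε r η K A : ℝ) (τ : ℕ) : Prop where
  one_le_L : 1 ≤ L
  one_le_rho : 1 ≤ ρ
  one_le_s : 1 ≤ s
  one_le_cm : 1 ≤ c_m
  one_le_c' : 1 ≤ c'
  one_le_ch : 1 ≤ c_h
  gamma_pos : 0 < γ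
  gamma_le : γ ≤ 1
  delta_pos : 0 < δ
  delta_lt : δ < 1
  eps_pos : 0 < ε
  eps_le : ε ≤ 1
  b_pos : 0 < b
  b_le : b ≤ 1
  r_pos : 0 < r
  eta_pos : 0 < η
  K_pos : 0 < K
  eta_bound : η * (c_m ^ 2 * L * c') ≤ 1 / 100 * (r * (δ * γ * ε ^ 3))
  r_eq : r * (c_m ^ 3 * ρ * L * s * c_h) = 1 / 10000 * (δ * γ * ε ^ 2)
  K_eq : K * (c_m * ρ * s) = 1 / 1000 * (r * γ * ε ^ 2)
  two_le_A : 2 ≤ A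
  A_eq : A * (b * δ * γ * ε) = L * c_m * s * ρ * c' * c_h
  tau_ge : 200 * b / (η * ε) * Real.log A ≤ τ
  tau_le : τ * η ^ 2 ≤ r ^ 2
  L_b : 1 < L * b ^ 3
  s_b : 1 < s * b ^ 3
  c'_b : 1 < c' * b ^ 2
  eta_eps : η * ε ≤ b

namespace AdmissibleParameters

variable {L ρ s c_m c' c_h γ δ b ε r η K A : ℝ} {τ : ℕ}
  (p : AdmissibleParameters L ρ s c_m c' c_h γ δ b ε r η K A τ)
include p

theorem delta_gamma_eps_le (k : ℕ) : δ * γ * ε ^ k ≤ 1 := by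
  have h1 := p.delta_pos
  have h2 := p.gamma_pos
  have h3 := p.eps_pos
  calc δ * γ * ε ^ k ≤ 1 * 1 * 1 ^ k := by
        gcongr
        · exact p.delta_lt.le
        · exact p.gamma_le
        · exact p.eps_le
    _ = 1 := by simp

/-- With `b = 1 - β`, the conditions keeping `β` away from 1 let `L`, `σ²` and `c'` absorb the
powers of `1/b` produced by momentum. -/
theorem inv_b_le : 1 / b ≤ L := by
  have h1 := p.b_pos
  have h2 : b ^ 3 ≤ b := by
    calc b ^ 3 ≤ b ^ 1 := pow_le_pow_of_le_one h1.le p.b_le (by norm_num)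
      _ = b := pow_one b
  rw [div_le_iff₀ h1]
  have h3 : L * b ^ 3 ≤ L * b := mul_le_mul_of_nonneg_left h2 (by linarith [p.one_le_L])
  linarith [p.L_b]

theorem inv_b_sq_le_s : 1 / b ^ 2 ≤ s := by
  have h1 := p.b_pos
  rw [div_le_iff₀ (by positivity)]
  have h2 : b ^ 3 ≤ b ^ 2 := pow_le_pow_of_le_one h1.le p.b_le (by norm_num)
  have h3 : s * b ^ 3 ≤ s * b ^ 2 := mul_le_mul_of_nonneg_left h2 (by linarith [p.one_le_s])
  linarith [p.s_b]

theorem inv_b_sq_le_c' : 1 / b ^ 2 ≤ c' := by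
  have h1 := p.b_pos
  rw [div_le_iff₀ (by positivity)]
  exact p.c'_b.le

theorem inv_b_cube_le : 1 / b ^ 3 ≤ L := by
  have h1 := p.b_pos
  rw [div_le_iff₀ (by positivity)]
  exact p.L_b.le

theorem eta_mul_le {M k : ℝ} (hM : 0 ≤ M) (hk : 1 ≤ k) (h : c_m ^ 2 * L * c' = M * k) :
    η * M ≤ 1 / 100 * (r * (δ * γ * ε ^ 3)) :=
  (mul_le_mul_of_nonneg_left (le_of_eq_mul_one_le hM hk h) p.eta_pos.le).trans p.eta_bound

theorem r_mul_le {M k : ℝ} (hM : 0 ≤ M) (hk : 1 ≤ k) (h : c_m ^ 3 * ρ * L * s * c_h = M * k) :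
    r * M ≤ 1 / 10000 * (δ * γ * ε ^ 2) :=
  (mul_le_mul_of_nonneg_left (le_of_eq_mul_one_le hM hk h) p.r_pos.le).trans p.r_eq.le

theorem eta_div_b_le : η / b ≤ r := by
  obtain ⟨h1, h2, h3, h4, h5, h6⟩ :=
    And.intro p.one_le_L (And.intro p.one_le_rho (And.intro p.one_le_s
      (And.intro p.one_le_cm (And.intro p.one_le_c' p.one_le_ch))))
  have hb := p.inv_b_le
  have hη := p.eta_pos
  have hr := p.r_pos
  have h7 := p.eta_mul_le (M := L) (k := c_m ^ 2 * c') (by linarith)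
    (one_le_mul_of_one_le_of_one_le (one_le_pow₀ h4) h5) (by ring)
  have h8 := mul_le_mul_of_nonneg_left (p.delta_gamma_eps_le 3) hr.le
  calc η / b = η * (1 / b) := by ring
    _ ≤ η * L := by gcongr
    _ ≤ r := by linarith

theorem eta_le : η ≤ r := by
  refine le_trans ?_ p.eta_div_b_le
  exact le_div_self p.eta_pos.le p.b_pos p.b_le

theorem r_cube_le : r * (ρ * c_m ^ 3) ≤ 1 / 10000 * (δ * γ * ε ^ 2) :=
  have h1 := p.one_le_cm
  have h2 := p.one_le_rho
  p.r_mul_le (k := L * s * c_h) (by positivity)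
    (one_le_mul_of_one_le_of_one_le (one_le_mul_of_one_le_of_one_le p.one_le_L p.one_le_s)
      p.one_le_ch) (by ring)

theorem r_cube_le_ch : r * (ρ * c_m ^ 3) ≤ c_h := by
  have := p.r_cube_le
  have := p.delta_gamma_eps_le 2
  linarith [p.one_le_ch]

theorem large_gradient_decrease :
    -(r / 2) * ε ^ 2 + r ^ 2 * (L * c_m ^ 2 + 3 * c_h) ≤ -K := by
  obtain ⟨h1, h2, h3, h4, h5, h6⟩ :=
    And.intro p.one_le_L (And.intro p.one_le_rho (And.intro p.one_le_s
      (And.intro p.one_le_cm (And.intro p.one_le_c' p.one_le_ch))))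
  have hr := p.r_pos
  have hε := p.eps_pos
  have hδ := p.delta_pos
  have hγ := p.gamma_pos
  have hdg : δ * γ ≤ 1 := mul_le_one₀ p.delta_lt.le hγ.le p.gamma_le
  have e1 := p.r_mul_le (M := L * c_m ^ 2) (k := c_m * ρ * s * c_h) (by positivity)
    (one_le_mul_of_one_le_of_one_le (one_le_mul_of_one_le_of_one_le
      (one_le_mul_of_one_le_of_one_le h4 h2) h3) h6) (by ring)
  have e2 := p.r_mul_le (M := c_h) (k := c_m ^ 3 * ρ * L * s) (by positivity)
    (one_le_mul_of_one_le_of_one_le (one_le_mul_of_one_le_of_one_le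
      (one_le_mul_of_one_le_of_one_le (one_le_pow₀ h4) h2) h1) h3) (by ring)
  have e3 : K ≤ K * (c_m * ρ * s) := le_mul_of_one_le_right p.K_pos.le
    (one_le_mul_of_one_le_of_one_le (one_le_mul_of_one_le_of_one_le h4 h2) h3)
  rw [p.K_eq] at e3
  have e4 : δ * γ * ε ^ 2 ≤ ε ^ 2 := mul_le_of_le_one_left (by positivity) hdg
  have e5 : r * γ * ε ^ 2 ≤ r * ε ^ 2 := by
    have := mul_le_mul_of_nonneg_left p.gamma_le (by positivity : 0 ≤ r * ε ^ 2)
    linarith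
  have e6 : r * (L * c_m ^ 2 + 3 * c_h) ≤ 4 / 10000 * ε ^ 2 := by linarith
  have e7 := mul_le_mul_of_nonneg_left e6 hr.le
  have e8 : 0 < r * ε ^ 2 := by positivity
  linarith

/-- The factor `δ` in `r` serves this comparison: the increase is quadratic in `r`, while `K` is
only linear in it. -/
theorem small_increase : 4 * r ^ 2 * c_h ≤ δ * K / 2 := by
  obtain ⟨h1, h2, h3, h4, h5, h6⟩ :=
    And.intro p.one_le_L (And.intro p.one_le_rho (And.intro p.one_le_s
      (And.intro p.one_le_cm (And.intro p.one_le_c' p.one_le_ch))))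
  have hr := p.r_pos
  have hε := p.eps_pos
  have hδ := p.delta_pos
  have hγ := p.gamma_pos
  have e1 := p.r_mul_le (M := c_h * (c_m * ρ * s)) (k := c_m ^ 2 * L) (by positivity)
    (one_le_mul_of_one_le_of_one_le (one_le_pow₀ h4) h1) (by ring)
  have e2 := mul_le_mul_of_nonneg_left e1 hr.le
  have e3 := p.K_eq
  have hpos : 0 < c_m * ρ * s := by positivity
  refine le_of_mul_le_mul_right ?_ hpos
  have e4 : δ * K / 2 * (c_m * ρ * s) = δ / 2 * (1 / 1000 * (r * γ * ε ^ 2)) := by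
    rw [← e3]
    ring
  rw [e4]
  have e5 : 0 < r * (δ * γ * ε ^ 2) := by positivity
  linarith

theorem log_ge : 69 / 100 ≤ Real.log A := by
  have h1 := Real.log_two_gt_d9
  have h2 := Real.log_le_log (by norm_num : (0 : ℝ) < 2) p.two_le_A
  linarith

/-- The constant is `200 · 0.69`, using `log A ≥ log 2`. -/
theorem period_ge : 138 * (b / (η * ε)) ≤ τ := by
  refine le_trans ?_ p.tau_ge
  have h1 := p.b_pos
  have h2 := p.eta_pos
  have h3 := p.eps_pos
  have h4 := p.log_ge
  calc _ = 200 * b / (η * ε) * (69 / 100) := by ring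
    _ ≤ _ := by gcongr

theorem two_le_period : 2 ≤ τ := by
  have h1 := p.period_ge
  have h2 : 1 ≤ b / (η * ε) := (one_le_div (mul_pos p.eta_pos p.eps_pos)).2 p.eta_eps
  have h3 : (2 : ℝ) ≤ τ := by linarith
  exact_mod_cast h3

/-- The period is at least a multiple of `b/(ηε)` yet `τη² ≤ r²`, so `η` is quadratically small in
`r`. This extra smallness controls the accumulated noise. -/
theorem eta_mul_b_le : 138 * (η * b) ≤ r ^ 2 * ε := by
  have h2 := p.eta_pos
  have h3 := p.eps_pos
  have h1 := mul_le_mul_of_nonneg_right (mul_le_mul_of_nonneg_right p.period_ge (sq_nonneg η)) h3.le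
  have h4 : 138 * (b / (η * ε)) * η ^ 2 * ε = 138 * (η * b) := by field_simp
  rw [h4] at h1
  exact h1.trans (mul_le_mul_of_nonneg_right p.tau_le h3.le)

theorem alignment_bound : c' * η * ε ≤ r * γ / 24 := by
  obtain ⟨h1, h2, h3, h4, h5, h6⟩ :=
    And.intro p.one_le_L (And.intro p.one_le_rho (And.intro p.one_le_s
      (And.intro p.one_le_cm (And.intro p.one_le_c' p.one_le_ch))))
  have hr := p.r_pos
  have hε := p.eps_pos
  have hγ := p.gamma_pos
  have hη := p.eta_pos
  have e1 := p.eta_mul_le (M := c') (k := c_m ^ 2 * L) (by linarith)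
    (one_le_mul_of_one_le_of_one_le (one_le_pow₀ h4) h1) (by ring)
  have e2 : δ * γ * ε ^ 3 ≤ γ := by
    calc _ ≤ 1 * γ * 1 ^ 3 := by
          gcongr
          · exact p.delta_lt.le
          · exact p.eps_le
      _ = γ := by ring
  have e3 := mul_le_mul_of_nonneg_left e2 hr.le
  have e4 : c' * η * ε ≤ η * c' := by
    rw [mul_comm c' η]
    exact mul_le_of_le_one_right (by positivity) p.eps_le
  have e5 : 0 < r * γ := by positivity
  linarith

theorem last_step_bound : ε * c_m * (η / b) ≤ r * γ / 24 := by
  obtain ⟨h1, h2, h3, h4, h5, h6⟩ :=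
    And.intro p.one_le_L (And.intro p.one_le_rho (And.intro p.one_le_s
      (And.intro p.one_le_cm (And.intro p.one_le_c' p.one_le_ch))))
  have hr := p.r_pos
  have hε := p.eps_pos
  have hγ := p.gamma_pos
  have hη := p.eta_pos
  have hb := p.inv_b_le
  have hb0 := p.b_pos
  have e1 := p.eta_mul_le (M := c_m * L) (k := c_m * c') (by positivity)
    (one_le_mul_of_one_le_of_one_le h4 h5) (by ring)
  have e2 : δ * γ * ε ^ 3 ≤ γ := by
    calc _ ≤ 1 * γ * 1 ^ 3 := by
          gcongr
          · exact p.delta_lt.le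
          · exact p.eps_le
      _ = γ := by ring
  have e3 := mul_le_mul_of_nonneg_left e2 hr.le
  have e4 : ε * c_m * (η / b) ≤ η * (c_m * L) := by
    calc _ = ε * (c_m * η * (1 / b)) := by ring
      _ ≤ 1 * (c_m * η * L) := by
          gcongr
          exact p.eps_le
      _ = _ := by ring
  have e5 : 0 < r * γ := by positivity
  linarith

theorem drift_bound : c_m * (L * η * c_m / b ^ 2 / ε) ≤ r * γ / 24 := by
  obtain ⟨h1, h2, h3, h4, h5, h6⟩ :=
    And.intro p.one_le_L (And.intro p.one_le_rho (And.intro p.one_le_s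
      (And.intro p.one_le_cm (And.intro p.one_le_c' p.one_le_ch))))
  have hr := p.r_pos
  have hε := p.eps_pos
  have hγ := p.gamma_pos
  have hη := p.eta_pos
  have hb := p.inv_b_sq_le_c'
  have e1 := p.eta_bound
  have e2 : δ * γ * ε ^ 2 ≤ γ := by
    calc _ ≤ 1 * γ * 1 ^ 2 := by
          gcongr
          · exact p.delta_lt.le
          · exact p.eps_le
      _ = γ := by ring
  have e3 := mul_le_mul_of_nonneg_left e2 hr.le
  calc _ = c_m ^ 2 * L * η * (1 / b ^ 2) / ε := by ring
    _ ≤ c_m ^ 2 * L * η * c' / ε := by gcongr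
    _ = η * (c_m ^ 2 * L * c') / ε := by ring
    _ ≤ 1 / 100 * (r * (δ * γ * ε ^ 3)) / ε := by gcongr
    _ = 1 / 100 * (r * (δ * γ * ε ^ 2)) := by field_simp
    _ ≤ r * γ / 24 := by
      have e5 : 0 < r * γ := by positivity
      linarith

theorem displacementConst_le :
    4 * (r ^ 2 * c_m ^ 2 + η ^ 2 * c_m ^ 2 / b ^ 2) ≤ 8 * r ^ 2 * c_m ^ 2 := by
  have h1 := p.eta_div_b_le
  have h2 := p.b_pos
  have h3 := p.eta_pos
  have h4 : η ^ 2 * c_m ^ 2 / b ^ 2 ≤ r ^ 2 * c_m ^ 2 := by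
    calc _ = (η / b) ^ 2 * c_m ^ 2 := by ring
      _ ≤ _ := by gcongr
  linarith

theorem const_remainder_bound {U : ℝ} (hU : U ≤ 8 * r ^ 2 * c_m ^ 2) :
    c_m * ρ * (U / ε) ≤ r * γ / 24 := by
  obtain ⟨h1, h2, h3, h4, h5, h6⟩ :=
    And.intro p.one_le_L (And.intro p.one_le_rho (And.intro p.one_le_s
      (And.intro p.one_le_cm (And.intro p.one_le_c' p.one_le_ch))))
  have hr := p.r_pos
  have hε := p.eps_pos
  have hγ := p.gamma_pos
  have e1 := p.r_cube_le
  have e2 : δ * γ * ε ≤ γ := by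
    calc _ ≤ 1 * γ * 1 := by
          gcongr
          · exact p.delta_lt.le
          · exact p.eps_le
      _ = γ := by ring
  have e3 := mul_le_mul_of_nonneg_left e2 hr.le
  calc _ ≤ c_m * ρ * (8 * r ^ 2 * c_m ^ 2 / ε) := by gcongr
    _ = 8 * r * (r * (ρ * c_m ^ 3)) / ε := by ring
    _ ≤ 8 * r * (1 / 10000 * (δ * γ * ε ^ 2)) / ε := by gcongr
    _ = 8 / 10000 * (r * (δ * γ * ε)) := by field_simp
    _ ≤ _ := by
      have e5 : 0 < r * γ := by positivity
      linarith

/-- The descent part is fixed by the choice of `K`, with `1/b²` absorbed into `s`. The noise part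
uses `eta_mul_b_le`, with `1/b³` absorbed into `L`. -/
theorem slope_remainder_bound :
    c_m * ρ * (4 * (η * (K + 4 * r ^ 2 * c_h) + η ^ 2 * s) / b ^ 2 * (2 / (η * ε ^ 2)))
      ≤ r * γ / 24 := by
  obtain ⟨h1, h2, h3, h4, h5, h6⟩ :=
    And.intro p.one_le_L (And.intro p.one_le_rho (And.intro p.one_le_s
      (And.intro p.one_le_cm (And.intro p.one_le_c' p.one_le_ch))))
  have hr := p.r_pos
  have hε := p.eps_pos
  have hγ := p.gamma_pos
  have hδ := p.delta_pos
  have hη := p.eta_pos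
  have hK := p.K_pos
  have hb := p.b_pos
  have hbs := p.inv_b_sq_le_s
  have hbL := p.inv_b_cube_le
  have e1 : K + 4 * r ^ 2 * c_h ≤ 2 * K := by
    have := mul_le_mul_of_nonneg_right p.delta_lt.le hK.le
    linarith [p.small_increase]
  have e0 : c_m * ρ * (4 * (η * (K + 4 * r ^ 2 * c_h) + η ^ 2 * s) / b ^ 2 * (2 / (η * ε ^ 2)))
      = 8 * (c_m * ρ * (K + 4 * r ^ 2 * c_h) * (1 / b ^ 2)) / ε ^ 2
        + 8 * (c_m * ρ * s * (η * b) * (1 / b ^ 3)) / ε ^ 2 := by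
    field_simp
    ring
  have e2 : 8 * (c_m * ρ * (K + 4 * r ^ 2 * c_h) * (1 / b ^ 2)) / ε ^ 2 ≤ 16 / 1000 * (r * γ) := by
    calc _ ≤ 8 * (c_m * ρ * (2 * K) * s) / ε ^ 2 := by gcongr
      _ = 16 * (K * (c_m * ρ * s)) / ε ^ 2 := by ring
      _ = 16 * (1 / 1000 * (r * γ * ε ^ 2)) / ε ^ 2 := by rw [p.K_eq]
      _ = _ := by field_simp
  have e3 : 8 * (c_m * ρ * s * (η * b) * (1 / b ^ 3)) / ε ^ 2 ≤ 1 / 1000 * (r * γ) := by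
    have e4 : η * b ≤ r ^ 2 * ε / 138 := by linarith [p.eta_mul_b_le]
    have e5 := p.r_mul_le (M := c_m * ρ * s * L) (k := c_m ^ 2 * c_h) (by positivity)
      (one_le_mul_of_one_le_of_one_le (one_le_pow₀ h4) h6) (by ring)
    have e6 : δ * γ * ε ≤ γ * ε := by
      have := mul_le_mul_of_nonneg_right p.delta_lt.le (by positivity : 0 ≤ γ * ε)
      linarith
    calc _ ≤ 8 * (c_m * ρ * s * (r ^ 2 * ε / 138) * L) / ε ^ 2 := by gcongr
      _ = 8 / 138 * r * (r * (c_m * ρ * s * L)) / ε := by field_simp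
      _ ≤ 8 / 138 * r * (1 / 10000 * (δ * γ * ε ^ 2)) / ε := by gcongr
      _ = 8 / 1380000 * r * (δ * γ * ε) := by field_simp; norm_num
      _ ≤ 8 / 1380000 * r * (γ * 1) := by
        have : δ * γ * ε ≤ γ * 1 := e6.trans (by gcongr; exact p.eps_le)
        gcongr
      _ ≤ _ := by
        have : 0 < r * γ := by positivity
        linarith
  rw [e0]
  have : 0 < r * γ := by positivity
  linarith

theorem slope_le {V : ℝ} (hV : c_m * ρ * (V * (2 / (η * ε ^ 2))) ≤ r * γ / 24) (hV0 : 0 ≤ V) :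
    V * τ ≤ r * γ * (η * ε * τ / b) / 48 := by
  have h2 := p.one_le_rho
  have h4 := p.one_le_cm
  have hr := p.r_pos
  have hε := p.eps_pos
  have hγ := p.gamma_pos
  have hη := p.eta_pos
  have hb := p.b_pos
  have e1 : V * (2 / (η * ε ^ 2)) ≤ r * γ / 24 := by
    refine le_trans ?_ hV
    exact le_mul_of_one_le_left (by positivity) (one_le_mul_of_one_le_of_one_le h4 h2)
  have e2 : V ≤ r * γ / 48 * (η * ε ^ 2) := by
    have e3 := mul_le_mul_of_nonneg_right e1 (by positivity : 0 ≤ η * ε ^ 2 / 2)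
    have e4 : V * (2 / (η * ε ^ 2)) * (η * ε ^ 2 / 2) = V := by field_simp
    rw [e4] at e3
    linarith
  have e5 : ε ^ 2 ≤ ε * (1 / b) := by
    have : 1 ≤ 1 / b := (one_le_div hb).2 p.b_le
    have h6 : ε ^ 2 ≤ ε := by
      rw [pow_two]
      exact mul_le_of_le_one_left hε.le p.eps_le
    exact h6.trans (le_mul_of_one_le_right hε.le this)
  calc V * τ ≤ r * γ / 48 * (η * ε ^ 2) * τ := by gcongr
    _ ≤ r * γ / 48 * (η * (ε * (1 / b))) * τ := by gcongr
    _ = _ := by ring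

/-- The constants entering `c_m²/γ` and `1/r` already occur in `A`, so three powers of `A` suffice
to dominate these quantities. -/
theorem cm_sq_le : c_m ^ 2 ≤ A ^ 3 * γ ∧ 1 / 10000 ≤ A ^ 3 * r := by
  obtain ⟨h1, h2, h3, h4, h5, h6⟩ :=
    And.intro p.one_le_L (And.intro p.one_le_rho (And.intro p.one_le_s
      (And.intro p.one_le_cm (And.intro p.one_le_c' p.one_le_ch))))
  have hr := p.r_pos
  have hε := p.eps_pos
  have hε1 := p.eps_le
  have hγ := p.gamma_pos
  have hγ1 := p.gamma_le
  have hδ := p.delta_pos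
  have hδ1 := p.delta_lt.le
  have hb := p.b_pos
  have hb1 := p.b_le
  have hA : 0 < A := by linarith [p.two_le_A]
  have e1 : L * c_m * s * ρ * c_h ≤ A * (δ * γ * ε) := by
    calc _ ≤ L * c_m * s * ρ * c' * c_h := le_of_eq_mul_one_le (by positivity) h5 (by ring)
      _ = A * (b * δ * γ * ε) := p.A_eq.symm
      _ ≤ A * (1 * δ * γ * ε) := by gcongr
      _ = _ := by ring
  have e2 : c_m ≤ A * ε := by
    calc c_m ≤ L * c_m * s * ρ * c_h := le_of_eq_mul_one_le (by positivity)
          (one_le_mul_of_one_le_of_one_le (one_le_mul_of_one_le_of_one_le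
            (one_le_mul_of_one_le_of_one_le h1 h3) h2) h6) (by ring)
      _ ≤ A * (δ * γ * ε) := e1
      _ ≤ A * (1 * 1 * ε) := by gcongr
      _ = _ := by ring
  have e3 : c_m ≤ A := e2.trans (mul_le_of_le_one_right hA.le hε1)
  have e4 : 1 ≤ A * γ := by
    calc 1 ≤ L * c_m * s * ρ * c_h := one_le_mul_of_one_le_of_one_le
          (one_le_mul_of_one_le_of_one_le (one_le_mul_of_one_le_of_one_le
            (one_le_mul_of_one_le_of_one_le h1 h4) h3) h2) h6
      _ ≤ A * (δ * γ * ε) := e1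
      _ ≤ A * (1 * γ * 1) := by gcongr
      _ = _ := by ring
  refine ⟨?_, ?_⟩
  · calc c_m ^ 2 ≤ A ^ 2 * 1 := by rw [mul_one]; gcongr
      _ ≤ A ^ 2 * (A * γ) := by gcongr
      _ = _ := by ring
  · have e5 : c_m ^ 3 * ρ * L * s * c_h ≤ A ^ 3 * (δ * γ * ε ^ 2) := by
      calc _ = (L * c_m * s * ρ * c_h) * c_m * c_m := by ring
        _ ≤ (A * (δ * γ * ε)) * (A * ε) * A := by gcongr
        _ = _ := by ring
    have e6 := p.r_eq
    have e7 : 0 < δ * γ * ε ^ 2 := by positivity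
    have e8 := mul_le_mul_of_nonneg_left e5 hr.le
    rw [e6] at e8
    refine le_of_mul_le_mul_right ?_ e7
    linarith

end AdmissibleParameters

/-- The strict inequality that rules out a small decrease over a period near a saddle point. -/
theorem AdmissibleParameters.escape {L ρ σ c_m c' c_h γ δ β ε r η K A : ℝ} {τ : ℕ}
    (p : AdmissibleParameters L ρ (σ ^ 2) c_m c' c_h γ δ (1 - β) ε r η K A τ) (hβ : 0 ≤ β)
    (hτ : 1 + 2 * β / (1 - β) ≤ τ) :
    decay η β ε (τ - 1) ^ 2
        * (displacementConst c_m β r η + displacementSlope σ c_h β r η K * τ)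
      < r ^ 2 * γ - 2 * r * (c' * η * ε) - 2 * r * (ε * c_m * (η / (1 - β)))
      - 2 * r * c_m * (L * η * c_m / (1 - β) ^ 2 / ε + ρ * (displacementConst c_m β r η / ε
        + displacementSlope σ c_h β r η K * (2 / (η * ε ^ 2)))) := by
  have hr := p.r_pos
  have hε := p.eps_pos
  have hγ := p.gamma_pos
  have hη := p.eta_pos
  have hb := p.b_pos
  have hK := p.K_pos
  have hch := p.one_le_ch
  have hU : displacementConst c_m β r η ≤ 8 * r ^ 2 * c_m ^ 2 := p.displacementConst_le
  have hV : c_m * ρ * (displacementSlope σ c_h β r η K * (2 / (η * ε ^ 2))) ≤ r * γ / 24 :=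
    p.slope_remainder_bound
  have hV0 : 0 ≤ displacementSlope σ c_h β r η K := by
    unfold displacementSlope
    positivity
  have hVτ := p.slope_le hV hV0
  have hx : 200 * Real.log A ≤ η * ε * τ / (1 - β) := by
    rw [le_div_iff₀ hb]
    have h1 := mul_le_mul_of_nonneg_left p.tau_ge (mul_pos hη hε).le
    have h2 : η * ε * (200 * (1 - β) / (η * ε) * Real.log A) = 200 * Real.log A * (1 - β) := by
      field_simp
    linarith
  have hdec : decay η β ε (τ - 1) ≤ Real.exp (-(η * ε * τ / (1 - β) / 8)) := by
    have h1 := decay_le_exp hη hβ (by linarith) hε ((le_div_iff₀ hε).2 p.eta_eps)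
      p.two_le_period hτ
    have h2 : η * ε * τ / (8 * (1 - β)) = η * ε * τ / (1 - β) / 8 := by
      rw [mul_comm 8, div_div]
    rwa [h2] at h1
  obtain ⟨hcA, hrA⟩ := p.cm_sq_le
  have key := half_lt_exp_bound hr hγ p.two_le_A hx (decay_pos hη.le hβ hε.le _).le hdec hU hVτ
    hcA hrA
  -- Each of the five corrections costs `2r · rγ/24`. Together they use `5/12` of `r²γ`, leaving
  -- more than the half required by `key`.
  have t1 := mul_le_mul_of_nonneg_left p.alignment_bound hr.le
  have t2 := mul_le_mul_of_nonneg_left p.last_step_bound hr.le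
  have t3 := mul_le_mul_of_nonneg_left p.drift_bound hr.le
  have t4 := mul_le_mul_of_nonneg_left (p.const_remainder_bound hU) hr.le
  have t5 := mul_le_mul_of_nonneg_left hV hr.le
  have t6 : 0 < r ^ 2 * γ := by positivity
  linarith

end Parameters

/-! ### From period estimates to the law of the returned point -/

section ReturnedPoint

variable {d : ℕ} {Ξ Ω : Type*} [MeasurableSpace Ξ] [MeasurableSpace Ω]

theorem isClosed_isSOSP {f : Vec d → ℝ} (hf : ContDiff ℝ 2 f) (ε : ℝ) :
    IsClosed {u | IsSOSP f ε u} := by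
  have h1 := continuous_gradient hf
  have h2 := continuous_hess hf
  have e : {u | IsSOSP f ε u} = {u | ‖gradient f u‖ ≤ ε} ∩
      ⋂ x : Vec d, {u | -ε * ‖x‖ ^ 2 ≤ inner ℝ x (hess f u x)} := by
    ext u
    simp [IsSOSP]
  rw [e]
  exact (isClosed_le (by fun_prop) (by fun_prop)).inter
    (isClosed_iInter fun x => isClosed_le (by fun_prop) (by fun_prop))

theorem returnLaw_apply {P : Measure Ω} [IsProbabilityMeasure P] {w : ℕ → Ω → Vec d}
    (hw : ∀ t, Measurable (w t)) (τ n : ℕ) {S : Set (Vec d)} (hS : MeasurableSet S) :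
    returnLaw P w τ n S
      = ENNReal.ofReal ((∑ k ∈ Finset.range (n + 1), P.real (w (k * τ) ⁻¹' S)) / (n + 1)) := by
  have hm : Measurable fun p : Ω × Fin (n + 1) => w ((p.2 : ℕ) * τ) p.1 :=
    measurable_from_prod_countable_left fun k => hw (k * τ)
  rw [returnLaw, Measure.map_apply hm hS, Measure.prod_apply_symm (hm hS), lintegral_fintype]
  have h1 : ∀ k : Fin (n + 1),
      P ((fun x => (x, k)) ⁻¹' ((fun p : Ω × Fin (n + 1) => w ((p.2 : ℕ) * τ) p.1) ⁻¹' S))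
        * (PMF.uniformOfFintype (Fin (n + 1))).toMeasure {k}
      = ENNReal.ofReal (P.real (w (k * τ) ⁻¹' S) / (n + 1)) := by
    intro k
    rw [PMF.toMeasure_apply_singleton _ _ (measurableSet_singleton k), PMF.uniformOfFintype_apply,
      Fintype.card_fin, ENNReal.ofReal_div_of_pos (by positivity), ofReal_measureReal,
      ENNReal.div_eq_inv_mul, mul_comm]
    congr 2
    rw [ENNReal.ofReal_add (by positivity) zero_le_one]
    simp
  rw [Finset.sum_congr rfl fun k _ => h1 k, Finset.sum_div,
    ENNReal.ofReal_sum_of_nonneg fun k _ => by positivity,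
    ← Fin.sum_univ_eq_sum_range
      (fun k => ENNReal.ofReal (P.real (w (k * τ) ⁻¹' S) / ((n : ℝ) + 1)))]

variable {D : Measure Ξ} {P : Measure Ω} [IsProbabilityMeasure D] [IsProbabilityMeasure P]
  {F : Vec d → Ξ → ℝ} {ξ : ℕ → Ω → Ξ}
  {w₀ : Vec d} {L ρ σ c_m c' c_h γ δ β r η ε K A Δ : ℝ} {τ : ℕ} {w g m : ℕ → Ω → Vec d}

namespace MomentumRun

variable (R : MomentumRun D P F ξ w₀ L ρ σ c_m β r η τ w g m)
include R

/-- Expected change of the objective over one period. -/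
theorem integral_period_le
    (p : AdmissibleParameters L ρ (σ ^ 2) c_m c' c_h γ δ (1 - β) ε r η K A τ)
    (hηL : η ≤ (1 - β) / L) (hτ : 1 + 2 * β / (1 - β) ≤ τ)
    (hCNC : CNC P (objective D F) ε γ w m) (hAPAG : APAG P (objective D F) ε w g m)
    (hAPCG : APCG P (objective D F) ε η β τ c' w m)
    (hGr : GrACE P (objective D F) (stepSize r η τ) c_h w g m) {t : ℕ} (ht : τ ∣ t) :
    ∫ ω, (objective D F (w (t + τ) ω) - objective D F (w t ω)) ∂P
      ≤ -K * (1 - P.real (w t ⁻¹' {u | IsSOSP (objective D F) ε u}))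
        + δ * K / 2 * P.real (w t ⁻¹' {u | IsSOSP (objective D F) ε u}) := by
  have hwm := R.measurable_past t
  have hcg := R.continuous_gradient
  set f := objective D F with hf
  -- Three disjoint cases at the start of the period: large gradient off `G`, strict saddle on `G \
  -- C`, and second-order stationarity on `C ⊆ G`. All are events of the past.
  set C : Set Ω := w t ⁻¹' {u | IsSOSP f ε u} with hC
  set G : Set Ω := w t ⁻¹' {u | ‖gradient f u‖ ≤ ε} with hG
  have hCm : MeasurableSet[past w t] C :=
    hwm (isClosed_isSOSP R.smooth.contDiff ε).measurableSet
  have hGm : MeasurableSet[past w t] G :=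
    hwm (isClosed_le (by fun_prop) (by fun_prop)).measurableSet
  have hCG : C ⊆ G := fun ω h => h.1
  have hint : Integrable (fun ω => f (w (t + τ) ω) - f (w t ω)) P :=
    (R.bddRV_objective (t + τ)).integrable.sub (R.bddRV_objective t).integrable
  have hC' := R.measurableSet_of_past hCm
  have hG' := R.measurableSet_of_past hGm
  have h2 := p.two_le_period
  have hch : 0 ≤ c_h := by linarith [p.one_le_ch]
  have hηε : η * ε ≤ 1 := p.eta_eps.trans p.b_le
  have a1 := R.setIntegral_period_le_of_large_gradient hGm.compl ht hGr hAPAG p.eps_pos.le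
    (fun ω (hω : ¬ ‖gradient f (w t ω)‖ ≤ ε) => (not_le.1 hω).le) (by omega) p.eta_le p.tau_le p.r_cube_le_ch hch
  have a2 := R.setIntegral_period_le_of_saddle (hGm.diff hCm) ht h2 p.eps_pos p.gamma_pos
    (by linarith [p.one_le_c']) hch p.K_pos.le (by linarith [p.one_le_L]) hηL hηε p.eta_le
    p.tau_le p.r_cube_le_ch (fun ω hω => hω.1) (fun ω hω hx => hω.2 ⟨hω.1, hx⟩) hCNC hAPCG hGr
    (p.escape R.beta_nonneg hτ)
  have a3 := R.setIntegral_period_le hCm ht hGr (by omega) p.eta_le p.tau_le p.r_cube_le_ch hch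
  have a4 : 0 ≤ r * ∫ ω in C, ‖gradient f (w t ω)‖ ^ 2 ∂P :=
    mul_nonneg p.r_pos.le (integral_nonneg fun _ => by positivity)
  have a5 : 0 ≤ η * ∑ i ∈ Finset.Ico 1 τ, ∫ ω in C, ‖gradient f (w (t + i) ω)‖ ^ 2 ∂P :=
    mul_nonneg p.eta_pos.le (Finset.sum_nonneg fun _ _ => integral_nonneg fun _ => by positivity)
  have a6 := mul_le_mul_of_nonneg_right p.large_gradient_decrease
    (measureReal_nonneg : 0 ≤ P.real Gᶜ)
  have a7 := mul_le_mul_of_nonneg_right p.small_increase (measureReal_nonneg : 0 ≤ P.real C)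
  have s1 : ∫ ω, (f (w (t + τ) ω) - f (w t ω)) ∂P
      = ∫ ω in G, (f (w (t + τ) ω) - f (w t ω)) ∂P
        + ∫ ω in Gᶜ, (f (w (t + τ) ω) - f (w t ω)) ∂P := (integral_add_compl hG' hint).symm
  have s2 : ∫ ω in G, (f (w (t + τ) ω) - f (w t ω)) ∂P
      = ∫ ω in C, (f (w (t + τ) ω) - f (w t ω)) ∂P
        + ∫ ω in G \ C, (f (w (t + τ) ω) - f (w t ω)) ∂P := by
    rw [← setIntegral_union Set.disjoint_sdiff_right (hG'.diff hC') hint.integrableOn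
      hint.integrableOn, Set.union_sdiff_cancel hCG]
  have m1 : P.real Gᶜ = 1 - P.real G := by
    rw [measureReal_compl hG', probReal_univ]
  have m2 : P.real (G \ C) = P.real G - P.real C := measureReal_sdiff hCG hC'
  rw [m2] at a2
  rw [m1] at a1 a6
  linarith

/-- The telescoped objective cannot fall by more than `Δ`, whereas each nonstationary period costs
`K` and each stationary one returns at most `δK/2`. For `Δ ≤ nδK/2` this gives an average stationary
probability of at least `(1 - δ/2)/(1 + δ/2) ≥ 1 - δ`. -/
theorem sum_prob_isSOSP_ge
    (p : AdmissibleParameters L ρ (σ ^ 2) c_m c' c_h γ δ (1 - β) ε r η K A τ)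
    (hηL : η ≤ (1 - β) / L) (hτ : 1 + 2 * β / (1 - β) ≤ τ)
    (hCNC : CNC P (objective D F) ε γ w m) (hAPAG : APAG P (objective D F) ε w g m)
    (hAPCG : APCG P (objective D F) ε η β τ c' w m)
    (hGr : GrACE P (objective D F) (stepSize r η τ) c_h w g m)
    (hΔ : ∀ u, objective D F w₀ - objective D F u ≤ Δ) {n : ℕ} (hn : Δ ≤ n * (δ * K / 2)) :
    (1 - δ) * n ≤ ∑ k ∈ Finset.range n,
      P.real (w (k * τ) ⁻¹' {u | IsSOSP (objective D F) ε u}) := by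
  have hi := fun t => (R.bddRV_objective t).integrable
  set q : ℕ → ℝ := fun k => P.real (w (k * τ) ⁻¹' {u | IsSOSP (objective D F) ε u}) with hq
  have h1 : ∀ n : ℕ, ∫ ω, (objective D F (w (n * τ) ω)) ∂P - objective D F w₀
      ≤ -K * n + K * (1 + δ / 2) * ∑ k ∈ Finset.range n, q k := by
    intro n
    induction n with
    | zero => simp [R.run.init]
    | succ n ih =>
      have h2 := R.integral_period_le p hηL hτ hCNC hAPAG hAPCG hGr (Dvd.intro_left n rfl)
      rw [integral_sub (hi _) (hi _)] at h2
      change _ ≤ -K * (1 - q n) + δ * K / 2 * q n at h2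
      rw [Finset.sum_range_succ, add_mul, one_mul]
      push_cast
      linarith
  have h2 : -Δ ≤ ∫ ω, (objective D F (w (n * τ) ω)) ∂P - objective D F w₀ := by
    have h3 : ∫ _, (objective D F w₀ - Δ) ∂P ≤ ∫ ω, (objective D F (w (n * τ) ω)) ∂P :=
      integral_mono (integrable_const _) (hi _) fun ω => by linarith [hΔ (w (n * τ) ω)]
    rw [integral_const, probReal_univ, one_smul] at h3
    linarith
  have h3 := h1 n
  have hK := p.K_pos
  have hδ := p.delta_pos
  have hδ1 := p.delta_lt
  have h4 : K * (1 - δ / 2) * n ≤ K * (1 + δ / 2) * ∑ k ∈ Finset.range n, q k := by linarith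
  have h5 : (1 - δ) * n * (K * (1 + δ / 2)) ≤ K * (1 - δ / 2) * n := by
    have : 0 ≤ K * δ ^ 2 * (n : ℝ) := by positivity
    linarith
  refine le_of_mul_le_mul_right ?_ (by positivity : 0 < K * (1 + δ / 2))
  linarith

end MomentumRun

end ReturnedPoint

/-! ### Choice of constants and conclusion -/

theorem logArg_mul {L ρ σ c_m c' c_h γ δ β ε : ℝ} (hγ : 0 < γ) (hδ : 0 < δ) (hβ : β < 1)
    (hε : 0 < ε) : logArg L ρ σ c_m c' c_h γ δ β ε * ((1 - β) * δ * γ * ε)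
      = L * c_m * σ ^ 2 * ρ * c' * c_h := by
  have : 0 < 1 - β := by linarith
  rw [logArg, div_mul_cancel₀]
  positivity

end

theorem theorem1 :
    -- absolute constants
    ∃ c₀ c₁ c₂ c₃ C : ℝ, 0 < c₀ ∧ 0 < c₁ ∧ 0 < c₂ ∧ 0 < c₃ ∧ 0 < C ∧
    ∀ (d : ℕ) (Ξ : Type*) (Ω : Type*) [MeasurableSpace Ξ] [MeasurableSpace Ω]
      (D : Measure Ξ) (P : Measure Ω) [IsProbabilityMeasure D] [IsProbabilityMeasure P]
      (F : Vec d → Ξ → ℝ) (ξ : ℕ → Ω → Ξ) (w g m : ℕ → Ω → Vec d) (w₀ : Vec d)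
      (L ρ σ c_m c' c_h γ δ β ε r η c_η F_thred Δ T : ℝ) (τ : ℕ),
    -- normalization of the constants
    1 ≤ L → 1 ≤ ρ → 1 ≤ σ ^ 2 → 1 ≤ c_m → 1 ≤ c' → 1 ≤ c_h →
    0 < γ → γ ≤ 1 → 0 < δ → δ < 1 → 0 < ε → ε ≤ 1 → 0 ≤ β → β < 1 →
    2 ≤ logArg L ρ σ c_m c' c_h γ δ β ε →
    -- the problem and the algorithm
    SmoothStochastic D F L ρ σ →
    IIDSamples P D ξ →
    HeavyBall F ξ w₀ β r η τ w g m →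
    (∀ t, ∀ᵐ ω ∂P, ‖m t ω‖ ≤ c_m) →
    (∀ u, objective D F w₀ - objective D F u ≤ Δ) →
    -- the choice of the parameters
    r = δ * γ * ε ^ 2 * (c₀ / (c_m ^ 3 * ρ * L * σ ^ 2 * c_h)) →
    0 < c_η → c_η ≤ c₁ / (c_m ^ 5 * ρ * L ^ 2 * σ ^ 2 * c' * c_h) →
    η = δ ^ 2 * γ ^ 2 * ε ^ 5 * c_η →
    c₃ * (1 - β) / (η * ε) * Real.log (logArg L ρ σ c_m c' c_h γ δ β ε) ≤ τ →
    η ≤ r / √(τ : ℝ) →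
    F_thred = δ * γ ^ 2 * ε ^ 4 * (c₂ / (c_m ^ 4 * ρ ^ 2 * L * σ ^ 4 * c_h)) →
    T = 2 * τ * Δ / (δ * F_thred) →
    -- the constraints on `β`
    1 < L * (1 - β) ^ 3 → 1 < σ ^ 2 * (1 - β) ^ 3 → 1 < c' * (1 - β) ^ 2 →
    η ≤ (1 - β) / L → η ≤ (1 - β) / ε → 1 + 2 * β / (1 - β) ≤ τ →
    -- the properties of the stochastic momentum
    CNC P (objective D F) ε γ w m →
    APAG P (objective D F) ε w g m →
    APCG P (objective D F) ε η β τ c' w m →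
    GrACE P (objective D F) (stepSize r η τ) c_h w g m →
    -- the returned point is second-order stationary with probability at least `1 - δ`
    ENNReal.ofReal (1 - δ) ≤
        returnLaw P w τ ⌊T / τ⌋₊ {u | IsSOSP (objective D F) ε u} ∧
    -- the number of iterations for the smallest admissible period
    (τ = ⌈c₃ * (1 - β) / (η * ε) * Real.log (logArg L ρ σ c_m c' c_h γ δ β ε)⌉₊ →
      τ ≤ C / (δ ^ 2 * γ ^ 2 * c_η)
          * ((1 - β) * Real.log (logArg L ρ σ c_m c' c_h γ δ β ε) / ε ^ 6) ∧
      T ≤ C * (Δ * c_m ^ 4 * ρ ^ 2 * L * σ ^ 4 * c_h / (δ ^ 4 * γ ^ 4 * c_η))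
          * ((1 - β) * Real.log (logArg L ρ σ c_m c' c_h γ δ β ε) / ε ^ 10)) := by
  -- The last constant is `2 · 2 · 200 · 10⁷`: the 2 in `T`, the rounding of `τ`, the constant in
  -- the period, and the inverse of the threshold constant.
  refine ⟨1 / 10000, 1 / 1000000, 1 / 10000000, 200, 8000000000, by norm_num, by norm_num,
    by norm_num, by norm_num, by norm_num, ?_⟩
  intro d Ξ Ω _ _ D P _ _ F ξ w g m w₀ L ρ σ c_m c' c_h γ δ β ε r η c_η K Δ T τ
    hL hρ hσ hcm hc' hch hγ hγ1 hδ hδ1 hε hε1 hβ hβ1 hA hF hξ hrun hm hΔ hr hcη hcη1 hη hτ hητ hK hT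
    hLβ hσβ hcβ hηL hηε hτβ hCNC hAPAG hAPCG hGr
  have hb : 0 < 1 - β := by linarith
  have hr0 : 0 < r := by rw [hr]; positivity
  have hη0 : 0 < η := by rw [hη]; positivity
  have hσ0 : 0 < σ ^ 2 := by linarith
  have hσ4 : σ ^ 4 = (σ ^ 2) ^ 2 := by ring
  rw [hσ4] at hK
  have hK0 : 0 < K := by rw [hK]; positivity
  have hτ0 : (0 : ℝ) < τ := by
    have : 0 ≤ 2 * β / (1 - β) := by positivity
    linarith
  have hτη : τ * η ^ 2 ≤ r ^ 2 := by
    rw [le_div_iff₀ (Real.sqrt_pos.2 hτ0)] at hητ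
    have h1 := pow_le_pow_left₀ (by positivity) hητ 2
    rwa [mul_pow, Real.sq_sqrt hτ0.le, mul_comm] at h1
  have R : MomentumRun D P F ξ w₀ L ρ σ c_m β r η τ w g m :=
    ⟨hF, hξ, hrun, hm, by linarith, by linarith, by linarith, hr0, hη0, hβ, hβ1⟩
  have p : AdmissibleParameters L ρ (σ ^ 2) c_m c' c_h γ δ (1 - β) ε r η K
      (logArg L ρ σ c_m c' c_h γ δ β ε) τ :=
    { one_le_L := hL, one_le_rho := hρ, one_le_s := hσ, one_le_cm := hcm, one_le_c' := hc',
      one_le_ch := hch, gamma_pos := hγ, gamma_le := hγ1, delta_pos := hδ, delta_lt := hδ1,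
      eps_pos := hε, eps_le := hε1, b_pos := hb, b_le := by linarith, r_pos := hr0,
      eta_pos := hη0, K_pos := hK0,
      eta_bound := step_size_bound hL hρ hσ hcm hc' hch hδ hγ hε hr hcη1 hη,
      r_eq := large_step_eq hL hρ hσ hcm hch hr,
      K_eq := threshold_eq hL hρ hσ hcm hch hr hK,
      two_le_A := hA, A_eq := logArg_mul hγ hδ hβ1 hε, tau_ge := hτ, tau_le := hτη, L_b := hLβ,
      s_b := hσβ, c'_b := hcβ, eta_eps := (le_div_iff₀ hε).1 hηε }
  have hΔ0 : 0 ≤ Δ := by simpa using hΔ w₀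
  refine ⟨?_, fun hceil => ?_⟩
  · rw [returnLaw_apply (fun t => (R.bddRV_iterate t).1) τ _
      (isClosed_isSOSP hF.contDiff ε).measurableSet]
    refine ENNReal.ofReal_le_ofReal ?_
    rw [le_div_iff₀ (by positivity)]
    -- Indices `0, …, ⌊T/τ⌋` give `⌊T/τ⌋ + 1 > T/τ` sampled points, so the count covers `2Δ/(δK)`
    -- despite the rounding down.
    have hn : Δ ≤ ((⌊T / τ⌋₊ + 1 : ℕ) : ℝ) * (δ * K / 2) := by
      have h1 := (Nat.lt_floor_add_one (T / τ)).le
      have h2 : T / τ * (δ * K / 2) = Δ := by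
        rw [hT]
        field_simp
      have h3 := mul_le_mul_of_nonneg_right h1 (by positivity : 0 ≤ δ * K / 2)
      rw [h2] at h3
      push_cast
      exact h3
    have h := R.sum_prob_isSOSP_ge p hηL hτβ hCNC hAPAG hAPCG hGr hΔ hn
    push_cast at h
    exact h
  · set ℓ := Real.log (logArg L ρ σ c_m c' c_h γ δ β ε) with hℓ
    have hℓ0 : 69 / 100 ≤ ℓ := p.log_ge
    set y := 200 * (1 - β) / (η * ε) * ℓ with hy
    have hy1 : 1 ≤ y := by
      have h1 : 1 ≤ (1 - β) / (η * ε) := (one_le_div (by positivity)).2 p.eta_eps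
      have h2 : y = (1 - β) / (η * ε) * (200 * ℓ) := by rw [hy]; ring
      rw [h2]
      exact one_le_mul_of_one_le_of_one_le h1 (by linarith)
    -- Rounding up adds at most 1, which is absorbed because `y ≥ 1`.
    have hτy : (τ : ℝ) ≤ 2 * y := by
      rw [hceil]
      have := (Nat.ceil_lt_add_one (by linarith : 0 ≤ y)).le
      linarith
    have hye : y = 200 / (δ ^ 2 * γ ^ 2 * c_η) * ((1 - β) * ℓ / ε ^ 6) := by
      rw [hy, hη]
      field_simp
    have hX : 0 ≤ 1 / (δ ^ 2 * γ ^ 2 * c_η) * ((1 - β) * ℓ / ε ^ 6) := by positivity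
    refine ⟨?_, ?_⟩
    · have e1 : 8000000000 / (δ ^ 2 * γ ^ 2 * c_η) * ((1 - β) * ℓ / ε ^ 6)
          = 8000000000 * (1 / (δ ^ 2 * γ ^ 2 * c_η) * ((1 - β) * ℓ / ε ^ 6)) := by ring
      have e2 : 200 / (δ ^ 2 * γ ^ 2 * c_η) * ((1 - β) * ℓ / ε ^ 6)
          = 200 * (1 / (δ ^ 2 * γ ^ 2 * c_η) * ((1 - β) * ℓ / ε ^ 6)) := by ring
      rw [e1]
      rw [e2] at hye
      linarith
    · rw [hT]
      calc 2 * τ * Δ / (δ * K) ≤ 2 * (2 * y) * Δ / (δ * K) := by gcongr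
        _ = _ := by
          rw [hye, hK]
          field_simp
          ring
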